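/- **Theorem.** Let $\mathcal P$ be a set of prime numbers (possibly empty) and let $G=\bigoplus_{p\in\mathcal P}C_p\times C_p$. For $p\in\mathcal P$ let $\pi_p\colon G\to G$ be the endomorphism that replaces the $p$-component by $1$, and let $A_p=\coprod_{[G:H]=p}G/H$, where $H$ ranges over the subgroups of $G$ of index $p$; put $A=\coprod_{p\in\mathcal P}A_p$ and $X=A\times\mathbb N$. Let $G$ act self-similarly on the free monoid $X^*$ by translating cosets, $g(a,i)=(ga,i)$, with sections $g|_{(a,i)}=\pi_p(g)$ for $a\in A_p$ (the countable inflation of the analogous action over $A$); thus $g(xu)=g(x)\,g|_x(u)$ for $x\in X$, $u\in X^*$. Let $M=X^*G$ be the left cancellative monoid with elements $ug$ ($u\in X^*$, $g\in G$) and product $(ug)(vh)=(u\,g(v))(g|_v h)$, where $g|_\varepsilon=g$ and $g|_{xu}=(g|_x)|_u$, and let $S$ be its inverse hull with zero, that is, the inverse monoid of partial bijections of $M$ generated by the left multiplications by elements of $M$ together with the empty map $0$. (If $\mathcal P\neq\emptyset$ then $X$ is infinite; if $\mathcal P=\emptyset$ then $S=\{0,1\}$.) Then the action of $G$ on $X^*$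 is faithful, $S$ is a countable inverse semigroup with zero, and $S$ is congruence-free (its only congruences are equality and the universal relation). For every field $K$, the contracted semigroup algebra $K_0S$ (the $K$-algebra with basis $S\setminus\{0\}$ and product induced by that of $S$) is simple if and only if $\operatorname{char}K\notin\mathcal P$. In particular, if $\mathcal P$ is the set of all primes, then $K_0S$ is simple if and only if $\operatorname{char}K=0$. Moreover, let $\mathcal G(S)$ be the (contracted) universal groupoid of $S$, that is, the groupoid of germs of the action of $S$ on the space of nonzero zero-preserving homomorphisms $E(S)\to\{0,1\}$, where $E(S)$ is the semilattice of idempotents of $S$. Then $\mathcal G(S)$ is an ample groupoid that is second countable, minimal (the unit space has no proper non-empty open invariant subset) and effective (the interior of the isotropy is the unit space), and, for every field $K$, its Steinberg algebra $K\mathcal G(S)$ (the span of the characteristic functions of compact local bisections, under convolution) is simple if and only if $\operatorname{char}K\notin\mathcal P$. -/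

import Mathlib

/-! ### Inverse monoids with zero -/

/-- A monoid with zero in which every `s` has a unique inverse `pinv s`, usually written `s*`. -/
class InverseMonoidWithZero (S : Type*) extends MonoidWithZero S where
  pinv : S → S
  mul_pinv_mul : ∀ s : S, s * pinv s * s = s
  pinv_mul_pinv : ∀ s : S, pinv s * s * pinv s = pinv s
  pinv_unique : ∀ s t : S, s * t * s = s → t * s * t = t → t = pinv s

/-- The only congruences are the equality relation and the universal relation. -/
def IsCongruenceFree (S : Type*) [Mul S] : Prop :=
  ∀ c : Con S, c = ⊥ ∨ c = ⊤

/-- The contracted semigroup algebra `K₀S`: the semigroup algebra `KS` modulo the ideal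
generated by (equivalently, the line spanned by) the basis element `0 ∈ S`. -/
abbrev ContractedAlgebra (K S : Type*) [Field K] [MonoidWithZero S] : Type _ :=
  (TwoSidedIdeal.span ({MonoidAlgebra.single (0 : S) (1 : K)} :
    Set (MonoidAlgebra K S))).ringCon.Quotient

namespace InverseMonoidWithZero

section Basic

variable {S : Type*} [InverseMonoidWithZero S]

theorem pinv_idem {e : S} (he : e * e = e) : pinv e = e :=
  (pinv_unique e e (by rw [he, he]) (by rw [he, he])).symm

theorem pinv_pinv (s : S) : pinv (pinv s) = s :=
  (pinv_unique (pinv s) s (pinv_mul_pinv s) (mul_pinv_mul s)).symm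

theorem idem_mul_idem {e f : S} (he : e * e = e) (hf : f * f = f) :
    (e * f) * (e * f) = e * f := by
  set x := pinv (e * f) with hx
  have h1 : e * f * x * (e * f) = e * f := mul_pinv_mul _
  have h2 : x * (e * f) * x = x := pinv_mul_pinv _
  have h3 : f * x * e = x := by
    refine pinv_unique (e * f) (f * x * e) ?_ ?_
    · calc e * f * (f * x * e) * (e * f) = e * (f * f) * x * ((e * e) * f) := by
            simp only [mul_assoc]
        _ = e * f := by rw [he, hf, h1]
    · calc f * x * e * (e * f) * (f * x * e)
          = f * (x * ((e * e) * (f * f)) * x) * e := by simp only [mul_assoc]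
        _ = f * x * e := by rw [he, hf, h2]
  have hxx : x * x = x := by
    calc x * x = (f * x * e) * (f * x * e) := by rw [h3]
      _ = f * (x * (e * f) * x) * e := by simp only [mul_assoc]
      _ = x := by rw [h2, h3]
  have h4 : e * f = x := by
    have h5 : pinv x = x := pinv_idem hxx
    rw [hx, pinv_pinv] at h5
    rw [h5, hx]
  rw [h4, hxx]

theorem idem_comm {e f : S} (he : e * e = e) (hf : f * f = f) : e * f = f * e := by
  have h1 := idem_mul_idem he hf
  have h2 := idem_mul_idem hf he
  have h3 : f * e = pinv (e * f) := by
    refine pinv_unique _ _ ?_ ?_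
    · calc e * f * (f * e) * (e * f) = e * (f * f) * ((e * e) * f) := by simp only [mul_assoc]
        _ = e * f := by rw [he, hf, h1]
    · calc f * e * (e * f) * (f * e) = f * (e * e) * ((f * f) * e) := by simp only [mul_assoc]
        _ = f * e := by rw [he, hf, h2]
  rw [h3, pinv_idem h1]

theorem pinv_mul_self_idem (s : S) : (pinv s * s) * (pinv s * s) = pinv s * s := by
  rw [← mul_assoc, pinv_mul_pinv]

theorem self_mul_pinv_idem (s : S) : (s * pinv s) * (s * pinv s) = s * pinv s := by
  rw [← mul_assoc, mul_pinv_mul]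

theorem pinv_mul_rev (s t : S) : pinv (s * t) = pinv t * pinv s := by
  have hc := idem_comm (self_mul_pinv_idem t) (pinv_mul_self_idem s)
  refine (pinv_unique _ _ ?_ ?_).symm
  · calc s * t * (pinv t * pinv s) * (s * t)
        = s * ((t * pinv t) * (pinv s * s)) * t := by simp only [mul_assoc]
      _ = (s * pinv s * s) * (t * pinv t * t) := by rw [hc]; simp only [mul_assoc]
      _ = s * t := by rw [mul_pinv_mul, mul_pinv_mul]
  · calc pinv t * pinv s * (s * t) * (pinv t * pinv s)
        = pinv t * ((pinv s * s) * (t * pinv t)) * pinv s := by simp only [mul_assoc]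
      _ = (pinv t * t * pinv t) * (pinv s * s * pinv s) := by
          rw [← hc]; simp only [mul_assoc]
      _ = pinv t * pinv s := by rw [pinv_mul_pinv, pinv_mul_pinv]

theorem conj_idem (s : S) {e : S} (he : e * e = e) :
    (pinv s * e * s) * (pinv s * e * s) = pinv s * e * s := by
  have hc := idem_comm (self_mul_pinv_idem s) he
  calc (pinv s * e * s) * (pinv s * e * s)
      = pinv s * e * ((s * pinv s) * e) * s := by simp only [mul_assoc]
    _ = pinv s * (e * e) * (s * pinv s * s) := by rw [hc]; simp only [mul_assoc]
    _ = pinv s * e * s := by rw [he, mul_pinv_mul]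

end Basic

/-! ### Idempotents, characters and the spectrum -/

/-- The semilattice `E(S)` of idempotents. -/
def Idem (S : Type*) [InverseMonoidWithZero S] : Type _ := {e : S // e * e = e}

section Spectrum

variable {S : Type*} [InverseMonoidWithZero S]

instance : Zero (Idem S) := ⟨⟨0, zero_mul 0⟩⟩
instance : One (Idem S) := ⟨⟨1, one_mul 1⟩⟩
instance : Mul (Idem S) := ⟨fun e f => ⟨e.1 * f.1, idem_mul_idem e.2 f.2⟩⟩

/-- The idempotent `s* s`. -/
def dom (s : S) : Idem S := ⟨pinv s * s, pinv_mul_self_idem s⟩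

/-- The idempotent `s* e s`. -/
def conj (s : S) (e : Idem S) : Idem S := ⟨pinv s * e.1 * s, conj_idem s e.2⟩

/-- The natural partial order: `u ≤ s` iff `u ∈ s E(S)`. -/
def NatLE (u s : S) : Prop := ∃ e : Idem S, u = s * e.1

theorem idem_mul_comm (e f : Idem S) : e.1 * f.1 = f.1 * e.1 := idem_comm e.2 f.2

end Spectrum

/-- The spectrum of `E(S)`: nonzero, zero-preserving homomorphisms `E(S) → {0,1}`. -/
structure Spectrum (S : Type*) [InverseMonoidWithZero S] where
  toFun : Idem S → Bool
  map_zero : toFun 0 = false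
  map_mul : ∀ e f, toFun (e * f) = (toFun e && toFun f)
  nonzero : ∃ e, toFun e = true

section Action

variable {S : Type*} [InverseMonoidWithZero S]

/-- The topology of pointwise convergence. -/
instance : TopologicalSpace (Spectrum S) :=
  TopologicalSpace.induced Spectrum.toFun inferInstance

theorem Spectrum.ext' {θ η : Spectrum S} (h : ∀ e, θ.toFun e = η.toFun e) : θ = η := by
  cases θ; cases η; congr; exact funext h

theorem Spectrum.map_one (θ : Spectrum S) : θ.toFun 1 = true := by
  obtain ⟨e, he⟩ := θ.nonzero
  have h : (1 : Idem S) * e = e := Subtype.ext (one_mul e.1)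
  have h2 := θ.map_mul 1 e
  rw [h, he] at h2
  simpa using h2.symm

/-- `D(e) = {θ : θ(e) = 1}`. -/
def basicD (e : Idem S) : Set (Spectrum S) := {θ | θ.toFun e = true}

/-- The action of `S` on the spectrum: `(sθ)(e) = θ(s* e s)` for `θ ∈ D(s* s)`. -/
def act (s : S) (θ : Spectrum S) (h : θ ∈ basicD (dom s)) : Spectrum S where
  toFun e := θ.toFun (conj s e)
  map_zero := by
    have : conj s 0 = 0 := Subtype.ext (by
      change pinv s * 0 * s = 0
      rw [mul_zero, zero_mul])
    rw [this]; exact θ.map_zero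
  map_mul e f := by
    have : conj s (e * f) = conj s e * conj s f := Subtype.ext (by
      change pinv s * (e.1 * f.1) * s = (pinv s * e.1 * s) * (pinv s * f.1 * s)
      have hc := idem_comm (self_mul_pinv_idem s) f.2
      calc pinv s * (e.1 * f.1) * s = pinv s * e.1 * f.1 * (s * pinv s * s) := by
            rw [mul_pinv_mul]; simp only [mul_assoc]
        _ = pinv s * e.1 * (f.1 * (s * pinv s)) * s := by simp only [mul_assoc]
        _ = _ := by rw [← hc]; simp only [mul_assoc])
    rw [this]; exact θ.map_mul _ _
  nonzero := ⟨1, by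
    have : conj s 1 = dom s := Subtype.ext (by
      change pinv s * 1 * s = pinv s * s
      rw [mul_one])
    rw [this]; exact h⟩

/-! ### The universal groupoid -/

/-- Pairs `(s, θ)` with `θ ∈ D(s* s)`. -/
structure PreGerm (S : Type*) [InverseMonoidWithZero S] where
  elt : S
  pt : Spectrum S
  mem : pt ∈ basicD (dom elt)

/-- `(s, θ) ∼ (t, η)` iff `θ = η` and some `u ≤ s, t` has `θ ∈ D(u* u)`. -/
def PreGerm.Rel (a b : PreGerm S) : Prop :=
  a.pt = b.pt ∧ ∃ u : S, NatLE u a.elt ∧ NatLE u b.elt ∧ a.pt ∈ basicD (dom u)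

theorem mul_dom_of_natLE {u s : S} (h : NatLE u s) : s * (dom u).1 = u := by
  obtain ⟨e, rfl⟩ := h
  change s * (pinv (s * e.1) * (s * e.1)) = s * e.1
  have h1 : e.1 * (pinv (s * e.1) * (s * e.1)) = pinv (s * e.1) * (s * e.1) := by
    have h2 : (pinv (s * e.1) * (s * e.1)) * e.1 = pinv (s * e.1) * (s * e.1) := by
      simp only [mul_assoc, e.2]
    rw [idem_comm e.2 (pinv_mul_self_idem _), h2]
  calc s * (pinv (s * e.1) * (s * e.1))
      = (s * e.1) * pinv (s * e.1) * (s * e.1) := by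
        rw [← h1]; simp only [mul_assoc]
    _ = s * e.1 := mul_pinv_mul _

theorem dom_mul_idem (s : S) (e : Idem S) : dom (s * e.1) = dom s * e := Subtype.ext (by
  change pinv (s * e.1) * (s * e.1) = pinv s * s * e.1
  rw [pinv_mul_rev, pinv_idem e.2]
  calc e.1 * pinv s * (s * e.1) = (e.1 * (pinv s * s)) * e.1 := by simp only [mul_assoc]
    _ = pinv s * s * (e.1 * e.1) := by
        rw [idem_comm e.2 (pinv_mul_self_idem s)]; simp only [mul_assoc]
    _ = _ := by rw [e.2])

theorem PreGerm.rel_iff (a b : PreGerm S) :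
    a.Rel b ↔ a.pt = b.pt ∧ ∃ e : Idem S, a.pt ∈ basicD e ∧ a.elt * e.1 = b.elt * e.1 := by
  refine and_congr_right fun _ => ⟨?_, ?_⟩
  · rintro ⟨u, h1, h2, h3⟩
    exact ⟨dom u, h3, by rw [mul_dom_of_natLE h1, mul_dom_of_natLE h2]⟩
  · rintro ⟨e, h1, h2⟩
    refine ⟨a.elt * e.1, ⟨e, rfl⟩, ⟨e, h2⟩, ?_⟩
    have h3 := a.mem
    change a.pt.toFun (dom (a.elt * e.1)) = true
    rw [dom_mul_idem, a.pt.map_mul]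
    change a.pt.toFun _ = true at h1 h3
    rw [h1, h3]; rfl

theorem mem_basicD_mul {θ : Spectrum S} {e f : Idem S} (he : θ ∈ basicD e) (hf : θ ∈ basicD f) :
    θ ∈ basicD (e * f) := by
  change θ.toFun _ = true at he hf ⊢
  rw [θ.map_mul, he, hf]; rfl

theorem PreGerm.rel_equivalence : Equivalence (PreGerm.Rel (S := S)) where
  refl a := (a.rel_iff a).2 ⟨rfl, dom a.elt, a.mem, rfl⟩
  symm := by
    rintro a b ⟨h, u, h1, h2, h3⟩
    exact ⟨h.symm, u, h2, h1, h ▸ h3⟩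
  trans := by
    intro a b c hab hbc
    obtain ⟨h, e, he, hab⟩ := (a.rel_iff b).1 hab
    obtain ⟨h', f, hf, hbc⟩ := (b.rel_iff c).1 hbc
    refine (a.rel_iff c).2 ⟨h.trans h', e * f, mem_basicD_mul he (h ▸ hf), ?_⟩
    change a.elt * (e.1 * f.1) = c.elt * (e.1 * f.1)
    calc a.elt * (e.1 * f.1) = a.elt * e.1 * f.1 := (mul_assoc _ _ _).symm
      _ = b.elt * f.1 * e.1 := by rw [hab, mul_assoc, idem_mul_comm, ← mul_assoc]
      _ = c.elt * (e.1 * f.1) := by rw [hbc, mul_assoc, idem_mul_comm]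

instance PreGerm.setoid (S : Type*) [InverseMonoidWithZero S] : Setoid (PreGerm S) :=
  ⟨PreGerm.Rel, PreGerm.rel_equivalence⟩

theorem act_congr {s t : S} {θ : Spectrum S} (hs : θ ∈ basicD (dom s)) (ht : θ ∈ basicD (dom t))
    {e : Idem S} (he : θ ∈ basicD e) (h : s * e.1 = t * e.1) : act s θ hs = act t θ ht := by
  have key : ∀ (s : S) (f : Idem S), θ.toFun (conj s f) = θ.toFun (conj (s * e.1) f) := by
    intro s f
    have h1 : conj (s * e.1) f = e * conj s f * e := Subtype.ext (by
      change pinv (s * e.1) * f.1 * (s * e.1) = e.1 * (pinv s * f.1 * s) * e.1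
      rw [pinv_mul_rev, pinv_idem e.2]; simp only [mul_assoc])
    change θ.toFun e = true at he
    rw [h1, θ.map_mul, θ.map_mul, he, Bool.true_and, Bool.and_true]
  refine Spectrum.ext' fun f => ?_
  change θ.toFun (conj s f) = θ.toFun (conj t f)
  rw [key s, key t, h]

end Action

/-- The (contracted) universal groupoid `𝒢(S)`, as the set of germs `[s, θ]` of the action of `S`
on its spectrum. -/
def UniversalGroupoid (S : Type*) [InverseMonoidWithZero S] : Type _ :=
  Quotient (PreGerm.setoid S)

namespace UniversalGroupoid

variable {S : Type*} [InverseMonoidWithZero S]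

/-- The germ `[s, θ]`. -/
def mk (s : S) (θ : Spectrum S) (h : θ ∈ basicD (dom s)) : UniversalGroupoid S :=
  Quotient.mk (PreGerm.setoid S) ⟨s, θ, h⟩

theorem mk_eq_mk {s t : S} {θ η : Spectrum S} {hs : θ ∈ basicD (dom s)}
    {ht : η ∈ basicD (dom t)} : mk s θ hs = mk t η ht ↔
      θ = η ∧ ∃ e : Idem S, θ ∈ basicD e ∧ s * e.1 = t * e.1 :=
  Quotient.eq.trans (PreGerm.rel_iff _ _)

theorem ind {p : UniversalGroupoid S → Prop} (h : ∀ s θ hs, p (mk s θ hs)) (a) : p a :=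
  Quotient.ind (fun a => h a.elt a.pt a.mem) a

/-- The basic open set `(s, U) = {[s, θ] : θ ∈ U}`, where `U ⊆ D(s* s)`. -/
def slice (s : S) (U : Set (Spectrum S)) (hU : U ⊆ basicD (dom s)) : Set (UniversalGroupoid S) :=
  {a | ∃ (θ : Spectrum S) (h : θ ∈ U), a = mk s θ (hU h)}

/-- The topology with basis the sets `(s, U)`, `U ⊆ D(s* s)` open. -/
instance : TopologicalSpace (UniversalGroupoid S) :=
  TopologicalSpace.generateFrom
    {V | ∃ (s : S) (U : Set (Spectrum S)) (hU : U ⊆ basicD (dom s)),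
      IsOpen U ∧ V = slice s U hU}

/-- `d[s, θ] = θ`. -/
def d : UniversalGroupoid S → Spectrum S :=
  Quotient.lift PreGerm.pt fun _ _ h => h.1

/-- `r[s, θ] = sθ`. -/
def r : UniversalGroupoid S → Spectrum S :=
  Quotient.lift (fun a : PreGerm S => act a.elt a.pt a.mem) (by
    rintro ⟨s, θ, hs⟩ ⟨t, η, ht⟩ h
    obtain ⟨h, e, he, h'⟩ := (PreGerm.rel_iff _ _).1 h
    obtain rfl : θ = η := h
    exact act_congr hs ht he h')

@[simp] theorem d_mk (s : S) (θ) (h) : d (mk s θ h) = θ := rfl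
@[simp] theorem r_mk (s : S) (θ) (h) : r (mk s θ h) = act s θ h := rfl

theorem mem_dom_one (θ : Spectrum S) : θ ∈ basicD (dom (1 : S)) := by
  have h : dom (1 : S) = 1 := Subtype.ext (by
    change pinv (1 : S) * 1 = 1
    rw [mul_one, pinv_idem (one_mul 1)])
  rw [h]; exact θ.map_one

/-- The identity arrow `[1, θ]` at `θ`. -/
def one (θ : Spectrum S) : UniversalGroupoid S := mk 1 θ (mem_dom_one θ)

theorem mem_dom_mul {s t : S} {θ : Spectrum S} (ht : θ ∈ basicD (dom t))
    (hs : act t θ ht ∈ basicD (dom s)) : θ ∈ basicD (dom (s * t)) := by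
  have h : dom (s * t) = conj t (dom s) := Subtype.ext (by
    change pinv (s * t) * (s * t) = pinv t * (pinv s * s) * t
    rw [pinv_mul_rev]; simp only [mul_assoc])
  rw [h]; exact hs

theorem mem_dom_pinv {s : S} {θ : Spectrum S} (hs : θ ∈ basicD (dom s)) :
    act s θ hs ∈ basicD (dom (pinv s)) := by
  have h : conj s (dom (pinv s)) = dom s := Subtype.ext (by
    change pinv s * (pinv (pinv s) * pinv s) * s = pinv s * s
    rw [pinv_pinv, ← mul_assoc, pinv_mul_pinv])
  change θ.toFun (conj s (dom (pinv s))) = true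
  rw [h]; exact hs

theorem exists_mul {a b : UniversalGroupoid S} (h : d a = r b) :
    ∃ c : UniversalGroupoid S, ∃ (s t : S) (θ : Spectrum S) (ht : θ ∈ basicD (dom t))
      (hs : act t θ ht ∈ basicD (dom s)), a = mk s (act t θ ht) hs ∧ b = mk t θ ht ∧
        c = mk (s * t) θ (mem_dom_mul ht hs) := by
  induction a using ind with | h s η hs => ?_
  induction b using ind with | h t θ ht => ?_
  obtain rfl : η = act t θ ht := h
  exact ⟨_, s, t, θ, ht, hs, rfl, rfl, rfl⟩

/-- The product of composable germs, characterized by `[s, tθ][t, θ] = [st, θ]`; see `mul_mk`. -/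
noncomputable def mul (a b : UniversalGroupoid S) (h : d a = r b) : UniversalGroupoid S :=
  (exists_mul h).choose

theorem mul_wd {s s' t t' : S} {η θ : Spectrum S} {e f : Idem S}
    (ht : θ ∈ basicD (dom t)) (hη : η = act t θ ht) (he : η ∈ basicD e) (hf : θ ∈ basicD f)
    (h1 : s * e.1 = s' * e.1) (h2 : t * f.1 = t' * f.1) :
    ∃ g : Idem S, θ ∈ basicD g ∧ s * t * g.1 = s' * t' * g.1 := by
  subst hη
  refine ⟨f * conj t e, mem_basicD_mul hf he, ?_⟩
  have h3 : t * (conj t e).1 = e.1 * t := by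
    change t * (pinv t * e.1 * t) = e.1 * t
    calc t * (pinv t * e.1 * t) = (t * pinv t) * e.1 * t := by simp only [mul_assoc]
      _ = e.1 * (t * pinv t * t) := by
          rw [idem_comm (self_mul_pinv_idem t) e.2]; simp only [mul_assoc]
      _ = e.1 * t := by rw [mul_pinv_mul]
  have h4 : t * (f.1 * (conj t e).1) = e.1 * (t * f.1) := by
    rw [idem_mul_comm, ← mul_assoc, h3, mul_assoc]
  change s * t * (f.1 * (conj t e).1) = s' * t' * (f.1 * (conj t e).1)
  calc s * t * (f.1 * (conj t e).1) = s * (t * (f.1 * (conj t e).1)) := by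
        simp only [mul_assoc]
    _ = (s * e.1) * (t * f.1) := by rw [h4]; simp only [mul_assoc]
    _ = s' * (t * (f.1 * (conj t e).1)) := by rw [h1, h4]; simp only [mul_assoc]
    _ = s' * ((t * f.1) * (conj t e).1) := by simp only [mul_assoc]
    _ = s' * t' * (f.1 * (conj t e).1) := by rw [h2]; simp only [mul_assoc]

theorem mul_mk (s t : S) (η θ : Spectrum S) (hs : η ∈ basicD (dom s)) (ht : θ ∈ basicD (dom t))
    (h : η = act t θ ht) :
    mul (mk s η hs) (mk t θ ht) h = mk (s * t) θ (mem_dom_mul ht (h ▸ hs)) := by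
  obtain ⟨s', t', θ', ht', hs', h1, h2, h3⟩ := (exists_mul
    (a := mk s η hs) (b := mk t θ ht) h).choose_spec
  obtain ⟨h4, f, hf, hf'⟩ := mk_eq_mk.1 h2
  obtain ⟨h5, e, he, he'⟩ := mk_eq_mk.1 h1
  refine Eq.trans h3 (Eq.symm (mk_eq_mk.2 ⟨h4, ?_⟩))
  exact mul_wd ht h he hf he' hf'

/-- The inverse `[s, θ]⁻¹ = [s*, sθ]`. -/
def inv : UniversalGroupoid S → UniversalGroupoid S :=
  Quotient.lift (fun a : PreGerm S => mk (pinv a.elt) (act a.elt a.pt a.mem)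
      (mem_dom_pinv a.mem)) (by
    rintro ⟨s, θ, hs⟩ ⟨t, η, ht⟩ h
    obtain ⟨h, e, he, h'⟩ := (PreGerm.rel_iff _ _).1 h
    obtain rfl : θ = η := h
    change s * e.1 = t * e.1 at h'
    change θ ∈ basicD e at he
    refine mk_eq_mk.2 ⟨act_congr hs ht he h', ?_⟩
    have hmem : ∀ (s : S) (hs : θ ∈ basicD (dom s)),
        act s θ hs ∈ basicD (dom (pinv (s * e.1))) := by
      intro s hs
      have h1 : conj s (dom (pinv (s * e.1))) = dom s * e := Subtype.ext (by
        change pinv s * (pinv (pinv (s * e.1)) * pinv (s * e.1)) * s = pinv s * s * e.1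
        rw [pinv_pinv, pinv_mul_rev, pinv_idem e.2]
        calc pinv s * (s * e.1 * (e.1 * pinv s)) * s
            = (pinv s * s) * ((e.1 * e.1) * (pinv s * s)) := by simp only [mul_assoc]
          _ = pinv s * s * (pinv s * s) * e.1 := by
              rw [e.2, idem_comm e.2 (pinv_mul_self_idem s)]; simp only [mul_assoc]
          _ = _ := by rw [pinv_mul_self_idem])
      change θ.toFun (conj s _) = true
      rw [h1]
      exact mem_basicD_mul hs he
    have hmul : ∀ s : S, pinv s * (dom (pinv (s * e.1))).1 = pinv (s * e.1) := by
      intro s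
      change pinv s * (pinv (pinv (s * e.1)) * pinv (s * e.1)) = pinv (s * e.1)
      rw [pinv_pinv, pinv_mul_rev, pinv_idem e.2]
      calc pinv s * (s * e.1 * (e.1 * pinv s))
          = ((pinv s * s) * (e.1 * e.1)) * pinv s := by simp only [mul_assoc]
        _ = e.1 * (pinv s * s * pinv s) := by
            rw [e.2, idem_comm (pinv_mul_self_idem s) e.2]; simp only [mul_assoc]
        _ = _ := by rw [pinv_mul_pinv]
    refine ⟨dom (pinv (s * e.1)), hmem s hs, ?_⟩
    change pinv s * _ = pinv t * _
    rw [hmul s]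
    conv_rhs => rw [h']
    rw [hmul t, h'])

theorem inv_mk (s : S) (θ : Spectrum S) (hs : θ ∈ basicD (dom s)) :
    inv (mk s θ hs) = mk (pinv s) (act s θ hs) (mem_dom_pinv hs) := rfl

theorem act_mul {s t : S} {θ : Spectrum S} (ht : θ ∈ basicD (dom t))
    (hs : act t θ ht ∈ basicD (dom s)) :
    act (s * t) θ (mem_dom_mul ht hs) = act s (act t θ ht) hs := by
  refine Spectrum.ext' fun e => ?_
  change θ.toFun (conj (s * t) e) = θ.toFun (conj t (conj s e))
  congr 1
  refine Subtype.ext ?_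
  change pinv (s * t) * e.1 * (s * t) = pinv t * (pinv s * e.1 * s) * t
  rw [pinv_mul_rev]; simp only [mul_assoc]

theorem act_one (θ : Spectrum S) : act 1 θ (mem_dom_one θ) = θ := by
  refine Spectrum.ext' fun e => ?_
  change θ.toFun (conj 1 e) = θ.toFun e
  congr 1
  refine Subtype.ext ?_
  change pinv (1 : S) * e.1 * 1 = e.1
  rw [pinv_idem (one_mul (1 : S)), one_mul, mul_one]

theorem act_pinv {s : S} {θ : Spectrum S} (hs : θ ∈ basicD (dom s)) :
    act (pinv s) (act s θ hs) (mem_dom_pinv hs) = θ := by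
  have h : pinv s * s * (pinv s * s) = 1 * (pinv s * s) := by
    rw [pinv_mul_self_idem, one_mul]
  exact (act_mul hs (mem_dom_pinv hs)).symm.trans
    ((act_congr (e := dom s) _ (mem_dom_one θ) hs h).trans (act_one θ))

end UniversalGroupoid

end InverseMonoidWithZero

/-! ### Topological groupoids and their algebras -/

/-- A groupoid as a set `𝒢` of arrows over a set `X` of objects, with domain `d`, range `r`, units
`one`, inverses, and a product `mul a b` defined when `d a = r b`. -/
class ArrowGroupoid (X : outParam (Type*)) (𝒢 : Type*) where
  d : 𝒢 → X
  r : 𝒢 → X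
  one : X → 𝒢
  inv : 𝒢 → 𝒢
  mul : (a b : 𝒢) → d a = r b → 𝒢
  d_one : ∀ x, d (one x) = x
  r_one : ∀ x, r (one x) = x
  d_inv : ∀ a, d (inv a) = r a
  r_inv : ∀ a, r (inv a) = d a
  d_mul : ∀ a b h, d (mul a b h) = d b
  r_mul : ∀ a b h, r (mul a b h) = r a
  mul_assoc : ∀ a b c hab hbc,
    mul (mul a b hab) c ((d_mul a b hab).trans hbc) =
      mul a (mul b c hbc) (hab.trans (r_mul b c hbc).symm)
  one_mul : ∀ a, mul (one (r a)) a (d_one _) = a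
  mul_one : ∀ a, mul a (one (d a)) (r_one _).symm = a
  inv_mul : ∀ a, mul (inv a) a (d_inv a) = one (d a)
  mul_inv : ∀ a, mul a (inv a) (r_inv a).symm = one (r a)

open InverseMonoidWithZero in
noncomputable instance {S : Type*} [InverseMonoidWithZero S] :
    ArrowGroupoid (Spectrum S) (UniversalGroupoid S) where
  d := UniversalGroupoid.d
  r := UniversalGroupoid.r
  one := UniversalGroupoid.one
  inv := UniversalGroupoid.inv
  mul := UniversalGroupoid.mul
  d_one _ := rfl
  r_one θ := UniversalGroupoid.act_one θ
  d_inv a := by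
    induction a using UniversalGroupoid.ind with | h s θ hs => rfl
  r_inv a := by
    induction a using UniversalGroupoid.ind with | h s θ hs => ?_
    exact UniversalGroupoid.act_pinv hs
  d_mul a b h := by
    induction a using UniversalGroupoid.ind with | h s η hs => ?_
    induction b using UniversalGroupoid.ind with | h t θ ht => ?_
    rw [UniversalGroupoid.mul_mk s t η θ hs ht h]; rfl
  r_mul a b h := by
    induction a using UniversalGroupoid.ind with | h s η hs => ?_
    induction b using UniversalGroupoid.ind with | h t θ ht => ?_
    rw [UniversalGroupoid.mul_mk s t η θ hs ht h]
    obtain rfl : η = act t θ ht := h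
    exact UniversalGroupoid.act_mul ht hs
  mul_assoc a b c hab hbc := by
    induction a using UniversalGroupoid.ind with | h s η hs => ?_
    induction b using UniversalGroupoid.ind with | h t θ ht => ?_
    induction c using UniversalGroupoid.ind with | h u ζ hu => ?_
    obtain rfl : θ = act u ζ hu := hbc
    obtain rfl : η = act t (act u ζ hu) ht := hab
    simp only [UniversalGroupoid.mul_mk _ _ _ _ hs ht rfl,
      UniversalGroupoid.mul_mk _ _ _ _ ht hu rfl]
    rw [UniversalGroupoid.mul_mk _ _ _ _ _ _ rfl,
      UniversalGroupoid.mul_mk _ _ _ _ _ _ (UniversalGroupoid.act_mul hu ht).symm]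
    simp only [_root_.mul_assoc]
  one_mul a := by
    induction a using UniversalGroupoid.ind with | h s θ hs => ?_
    refine (UniversalGroupoid.mul_mk _ _ _ _ _ hs rfl).trans ?_
    simp only [_root_.one_mul]
  mul_one a := by
    induction a using UniversalGroupoid.ind with | h s θ hs => ?_
    refine (UniversalGroupoid.mul_mk _ _ _ _ hs _ (UniversalGroupoid.act_one θ).symm).trans ?_
    simp only [_root_.mul_one]
  inv_mul a := by
    induction a using UniversalGroupoid.ind with | h s θ hs => ?_
    refine (UniversalGroupoid.mul_mk _ _ _ _ _ hs rfl).trans ?_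
    refine UniversalGroupoid.mk_eq_mk.2 ⟨rfl, dom s, hs, ?_⟩
    change pinv s * s * (pinv s * s) = 1 * (pinv s * s)
    rw [pinv_mul_self_idem, _root_.one_mul]
  mul_inv a := by
    induction a using UniversalGroupoid.ind with | h s θ hs => ?_
    refine (UniversalGroupoid.mul_mk _ _ _ _ hs _ (UniversalGroupoid.act_pinv hs).symm).trans ?_
    refine UniversalGroupoid.mk_eq_mk.2
      ⟨rfl, dom (pinv s), UniversalGroupoid.mem_dom_pinv hs, ?_⟩
    change s * pinv s * (pinv (pinv s) * pinv s) = 1 * (pinv (pinv s) * pinv s)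
    rw [pinv_pinv, self_mul_pinv_idem, _root_.one_mul]

namespace ArrowGroupoid

section Topology

variable {X : Type*} (𝒢 : Type*) [ArrowGroupoid X 𝒢] [TopologicalSpace X] [TopologicalSpace 𝒢]

/-- A topological groupoid (with unit space topologized as a subspace) that is étale and whose unit
space is Hausdorff with a basis of compact open sets. -/
structure IsAmple : Prop where
  isEmbedding_one : Topology.IsEmbedding (one : X → 𝒢)
  continuous_r : Continuous (r : 𝒢 → X)
  continuous_inv : Continuous (inv : 𝒢 → 𝒢)
  continuous_mul : Continuous fun p : {p : 𝒢 × 𝒢 // d p.1 = r p.2} => mul p.1.1 p.1.2 p.2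
  isLocalHomeomorph_d : IsLocalHomeomorph (d : 𝒢 → X)
  t2Space : T2Space X
  isTopologicalBasis : TopologicalSpace.IsTopologicalBasis {U : Set X | IsOpen U ∧ IsCompact U}

/-- The unit space has no proper non-empty open invariant subset. -/
def IsMinimal : Prop :=
  ∀ U : Set X, IsOpen U → (∀ a : 𝒢, d a ∈ U → r a ∈ U) → U = ∅ ∨ U = Set.univ

/-- The interior of the isotropy subgroupoid is the set of units. -/
def IsEffective : Prop :=
  interior {a : 𝒢 | d a = r a} = Set.range (one : X → 𝒢)

variable {𝒢} in
/-- An open set on which `d` and `r` are homeomorphisms onto their images. -/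
def IsLocalBisection (U : Set 𝒢) : Prop :=
  IsOpen U ∧ Topology.IsEmbedding (U.domRestrict (d : 𝒢 → X)) ∧
    Topology.IsEmbedding (U.domRestrict (r : 𝒢 → X))

/-- The underlying space of the Steinberg algebra `K𝒢`: the span, inside the functions `𝒢 → K`, of
the characteristic functions of compact local bisections. -/
def steinberg (K : Type*) [Field K] : Submodule K (𝒢 → K) :=
  Submodule.span K
    {f | ∃ U : Set 𝒢, IsLocalBisection U ∧ IsCompact U ∧ f = U.indicator (fun _ => 1)}

end Topology

section Algebra

variable {X 𝒢 : Type*} [ArrowGroupoid X 𝒢]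

/-- Convolution `(f * g)(c) = ∑_{ab = c} f(a) g(b)`. For `f, g` in the Steinberg algebra of an ample
groupoid only finitely many terms are nonzero. -/
noncomputable def conv {K : Type*} [Field K] (f g : 𝒢 → K) (c : 𝒢) : K :=
  ∑ᶠ p : {p : 𝒢 × 𝒢 // ∃ h : d p.1 = r p.2, mul p.1 p.2 h = c}, f p.1.1 * g p.1.2

variable (𝒢) in
/-- The Steinberg algebra `K𝒢` is a simple ring under convolution: it is nonzero and its only
two-sided ideals are `0` and `K𝒢`. -/
def IsSimpleSteinberg [TopologicalSpace X] [TopologicalSpace 𝒢] (K : Type*) [Field K] : Prop :=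
  steinberg 𝒢 K ≠ ⊥ ∧
    ∀ I : AddSubgroup (𝒢 → K), I ≤ (steinberg 𝒢 K).toAddSubgroup →
      (∀ f ∈ I, ∀ a ∈ steinberg 𝒢 K, conv a f ∈ I ∧ conv f a ∈ I) →
        I = ⊥ ∨ I = (steinberg 𝒢 K).toAddSubgroup

end Algebra

end ArrowGroupoid

/-! ### Inverse hulls -/

/-- The symmetric inverse monoid: partial bijections of `M`, with `s * t` meaning `s` after `t`. -/
def SymmetricInverseMonoid (M : Type*) : Type _ := M ≃. M

namespace SymmetricInverseMonoid

variable {M : Type*}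

instance : MonoidWithZero (SymmetricInverseMonoid M) where
  mul s t := PEquiv.trans t s
  one := PEquiv.refl M
  zero := (⊥ : M ≃. M)
  mul_assoc s t u := (PEquiv.trans_assoc u t s).symm
  one_mul s := PEquiv.trans_refl s
  mul_one s := PEquiv.refl_trans s
  zero_mul s := PEquiv.trans_bot s
  mul_zero s := PEquiv.bot_trans s

theorem mul_eq_some (s t : SymmetricInverseMonoid M) (a c : M) :
    PEquiv.toFun (s * t) a = some c ↔ ∃ b, PEquiv.toFun t a = some b ∧ PEquiv.toFun s b = some c :=
  PEquiv.trans_eq_some t s a c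

theorem ext_some {s t : SymmetricInverseMonoid M}
    (h : ∀ a b, PEquiv.toFun s a = some b ↔ PEquiv.toFun t a = some b) : s = t :=
  PEquiv.ext fun a => Option.ext fun b => h a b

theorem symm_eq_some (s : SymmetricInverseMonoid M) (a b : M) :
    PEquiv.toFun (PEquiv.symm s) b = some a ↔ PEquiv.toFun s a = some b :=
  PEquiv.eq_some_iff s

theorem inj (s : SymmetricInverseMonoid M) {a a' b : M} (h : PEquiv.toFun s a = some b)
    (h' : PEquiv.toFun s a' = some b) : a = a' := by
  have h1 := (symm_eq_some s a b).2 h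
  have h2 := (symm_eq_some s a' b).2 h'
  exact Option.some.inj (h1.symm.trans h2)

/-- The inverse partial bijection. -/
def symm (s : SymmetricInverseMonoid M) : SymmetricInverseMonoid M := PEquiv.symm s

theorem mul_symm_mul (s : SymmetricInverseMonoid M) : s * symm s * s = s := by
  refine ext_some fun a b => ?_
  rw [mul_eq_some]
  constructor
  · rintro ⟨c, h1, h2⟩
    obtain ⟨a', h3, h4⟩ := (mul_eq_some _ _ _ _).1 h2
    have h5 := (symm_eq_some s a' c).1 h3
    obtain rfl := inj s h1 h5
    exact h4
  · intro h
    exact ⟨b, h, (mul_eq_some _ _ _ _).2 ⟨a, (symm_eq_some s a b).2 h, h⟩⟩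

theorem symm_unique (s t : SymmetricInverseMonoid M) (h1 : s * t * s = s) (h2 : t * s * t = t) :
    t = symm s := by
  refine ext_some fun b a => ?_
  refine Iff.trans ?_ (symm_eq_some s a b).symm
  constructor
  · intro h
    have h3 := h
    rw [← h2, mul_eq_some] at h3
    obtain ⟨a', h4, h5⟩ := h3
    obtain ⟨b', h6, h7⟩ := (mul_eq_some _ _ _ _).1 h5
    obtain rfl := inj t h h7
    rw [h] at h4
    obtain rfl := Option.some.inj h4
    exact h6
  · intro h
    have h3 := h
    rw [← h1, mul_eq_some] at h3
    obtain ⟨b', h4, h5⟩ := h3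
    obtain ⟨a', h6, h7⟩ := (mul_eq_some _ _ _ _).1 h5
    obtain rfl := inj s h h7
    rw [h] at h4
    obtain rfl := Option.some.inj h4
    exact h6

open Classical in
/-- Left multiplication by `m` in a left cancellative monoid, as a partial bijection. -/
noncomputable def leftMul [Monoid M] [IsLeftCancelMul M] (m : M) : SymmetricInverseMonoid M :=
  show M ≃. M from
  { toFun := fun x => some (m * x)
    invFun := fun y => if h : ∃ x, m * x = y then some h.choose else none
    inv := by
      intro x y
      by_cases h : ∃ x, m * x = y
      · simp only [h, dite_true, Option.some.injEq]
        constructor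
        · rintro rfl; exact h.choose_spec
        · intro hx; exact mul_left_cancel (h.choose_spec.trans hx.symm)
      · simp only [h, dite_false, Option.some.injEq, reduceCtorEq, false_iff]
        exact fun hx => h ⟨x, hx⟩ }

/-- The inverse hull of a left cancellative monoid `M`: the inverse submonoid of the symmetric
inverse monoid on `M` generated by the left multiplications, with the empty map `0` included. -/
def hull (M : Type*) [Monoid M] [IsLeftCancelMul M] : Submonoid (SymmetricInverseMonoid M) :=
  Submonoid.closure (Set.range leftMul ∪ Set.range (fun m : M => symm (leftMul m)) ∪ {0})

theorem symm_mem_hull [Monoid M] [IsLeftCancelMul M] {s : SymmetricInverseMonoid M}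
    (hs : s ∈ hull M) : symm s ∈ hull M := by
  induction hs using Submonoid.closure_induction with
  | mem x hx =>
    refine Submonoid.subset_closure ?_
    rcases hx with (⟨m, rfl⟩ | ⟨m, rfl⟩) | rfl
    · exact Or.inl (Or.inr ⟨m, rfl⟩)
    · exact Or.inl (Or.inl ⟨m, rfl⟩)
    · exact Or.inr PEquiv.symm_bot
  | one => exact Submonoid.one_mem _
  | mul x y _ _ hx hy =>
    have h : symm (x * y) = symm y * symm x := PEquiv.symm_trans_rev y x
    rw [h]
    exact Submonoid.mul_mem _ hy hx

end SymmetricInverseMonoid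

/-- The inverse hull of `M` as a type. -/
def InverseHull (M : Type*) [Monoid M] [IsLeftCancelMul M] : Type _ :=
  SymmetricInverseMonoid.hull M

open SymmetricInverseMonoid in
instance (M : Type*) [Monoid M] [IsLeftCancelMul M] : InverseMonoidWithZero (InverseHull M) where
  mul s t := ⟨s.1 * t.1, Submonoid.mul_mem _ s.2 t.2⟩
  one := ⟨1, Submonoid.one_mem _⟩
  zero := ⟨0, Submonoid.subset_closure (Or.inr rfl)⟩
  mul_assoc s t u := Subtype.ext (mul_assoc s.1 t.1 u.1)
  one_mul s := Subtype.ext (one_mul s.1)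
  mul_one s := Subtype.ext (mul_one s.1)
  zero_mul s := Subtype.ext (zero_mul s.1)
  mul_zero s := Subtype.ext (mul_zero s.1)
  pinv s := ⟨symm s.1, symm_mem_hull s.2⟩
  mul_pinv_mul s := Subtype.ext (mul_symm_mul s.1)
  pinv_mul_pinv s := Subtype.ext (mul_symm_mul (symm s.1))
  pinv_unique s t h1 h2 :=
    Subtype.ext (symm_unique s.1 t.1 (congrArg Subtype.val h1) (congrArg Subtype.val h2))

/-! ### Self-similar actions -/

/-- A self-similar action of `G` over the alphabet `X`: `act g x = g(x)` and `sec g x = g|ₓ`. -/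
structure SelfSimilarAction (G X : Type*) [Group G] where
  act : G → X → X
  sec : G → X → G
  act_one : ∀ x, act 1 x = x
  act_mul : ∀ g h x, act (g * h) x = act g (act h x)
  sec_one : ∀ x, sec 1 x = 1
  sec_mul : ∀ g h x, sec (g * h) x = sec g (act h x) * sec h x

namespace SelfSimilarAction

variable {G X : Type*} [Group G] (σ : SelfSimilarAction G X)

/-- `g(xu) = g(x) g|ₓ(u)`. -/
def actWord : G → List X → List X
  | _, [] => []
  | g, x :: u => σ.act g x :: actWord (σ.sec g x) u

/-- `g|_{xu} = (g|ₓ)|ᵤ`. -/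
def secWord : G → List X → G
  | g, [] => g
  | g, x :: u => secWord (σ.sec g x) u

/-- `G` acts faithfully on words. -/
def IsFaithful : Prop := ∀ g : G, (∀ w : List X, σ.actWord g w = w) → g = 1

theorem actWord_one (w : List X) : σ.actWord 1 w = w := by
  induction w with
  | nil => rfl
  | cons x u ih => simp only [actWord, σ.act_one, σ.sec_one, ih]

theorem secWord_one (w : List X) : σ.secWord 1 w = 1 := by
  induction w with
  | nil => rfl
  | cons x u ih => simp only [secWord, σ.sec_one, ih]

theorem actWord_mul (g h : G) (w : List X) :
    σ.actWord (g * h) w = σ.actWord g (σ.actWord h w) := by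
  induction w generalizing g h with
  | nil => rfl
  | cons x u ih => simp only [actWord, σ.act_mul, σ.sec_mul, ih]

theorem secWord_mul (g h : G) (w : List X) :
    σ.secWord (g * h) w = σ.secWord g (σ.actWord h w) * σ.secWord h w := by
  induction w generalizing g h with
  | nil => rfl
  | cons x u ih => simp only [secWord, actWord, σ.sec_mul, ih]

theorem actWord_append (g : G) (u v : List X) :
    σ.actWord g (u ++ v) = σ.actWord g u ++ σ.actWord (σ.secWord g u) v := by
  induction u generalizing g with
  | nil => rfl
  | cons x u ih => simp only [List.cons_append, actWord, secWord, ih]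

theorem secWord_append (g : G) (u v : List X) :
    σ.secWord g (u ++ v) = σ.secWord (σ.secWord g u) v := by
  induction u generalizing g with
  | nil => rfl
  | cons x u ih => simp only [List.cons_append, secWord, ih]

/-- The monoid `M = X*G`, whose elements `ug` are pairs, with
`(ug)(vh) = (u g(v)) (g|ᵥ h)`. -/
@[ext] structure WordMonoid (σ : SelfSimilarAction G X) where
  word : List X
  grp : G

instance : Monoid σ.WordMonoid where
  mul m n := ⟨m.word ++ σ.actWord m.grp n.word, σ.secWord m.grp n.word * n.grp⟩
  one := ⟨[], 1⟩
  mul_assoc a b c := by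
    refine WordMonoid.ext ?_ ?_
    · change (a.word ++ σ.actWord a.grp b.word) ++
          σ.actWord (σ.secWord a.grp b.word * b.grp) c.word =
        a.word ++ σ.actWord a.grp (b.word ++ σ.actWord b.grp c.word)
      rw [σ.actWord_append, σ.actWord_mul, List.append_assoc]
    · change σ.secWord (σ.secWord a.grp b.word * b.grp) c.word * c.grp =
        σ.secWord a.grp (b.word ++ σ.actWord b.grp c.word) * (σ.secWord b.grp c.word * c.grp)
      rw [σ.secWord_append, σ.secWord_mul, mul_assoc]
  one_mul a := by
    refine WordMonoid.ext ?_ ?_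
    · exact σ.actWord_one a.word
    · change σ.secWord 1 a.word * a.grp = a.grp
      rw [σ.secWord_one, one_mul]
  mul_one a := by
    refine WordMonoid.ext ?_ ?_
    · exact List.append_nil a.word
    · exact mul_one a.grp

instance : IsLeftCancelMul σ.WordMonoid where
  mul_left_cancel a b c h := by
    have h1 : a.word ++ σ.actWord a.grp b.word = a.word ++ σ.actWord a.grp c.word :=
      congrArg WordMonoid.word h
    have h2 : σ.secWord a.grp b.word * b.grp = σ.secWord a.grp c.word * c.grp :=
      congrArg WordMonoid.grp h
    have h3 : b.word = c.word := by
      have h4 := congrArg (σ.actWord a.grp⁻¹) (List.append_cancel_left h1)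
      rwa [← σ.actWord_mul, ← σ.actWord_mul, inv_mul_cancel, σ.actWord_one, σ.actWord_one] at h4
    rw [h3] at h2
    exact WordMonoid.ext h3 (mul_left_cancel h2)

/-- The countable inflation, over the alphabet `X × ℕ`. -/
def inflation : SelfSimilarAction G (X × ℕ) where
  act g x := (σ.act g x.1, x.2)
  sec g x := σ.sec g x.1
  act_one x := Prod.ext (σ.act_one x.1) rfl
  act_mul g h x := Prod.ext (σ.act_mul g h x.1) rfl
  sec_one x := σ.sec_one x.1
  sec_mul g h x := σ.sec_mul g h x.1

end SelfSimilarAction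

/-! ### The action of `⨁_{p ∈ P} C_p × C_p` -/

/-- `G = ⨁_{p ∈ P} C_p × C_p`, written multiplicatively. -/
abbrev PrimeGroup (P : Set Nat.Primes) : Type :=
  Multiplicative (Π₀ p : P, ZMod (p.1 : ℕ) × ZMod (p.1 : ℕ))

/-- The endomorphism `π_p` of `G` that changes the `p`-component to `1`. -/
def PrimeGroup.proj {P : Set Nat.Primes} (p : P) : PrimeGroup P →* PrimeGroup P :=
  AddMonoidHom.toMultiplicative
    (DFinsupp.eraseAddHom (fun p : P => ZMod (p.1 : ℕ) × ZMod (p.1 : ℕ)) p)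

/-- The alphabet `A = ∐_{p ∈ P} ∐_{[G : H] = p} G/H`. -/
abbrev PrimeAlphabet (P : Set Nat.Primes) : Type :=
  Σ p : P, Σ H : {H : Subgroup (PrimeGroup P) // H.index = (p.1 : ℕ)}, PrimeGroup P ⧸ H.1

/-- `G` acts on `A` by translation of cosets, and `g|ₐ = π_p(g)` for `a ∈ A_p`. -/
def primeAction (P : Set Nat.Primes) : SelfSimilarAction (PrimeGroup P) (PrimeAlphabet P) where
  act g a := ⟨a.1, a.2.1, g • a.2.2⟩
  sec g a := PrimeGroup.proj a.1 g
  act_one a := by simp only [one_smul]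
  act_mul g h a := by simp only [mul_smul]
  sec_one a := map_one _
  sec_mul g h a := map_mul _ g h

/-- The inverse hull of `X*G` for the countable inflation of `primeAction P`. -/
abbrev PrimeHull (P : Set Nat.Primes) : Type :=
  InverseHull (primeAction P).inflation.WordMonoid

/-! ### Topology of the spectrum of idempotents -/

section

open Topology Set

namespace InverseMonoidWithZero

section Spectrum

variable {S : Type*} [InverseMonoidWithZero S]

/-! Each nonzero element of S is uniquely of the form u g v*, the partial map v m ↦ u g m, and each
nonzero idempotent is some u u* (`eq_zero_or_triple`, `triple_inj`, `eq_zero_or_wordIdem`).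
Simplicity of both algebras is reduced to one statement about two-sided ideals of KS containing the
basis element 0, `HasOnlyTrivialIdeals`. For the Steinberg algebra this uses the map that sends s to
the characteristic function of its germs: it is multiplicative, its kernel is the line of 0, and its
image is all of K𝒢(S) (`toSteinberg_mul`, `toSteinberg_eq_zero_iff`, `range_toSteinberg`).

Suppose first that every p ∈ P is invertible in K, and let J be an ideal with an element off the
line of 0. Multiplying by g⁻¹u* on the left and by v on the right, for a term u g v* of maximal
domain, gives an element of J with nonzero coefficient at 1. For letters x, y over A with an index i
unused in the support, the compression s ↦ (y,i)* s (x,i) kills everything in the support except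
those g ∈ G with g x = y, and sends such a g to its section. If x, y are letters of A_p, that
section forgets the p-component. The new coefficient at 1 is the sum of the old coefficients over an
affine line in C_p × C_p. If all line sums were zero, adding the p lines through the origin other
than one fixed line would give p times the old coefficient at 1, hence that coefficient would vanish
(`apply_zero_eq_zero_of_sum_line_eq_zero`). So some compression keeps a nonzero coefficient at 1 and
removes p from the finitely many primes involved. After all primes are removed, one last compression
leaves a nonzero multiple of 1 (modulo the line of 0).

Suppose now that p ∈ P is zero in K. The elements a such that, for all s and t, the coefficients of
a at those r with s r t ∈ G add up to zero form an ideal that omits 1. It contains the sum over C_p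
× C_p: each word u is fixed by some nontrivial c₀ in C_p × C_p, because a subgroup of index p meets
C_p × C_p nontrivially and sections at letters of A_p kill this component. Hence, for t = u g v*,
the set of c with s c t ∈ G is invariant under translation by c₀, and its size is divisible by p.
This ideal is proper and does not lie in the line of 0.

Congruence-freeness does not depend on a field, and follows from simplicity over ℚ. Minimality and
effectiveness come from fresh letters: a neighbourhood is D(w) with finitely many D(f) removed, and
extending w by a letter of unused index avoids all those f. -/

theorem Spectrum.isEmbedding_toFun : IsEmbedding (Spectrum.toFun : Spectrum S → Idem S → Bool) :=
  ⟨⟨rfl⟩, fun _ _ h => Spectrum.ext' fun e => congrFun h e⟩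

theorem Spectrum.continuous_apply (e : Idem S) : Continuous fun θ : Spectrum S => θ.toFun e :=
  (_root_.continuous_apply e).comp Spectrum.isEmbedding_toFun.continuous

theorem isClopen_basicD (e : Idem S) : IsClopen (basicD e) :=
  (isClopen_discrete ({true} : Set Bool)).preimage (Spectrum.continuous_apply e)

theorem isOpen_basicD (e : Idem S) : IsOpen (basicD e) := (isClopen_basicD e).isOpen

/-- The image is cut out by equations between continuous functions: for multiplicative f, being
nonzero amounts to f 1 = true. This is what makes the spectrum compact. -/
theorem Spectrum.isClosedEmbedding_toFun :
    IsClosedEmbedding (Spectrum.toFun : Spectrum S → Idem S → Bool) := by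
  refine ⟨Spectrum.isEmbedding_toFun, ?_⟩
  have h : range (Spectrum.toFun : Spectrum S → Idem S → Bool) =
      {f | f 0 = false} ∩ {f | f 1 = true} ∩ ⋂ e, ⋂ e', {f | f (e * e') = (f e && f e')} := by
    ext f
    simp only [mem_range, mem_inter_iff, mem_ofPred_eq, mem_iInter]
    constructor
    · rintro ⟨θ, rfl⟩
      exact ⟨⟨θ.map_zero, θ.map_one⟩, θ.map_mul⟩
    · rintro ⟨⟨h0, h1⟩, h2⟩
      exact ⟨⟨f, h0, h2, 1, h1⟩, rfl⟩
  rw [h]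
  refine (IsClosed.inter ?_ ?_).inter (isClosed_iInter fun e => isClosed_iInter fun e' => ?_)
  · exact isClosed_eq (_root_.continuous_apply _) continuous_const
  · exact isClosed_eq (_root_.continuous_apply _) continuous_const
  · refine isClosed_eq (_root_.continuous_apply _) ?_
    have h : Continuous fun p : Bool × Bool => p.1 && p.2 := continuous_of_discreteTopology
    have h' : Continuous fun f : Idem S → Bool => (f e, f e') :=
      (_root_.continuous_apply e).prodMk (_root_.continuous_apply e')
    exact h.comp h'

instance : CompactSpace (Spectrum S) := Spectrum.isClosedEmbedding_toFun.compactSpace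

instance : T2Space (Spectrum S) := Spectrum.isEmbedding_toFun.t2Space

instance : TotallyDisconnectedSpace (Spectrum S) :=
  Spectrum.isEmbedding_toFun.isTotallyDisconnected_range.1
    (isTotallyDisconnected_of_totallyDisconnectedSpace _)

theorem Spectrum.isTopologicalBasis_compact_open :
    TopologicalSpace.IsTopologicalBasis {U : Set (Spectrum S) | IsOpen U ∧ IsCompact U} := by
  convert isTopologicalBasis_isClopen (X := Spectrum S) using 3 with U
  exact ⟨fun h => ⟨h.2.isClosed, h.1⟩, fun h => ⟨h.isOpen, h.isClosed.isCompact⟩⟩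

theorem continuous_act (s : S) : Continuous fun θ : basicD (dom s) => act s θ.1 θ.2 := by
  refine Spectrum.isEmbedding_toFun.continuous_iff.2 (continuous_pi fun e => ?_)
  exact (Spectrum.continuous_apply (conj s e)).comp continuous_subtype_val

theorem isOpen_act_preimage (s : S) {U : Set (Spectrum S)} (hU : IsOpen U) :
    IsOpen {θ | ∃ h : θ ∈ basicD (dom s), act s θ h ∈ U} := by
  have h := (isOpen_basicD (dom s)).isOpenMap_subtype_val _ (hU.preimage (continuous_act s))
  convert h using 1
  ext θ
  simp

/-- Neighbourhoods in the spectrum are given by finitely many idempotents. -/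
theorem exists_basic_subset {U : Set (Spectrum S)} (hU : IsOpen U) {θ : Spectrum S} (hθ : θ ∈ U) :
    ∃ I : Finset (Idem S), {η : Spectrum S | ∀ e ∈ I, η.toFun e = θ.toFun e} ⊆ U := by
  obtain ⟨V, hV, rfl⟩ := isOpen_induced_iff.1 hU
  obtain ⟨I, u, h1, h2⟩ := isOpen_pi_iff.1 hV _ hθ
  exact ⟨I, fun η hη => h2 fun e he => by rw [hη e he]; exact (h1 e he).2⟩

theorem basicD_mul (e f : Idem S) : basicD (e * f) = basicD e ∩ basicD f := by
  ext θ
  change θ.toFun (e * f) = true ↔ θ.toFun e = true ∧ θ.toFun f = true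
  rw [θ.map_mul, Bool.and_eq_true]

/-- A basic neighbourhood prescribes finitely many values of a character. The idempotents with value
true can be multiplied into a single e; those with value false stay as exclusions. -/
theorem exists_basicD_sdiff_subset {U : Set (Spectrum S)} (hU : IsOpen U) {θ : Spectrum S}
    (hθ : θ ∈ U) :
    ∃ (e : Idem S) (I : Finset (Idem S)), θ ∈ basicD e ∧ (∀ f ∈ I, θ ∉ basicD f) ∧
      ∀ η ∈ basicD e, (∀ f ∈ I, η ∉ basicD f) → η ∈ U := by
  classical
  obtain ⟨I, hI⟩ := exists_basic_subset hU hθ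
  suffices h : ∀ J : Finset (Idem S), ∃ e : Idem S, θ ∈ basicD e ∧
      ∀ η ∈ basicD e, ∀ f ∈ J, θ ∈ basicD f → η ∈ basicD f by
    obtain ⟨e, he, h⟩ := h I
    refine ⟨e, I.filter (θ ∉ basicD ·), he, fun f hf => (Finset.mem_filter.1 hf).2,
      fun η hη hη' => hI fun f hf => ?_⟩
    by_cases hf' : θ ∈ basicD f
    · exact (h η hη f hf hf').trans hf'.symm
    · have h1 : ¬ η.toFun f = true := hη' f (Finset.mem_filter.2 ⟨hf, hf'⟩)
      have h2 : ¬ θ.toFun f = true := hf'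
      rw [Bool.not_eq_true] at h1 h2
      rw [h1, h2]
  intro J
  induction J using Finset.induction_on with
  | empty => exact ⟨1, θ.map_one, by simp⟩
  | insert f J _ ih =>
    obtain ⟨e, he, h⟩ := ih
    by_cases hf : θ ∈ basicD f
    · refine ⟨e * f, mem_basicD_mul he hf, fun η hη g hg hg' => ?_⟩
      rw [basicD_mul] at hη
      rcases Finset.mem_insert.1 hg with rfl | hg
      · exact hη.2
      · exact h η hη.1 g hg hg'
    · refine ⟨e, he, fun η hη g hg hg' => ?_⟩
      rcases Finset.mem_insert.1 hg with rfl | hg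
      · exact absurd hg' hf
      · exact h η hη g hg hg'

end Spectrum

/-! ### Topology of the groupoid of germs -/

namespace UniversalGroupoid

variable {S : Type*} [InverseMonoidWithZero S]

theorem isOpen_slice (s : S) {U : Set (Spectrum S)} (hU : U ⊆ basicD (dom s)) (h : IsOpen U) :
    IsOpen (slice s U hU) :=
  TopologicalSpace.isOpen_generateFrom_of_mem ⟨s, U, hU, h, rfl⟩

theorem mk_mem_slice_iff {s t : S} {θ : Spectrum S} {hθ : θ ∈ basicD (dom s)}
    {U : Set (Spectrum S)} {hU : U ⊆ basicD (dom t)} :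
    mk s θ hθ ∈ slice t U hU ↔ θ ∈ U ∧ ∃ e : Idem S, θ ∈ basicD e ∧ s * e.1 = t * e.1 := by
  constructor
  · rintro ⟨η, hη, h⟩
    obtain ⟨rfl, h'⟩ := mk_eq_mk.1 h
    exact ⟨hη, h'⟩
  · rintro ⟨h1, h2⟩
    exact ⟨θ, h1, mk_eq_mk.2 ⟨rfl, h2⟩⟩

theorem mk_mem_slice {s : S} {θ : Spectrum S} {U : Set (Spectrum S)} {hU : U ⊆ basicD (dom s)}
    {hθ : θ ∈ basicD (dom s)} (h : θ ∈ U) : mk s θ hθ ∈ slice s U hU :=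
  ⟨θ, h, rfl⟩

theorem isTopologicalBasis_slice : TopologicalSpace.IsTopologicalBasis
    {V : Set (UniversalGroupoid S) | ∃ (s : S) (U : Set (Spectrum S)) (hU : U ⊆ basicD (dom s)),
      IsOpen U ∧ V = slice s U hU} where
  exists_subset_inter := by
    rintro _ ⟨s, U, hU, hU', rfl⟩ _ ⟨t, V, hV, hV', rfl⟩ a ⟨⟨θ, hθ, rfl⟩, h⟩
    obtain ⟨hθ', e, he, hst⟩ := mk_mem_slice_iff.1 h
    refine ⟨_, ⟨s, U ∩ V ∩ basicD e, fun η hη => hU hη.1.1,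
      (hU'.inter hV').inter (isOpen_basicD e), rfl⟩, mk_mem_slice ⟨⟨hθ, hθ'⟩, he⟩, ?_⟩
    rintro _ ⟨η, hη, rfl⟩
    exact ⟨mk_mem_slice hη.1.1, mk_mem_slice_iff.2 ⟨hη.1.2, e, hη.2, hst⟩⟩
  sUnion_eq := by
    refine eq_univ_of_forall fun a => ?_
    induction a using ind with | h s θ hs => ?_
    exact ⟨_, ⟨s, _, subset_rfl, isOpen_basicD _, rfl⟩, mk_mem_slice hs⟩
  eq_generateFrom := rfl

/-- A germ `[s, θ]` in an open set has a neighbourhood `(s, U)` in it. -/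
theorem exists_slice_subset {s : S} {θ : Spectrum S} {hs : θ ∈ basicD (dom s)}
    {W : Set (UniversalGroupoid S)} (hW : IsOpen W) (h : mk s θ hs ∈ W) :
    ∃ (U : Set (Spectrum S)) (hU : U ⊆ basicD (dom s)), IsOpen U ∧ θ ∈ U ∧ slice s U hU ⊆ W := by
  obtain ⟨_, ⟨t, V, hV, hV', rfl⟩, h1, h2⟩ := isTopologicalBasis_slice.exists_subset_of_mem_open h hW
  obtain ⟨hθ', e, he, hst⟩ := mk_mem_slice_iff.1 h1
  -- Over D(e) the germs of s and t coincide, so a neighbourhood written with t can be rewritten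
  -- with s.
  refine ⟨V ∩ basicD (dom s) ∩ basicD e, fun η hη => hη.1.2,
    (hV'.inter (isOpen_basicD _)).inter (isOpen_basicD e), ⟨⟨hθ', hs⟩, he⟩, ?_⟩
  rintro _ ⟨η, hη, rfl⟩
  exact h2 (mk_mem_slice_iff.2 ⟨hη.1.1, e, hη.2, hst⟩)

theorem continuous_d : Continuous (d : UniversalGroupoid S → Spectrum S) := by
  refine continuous_def.2 fun U hU => isOpen_iff_mem_nhds.2 fun a => ?_
  induction a using ind with | h s θ hs => ?_
  intro h
  refine Filter.mem_of_superset ((isOpen_slice s (U := U ∩ basicD (dom s)) inter_subset_right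
    (hU.inter (isOpen_basicD _))).mem_nhds (mk_mem_slice ⟨h, hs⟩)) ?_
  rintro _ ⟨η, hη, rfl⟩
  exact hη.1

theorem continuous_r : Continuous (r : UniversalGroupoid S → Spectrum S) := by
  refine continuous_def.2 fun U hU => isOpen_iff_mem_nhds.2 fun a => ?_
  induction a using ind with | h s θ hs => ?_
  intro h
  refine Filter.mem_of_superset ((isOpen_slice s (U := {θ | ∃ h : θ ∈ basicD (dom s), act s θ h ∈ U})
    (fun η hη => hη.1) (isOpen_act_preimage s hU)).mem_nhds (mk_mem_slice ⟨hs, h⟩)) ?_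
  rintro _ ⟨η, hη, rfl⟩
  exact hη.2

theorem continuous_inv : Continuous (inv : UniversalGroupoid S → UniversalGroupoid S) := by
  refine continuous_def.2 fun W hW => isOpen_iff_mem_nhds.2 fun a => ?_
  induction a using ind with | h s θ hs => ?_
  intro h
  obtain ⟨U, hU, hU', hθ, h⟩ := exists_slice_subset hW h
  refine Filter.mem_of_superset ((isOpen_slice s (U := {θ | ∃ h : θ ∈ basicD (dom s), act s θ h ∈ U})
    (fun η hη => hη.1) (isOpen_act_preimage s hU')).mem_nhds (mk_mem_slice ⟨hs, hθ⟩)) ?_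
  rintro _ ⟨η, hη, rfl⟩
  exact h (mk_mem_slice hη.2)

theorem continuous_one : Continuous (one : Spectrum S → UniversalGroupoid S) := by
  refine continuous_def.2 fun W hW => isOpen_iff_mem_nhds.2 fun θ h => ?_
  obtain ⟨U, hU, hU', hθ, h⟩ := exists_slice_subset hW h
  exact Filter.mem_of_superset (hU'.mem_nhds hθ) fun η hη => h (mk_mem_slice hη)

theorem continuous_mul :
    Continuous fun p : {p : UniversalGroupoid S × UniversalGroupoid S // d p.1 = r p.2} =>
      mul p.1.1 p.1.2 p.2 := by
  refine continuous_def.2 fun W hW => isOpen_iff_mem_nhds.2 ?_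
  rintro ⟨⟨a, b⟩, hab⟩ h
  induction a using ind with | h s η hs => ?_
  induction b using ind with | h t θ ht => ?_
  change mul (mk s η hs) (mk t θ ht) hab ∈ W at h
  rw [mul_mk s t η θ hs ht hab] at h
  obtain ⟨U, hU, hU', hθ, h⟩ := exists_slice_subset hW h
  have h1 := (isOpen_slice s subset_rfl (isOpen_basicD (dom s))).prod
    (isOpen_slice t (U := U ∩ basicD (dom t)) inter_subset_right (hU'.inter (isOpen_basicD _)))
  refine Filter.mem_of_superset ((h1.preimage continuous_subtype_val).mem_nhds
    ⟨mk_mem_slice hs, mk_mem_slice ⟨hθ, ht⟩⟩) ?_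
  rintro ⟨⟨_, _⟩, hab'⟩ ⟨⟨η', hη', rfl⟩, ⟨θ', hθ', rfl⟩⟩
  change mul (mk s η' hη') (mk t θ' hθ'.2) hab' ∈ W
  rw [mul_mk s t η' θ' hη' hθ'.2 hab']
  exact h (mk_mem_slice hθ'.1)

theorem isOpenMap_d : IsOpenMap (d : UniversalGroupoid S → Spectrum S) := by
  intro W hW
  refine isOpen_iff_mem_nhds.2 ?_
  rintro _ ⟨a, ha, rfl⟩
  induction a using ind with | h s θ hs => ?_
  obtain ⟨U, hU, hU', hθ, h⟩ := exists_slice_subset hW ha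
  exact Filter.mem_of_superset (hU'.mem_nhds hθ) fun η hη => ⟨mk s η (hU hη), h (mk_mem_slice hη), rfl⟩

theorem injOn_d_slice (s : S) {U : Set (Spectrum S)} (hU : U ⊆ basicD (dom s)) :
    InjOn d (slice s U hU) := by
  rintro _ ⟨θ, hθ, rfl⟩ _ ⟨η, hη, rfl⟩ h
  obtain rfl : θ = η := h
  rfl

theorem isOpenEmbedding_d_slice (s : S) {U : Set (Spectrum S)} (hU : U ⊆ basicD (dom s))
    (h : IsOpen U) : IsOpenEmbedding ((slice s U hU).domRestrict d) :=
  IsOpenEmbedding.of_continuous_injective_isOpenMap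
    (continuous_d.comp continuous_subtype_val)
    (injOn_iff_injective.1 (injOn_d_slice s hU))
    (isOpenMap_d.comp (isOpen_slice s hU h).isOpenMap_subtype_val)

theorem isLocalHomeomorph_d : IsLocalHomeomorph (d : UniversalGroupoid S → Spectrum S) := by
  refine isLocalHomeomorph_iff_isOpenEmbedding_restrict.2 fun a => ?_
  induction a using ind with | h s θ hs => ?_
  exact ⟨_, (isOpen_slice s subset_rfl (isOpen_basicD _)).mem_nhds (mk_mem_slice hs),
    isOpenEmbedding_d_slice s subset_rfl (isOpen_basicD _)⟩

theorem isAmple : ArrowGroupoid.IsAmple (UniversalGroupoid S) where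
  isEmbedding_one := Function.LeftInverse.isEmbedding (f := d) (fun _ => rfl) continuous_d
    continuous_one
  continuous_r := continuous_r
  continuous_inv := continuous_inv
  continuous_mul := continuous_mul
  isLocalHomeomorph_d := isLocalHomeomorph_d
  t2Space := inferInstance
  isTopologicalBasis := Spectrum.isTopologicalBasis_compact_open

/-- The spectrum embeds in a countable power of Bool, and the groupoid is a countable union of open
slices, each embedded in the spectrum by d. -/
theorem secondCountableTopology [Countable S] :
    SecondCountableTopology (UniversalGroupoid S) := by
  have : Countable (Idem S) := Subtype.countable
  have : SecondCountableTopology (Spectrum S) :=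
    Spectrum.isEmbedding_toFun.secondCountableTopology
  have (s : S) : SecondCountableTopology (slice s (basicD (dom s)) subset_rfl) :=
    (isOpenEmbedding_d_slice s subset_rfl (isOpen_basicD _)).toIsEmbedding.secondCountableTopology
  refine TopologicalSpace.secondCountableTopology_of_countable_cover
    (fun s => isOpen_slice s subset_rfl (isOpen_basicD (dom s))) (eq_univ_of_forall fun a => ?_)
  induction a using ind with | h s θ hs => ?_
  exact mem_iUnion.2 ⟨s, mk_mem_slice hs⟩

end UniversalGroupoid

end InverseMonoidWithZero

end

/-! ### Ideals of the contracted algebra, and congruences -/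

section

open Set

/-- Every two-sided ideal of `KS` that contains the basis element `0` is either the line spanned by
this element or the whole algebra. -/
def HasOnlyTrivialIdeals (K S : Type*) [Field K] [MonoidWithZero S] : Prop :=
  ∀ J : TwoSidedIdeal (MonoidAlgebra K S), MonoidAlgebra.single (0 : S) (1 : K) ∈ J →
    (∀ a ∈ J, ∀ s : S, s ≠ 0 → a.coeff s = 0) ∨ 1 ∈ J

section

variable {K S : Type*} [Field K] [MonoidWithZero S]

theorem MonoidAlgebra.eq_single_zero {a : MonoidAlgebra K S} (h : ∀ s : S, s ≠ 0 → a.coeff s = 0) :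
    a = MonoidAlgebra.single 0 (a.coeff 0) := by
  classical
  ext s
  by_cases hs : s = 0
  · subst hs; simp
  · simp [h s hs, Ne.symm hs]

theorem MonoidAlgebra.single_zero_mul (r : K) (a : MonoidAlgebra K S) :
    ∃ r', MonoidAlgebra.single (0 : S) r * a = MonoidAlgebra.single 0 r' := by
  induction a using MonoidAlgebra.induction_linear with
  | zero => exact ⟨0, by simp⟩
  | add x y hx hy =>
    obtain ⟨r1, h1⟩ := hx
    obtain ⟨r2, h2⟩ := hy
    exact ⟨r1 + r2, by rw [mul_add, h1, h2, MonoidAlgebra.single_add]⟩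
  | single s r2 => exact ⟨r * r2, by rw [MonoidAlgebra.single_mul_single, zero_mul]⟩

theorem MonoidAlgebra.mul_single_zero (r : K) (a : MonoidAlgebra K S) :
    ∃ r', a * MonoidAlgebra.single (0 : S) r = MonoidAlgebra.single 0 r' := by
  induction a using MonoidAlgebra.induction_linear with
  | zero => exact ⟨0, by simp⟩
  | add x y hx hy =>
    obtain ⟨r1, h1⟩ := hx
    obtain ⟨r2, h2⟩ := hy
    exact ⟨r1 + r2, by rw [add_mul, h1, h2, MonoidAlgebra.single_add]⟩
  | single s r2 => exact ⟨r2 * r, by rw [MonoidAlgebra.single_mul_single, mul_zero]⟩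

theorem single_zero_mem {J : TwoSidedIdeal (MonoidAlgebra K S)}
    (h : MonoidAlgebra.single (0 : S) (1 : K) ∈ J) (r : K) :
    MonoidAlgebra.single (0 : S) r ∈ J := by
  have := J.mul_mem_left (MonoidAlgebra.single 1 r) _ h
  rwa [MonoidAlgebra.single_mul_single, mul_zero, mul_one] at this

theorem mem_span_single_zero_iff {a : MonoidAlgebra K S} :
    a ∈ TwoSidedIdeal.span ({MonoidAlgebra.single (0 : S) (1 : K)} : Set (MonoidAlgebra K S)) ↔
      ∀ s : S, s ≠ 0 → a.coeff s = 0 := by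
  classical
  constructor
  · intro ha
    -- The multiples of the basis element 0 already form an ideal, so the span is no larger.
    let N : TwoSidedIdeal (MonoidAlgebra K S) := TwoSidedIdeal.mk'
      {a | ∀ s : S, s ≠ 0 → a.coeff s = 0} (fun s _ => by simp)
      (fun hx hy s hs => by simp [hx s hs, hy s hs])
      (fun hx s hs => by simp [hx s hs])
      (fun {x y} hy s hs => by
        obtain ⟨r, hr⟩ := MonoidAlgebra.mul_single_zero (y.coeff 0) x
        rw [MonoidAlgebra.eq_single_zero hy, hr]; simp [Ne.symm hs])
      (fun {x y} hx s hs => by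
        obtain ⟨r, hr⟩ := MonoidAlgebra.single_zero_mul (x.coeff 0) y
        rw [MonoidAlgebra.eq_single_zero hx, hr]; simp [Ne.symm hs])
    have hN (x : MonoidAlgebra K S) : x ∈ N ↔ ∀ s : S, s ≠ 0 → x.coeff s = 0 := TwoSidedIdeal.mem_mk' _ _ _ _ _ _ _
    have h : TwoSidedIdeal.span ({MonoidAlgebra.single (0 : S) (1 : K)} :
        Set (MonoidAlgebra K S)) ≤ N := by
      refine TwoSidedIdeal.span_le.2 (singleton_subset_iff.2 ?_)
      exact (hN _).2 fun s hs => by simp [Ne.symm hs]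
    exact (hN _).1 (h ha)
  · intro h
    rw [MonoidAlgebra.eq_single_zero h]
    refine single_zero_mem ?_ _
    exact TwoSidedIdeal.subset_span (mem_singleton _)

/-- Correspondence theorem: ideals of the quotient are ideals of KS containing the basis element 0.
Nontriviality of S ensures that 1 is not in the line of 0. -/
theorem isSimpleRing_contractedAlgebra_iff [Nontrivial S] :
    IsSimpleRing (ContractedAlgebra K S) ↔ HasOnlyTrivialIdeals K S := by
  classical
  set N := TwoSidedIdeal.span ({MonoidAlgebra.single (0 : S) (1 : K)} : Set (MonoidAlgebra K S))
    with hN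
  have h0 : MonoidAlgebra.single (0 : S) (1 : K) ∈ N := TwoSidedIdeal.subset_span rfl
  let π : MonoidAlgebra K S →+* N.ringCon.Quotient := N.ringCon.mk'
  have hπ : Function.Surjective π := N.ringCon.mk'_surjective
  have hker (a : MonoidAlgebra K S) : π a = 0 ↔ a ∈ N := by
    rw [TwoSidedIdeal.mem_iff]
    exact RingCon.eq (c := N.ringCon) (a := a) (b := 0)
  have hnt : Nontrivial N.ringCon.Quotient := by
    refine ⟨1, 0, fun h => ?_⟩
    rw [← map_one π, hker, mem_span_single_zero_iff] at h
    simpa [MonoidAlgebra.one_def] using h 1 one_ne_zero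
  constructor
  · intro hs J hJ
    let J' : TwoSidedIdeal N.ringCon.Quotient := TwoSidedIdeal.mk' {q | ∃ a ∈ J, π a = q}
      ⟨0, J.zero_mem, map_zero π⟩
      (by rintro _ _ ⟨a, ha, rfl⟩ ⟨b, hb, rfl⟩; exact ⟨a + b, J.add_mem ha hb, map_add π a b⟩)
      (by rintro _ ⟨a, ha, rfl⟩; exact ⟨-a, J.neg_mem ha, map_neg π a⟩)
      (by
        rintro x _ ⟨a, ha, rfl⟩
        obtain ⟨b, rfl⟩ := hπ x
        exact ⟨b * a, J.mul_mem_left _ _ ha, map_mul π b a⟩)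
      (by
        rintro _ x ⟨a, ha, rfl⟩
        obtain ⟨b, rfl⟩ := hπ x
        exact ⟨a * b, J.mul_mem_right _ _ ha, map_mul π a b⟩)
    rcases hs.simple.eq_bot_or_eq_top J' with h | h
    · refine Or.inl fun a ha => mem_span_single_zero_iff.1 ((hker a).1 ?_)
      have : π a ∈ J' := (TwoSidedIdeal.mem_mk' _ _ _ _ _ _ _).2 ⟨a, ha, rfl⟩
      rw [h] at this
      exact (TwoSidedIdeal.mem_bot _).1 this
    · have : (1 : N.ringCon.Quotient) ∈ J' := by rw [h]; trivial
      obtain ⟨a, ha, ha'⟩ := (TwoSidedIdeal.mem_mk' _ _ _ _ _ _ _).1 this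
      right
      have h1 : a - 1 ∈ N := (hker _).1 (by rw [map_sub, ha', map_one, sub_self])
      have h2 : a - 1 ∈ J := by
        rw [MonoidAlgebra.eq_single_zero (mem_span_single_zero_iff.1 h1)]
        exact single_zero_mem hJ _
      simpa using J.sub_mem ha h2
  · intro h
    refine ⟨{ exists_pair_ne := ⟨⊥, ⊤, fun hbt => ?_⟩, eq_bot_or_eq_top := fun J => ?_ }⟩
    · have : (1 : N.ringCon.Quotient) ∈ (⊥ : TwoSidedIdeal N.ringCon.Quotient) := by
        rw [hbt]; trivial
      exact one_ne_zero ((TwoSidedIdeal.mem_bot _).1 this)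
    · have hJ : ∀ a, a ∈ TwoSidedIdeal.comap π J ↔ π a ∈ J := fun a => TwoSidedIdeal.mem_comap π
      rcases h (TwoSidedIdeal.comap π J) ((hJ _).2 (by rw [(hker _).2 h0]; exact J.zero_mem))
        with h | h
      · left
        refine (eq_bot_iff).2 fun q hq => ?_
        obtain ⟨a, rfl⟩ := hπ q
        exact (TwoSidedIdeal.mem_bot _).2
          ((hker a).2 (mem_span_single_zero_iff.2 (h a ((hJ a).2 hq))))
      · right
        refine (eq_top_iff).2 fun q _ => ?_
        have h1 := (hJ _).1 h
        rw [map_one] at h1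
        simpa using J.mul_mem_left q _ h1

/-- A congruence c induces KS → K(S/c), and the preimage J of the line through the class of 0 is an
ideal. If J is only the line of 0, a related pair s ≠ t is impossible because the difference of the
two basis elements lies in J. If J contains 1, then 1 and 0 are related, and so is everything. -/
theorem HasOnlyTrivialIdeals.isCongruenceFree (h : HasOnlyTrivialIdeals K S) :
    IsCongruenceFree S := by
  classical
  intro c
  let f : MonoidAlgebra K S →+* MonoidAlgebra K c.Quotient :=
    MonoidAlgebra.mapDomainRingHom K (c.mk')
  have hf (s : S) (r : K) : f (MonoidAlgebra.single s r) = MonoidAlgebra.single (s : c.Quotient) r :=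
    MonoidAlgebra.mapDomain_single ..
  have hz (s : c.Quotient) : ((0 : S) : c.Quotient) * s = (0 : S) ∧
      s * ((0 : S) : c.Quotient) = (0 : S) := by
    induction s using Con.induction_on with | H s => ?_
    rw [← Con.coe_mul, ← Con.coe_mul, zero_mul, mul_zero]
    exact ⟨rfl, rfl⟩
  have hl (x : MonoidAlgebra K c.Quotient) (r : K) :
      ∃ r', MonoidAlgebra.single ((0 : S) : c.Quotient) r * x = MonoidAlgebra.single ↑(0 : S) r' := by
    induction x using MonoidAlgebra.induction_linear with
    | zero => exact ⟨0, by simp⟩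
    | add x y hx hy =>
      obtain ⟨r1, h1⟩ := hx
      obtain ⟨r2, h2⟩ := hy
      exact ⟨r1 + r2, by rw [mul_add, h1, h2, MonoidAlgebra.single_add]⟩
    | single s r2 => exact ⟨r * r2, by rw [MonoidAlgebra.single_mul_single, (hz s).1]⟩
  have hr (x : MonoidAlgebra K c.Quotient) (r : K) :
      ∃ r', x * MonoidAlgebra.single ((0 : S) : c.Quotient) r = MonoidAlgebra.single ↑(0 : S) r' := by
    induction x using MonoidAlgebra.induction_linear with
    | zero => exact ⟨0, by simp⟩
    | add x y hx hy =>
      obtain ⟨r1, h1⟩ := hx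
      obtain ⟨r2, h2⟩ := hy
      exact ⟨r1 + r2, by rw [add_mul, h1, h2, MonoidAlgebra.single_add]⟩
    | single s r2 => exact ⟨r2 * r, by rw [MonoidAlgebra.single_mul_single, (hz s).2]⟩
  let J : TwoSidedIdeal (MonoidAlgebra K S) := TwoSidedIdeal.mk'
    {a | ∃ r, f a = MonoidAlgebra.single ((0 : S) : c.Quotient) r}
    ⟨0, by simp⟩
    (by
      rintro x y ⟨r, hx⟩ ⟨r', hy⟩
      exact ⟨r + r', by rw [map_add, hx, hy, MonoidAlgebra.single_add]⟩)
    (by rintro x ⟨r, hx⟩; exact ⟨-r, by rw [map_neg, hx, MonoidAlgebra.single_neg]⟩)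
    (by
      rintro x y ⟨r, hy⟩
      obtain ⟨r', h'⟩ := hr (f x) r
      exact ⟨r', by rw [map_mul, hy, h']⟩)
    (by
      rintro x y ⟨r, hx⟩
      obtain ⟨r', h'⟩ := hl (f y) r
      exact ⟨r', by rw [map_mul, hx, h']⟩)
  have hJ (a) : a ∈ J ↔ ∃ r, f a = MonoidAlgebra.single ((0 : S) : c.Quotient) r :=
    TwoSidedIdeal.mem_mk' _ _ _ _ _ _ _
  rcases h J ((hJ _).2 ⟨1, hf 0 1⟩) with h | h
  · left
    refine le_bot_iff.1 fun s t hst => ?_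
    change s = t
    by_contra hne
    have hmem : MonoidAlgebra.single s 1 - MonoidAlgebra.single t 1 ∈ J :=
      (hJ _).2 ⟨0, by rw [map_sub, hf, hf, (Con.eq c).2 hst]; simp⟩
    by_cases hs : s = 0
    · have := h _ hmem t fun ht => hne (hs.trans ht.symm)
      simp [hne] at this
    · have := h _ hmem s hs
      simp [Ne.symm hne] at this
  · right
    obtain ⟨r, h⟩ := (hJ _).1 h
    -- Distinct classes are distinct basis elements of K(S/c), so the class of 1 can be a multiple
    -- of the class of 0 only if the classes agree.
    have h1 : ((1 : S) : c.Quotient) = (0 : S) := by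
      by_contra hne
      have h2 := congrArg (fun x => x.coeff ((1 : S) : c.Quotient)) h
      rw [MonoidAlgebra.one_def, hf] at h2
      have h3 : ((0 : S) : c.Quotient) ≠ 1 := Ne.symm hne
      simp [h3] at h2
    have h3 (s : S) : (s : c.Quotient) = (0 : S) := by
      rw [← one_mul s, Con.coe_mul, h1, (hz s).1]
    refine top_le_iff.1 fun s t _ => (Con.eq c).1 ?_
    rw [h3 s, h3 t]

end

end

/-! ### The Steinberg algebra of the universal groupoid as the contracted algebra -/

section

open Topology Set

namespace InverseMonoidWithZero

variable {S : Type*} [InverseMonoidWithZero S]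

/-- The natural partial order on idempotents. -/
instance : PartialOrder (Idem S) where
  le e f := e.1 * f.1 = e.1
  le_refl e := e.2
  le_trans e f g hef hfg := by
    rw [← hef, mul_assoc, hfg]
  le_antisymm e f hef hfe := Subtype.ext (by
    rw [← hef, idem_mul_comm, hfe])

open Classical in
/-- The character of the principal filter of a nonzero idempotent. -/
noncomputable def principalCharacter (e : Idem S) (he : e.1 ≠ 0) : Spectrum S where
  toFun f := decide (e.1 * f.1 = e.1)
  map_zero := decide_eq_false fun h => he (by
    rw [← h]; exact mul_zero _)
  map_mul f g := by
    rw [← Bool.decide_and, decide_eq_decide]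
    change e.1 * (f.1 * g.1) = e.1 ↔ _
    constructor
    · intro h
      constructor
      · rw [← h]
        calc e.1 * (f.1 * g.1) * f.1 = e.1 * (f.1 * (g.1 * f.1)) := by simp only [mul_assoc]
          _ = e.1 * (f.1 * f.1 * g.1) := by rw [idem_mul_comm g f]; simp only [mul_assoc]
          _ = _ := by rw [f.2]
      · rw [← h]
        calc e.1 * (f.1 * g.1) * g.1 = e.1 * (f.1 * (g.1 * g.1)) := by simp only [mul_assoc]
          _ = _ := by rw [g.2]
    · rintro ⟨h1, h2⟩
      rw [← mul_assoc, h1, h2]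
  nonzero := ⟨e, decide_eq_true e.2⟩

theorem principalCharacter_mem {e : Idem S} {he : e.1 ≠ 0} {f : Idem S} :
    principalCharacter e he ∈ basicD f ↔ e.1 * f.1 = e.1 := by
  classical
  exact decide_eq_true_iff

theorem mul_dom (s : S) : s * (dom s).1 = s := by
  change s * (pinv s * s) = s
  rw [← mul_assoc, mul_pinv_mul]

theorem basicD_dom_zero : basicD (dom (0 : S)) = ∅ := by
  have h : dom (0 : S) = 0 := Subtype.ext (mul_zero _)
  rw [h]
  refine eq_empty_of_forall_notMem fun θ hθ => ?_
  change θ.toFun 0 = true at hθ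
  rw [θ.map_zero] at hθ
  exact Bool.false_ne_true hθ

namespace UniversalGroupoid

/-- The compact local bisection of all germs of `s`. -/
def germs (s : S) : Set (UniversalGroupoid S) := slice s (basicD (dom s)) subset_rfl

theorem mk_mem_germs {s t : S} {θ : Spectrum S} {hs : θ ∈ basicD (dom s)} :
    mk s θ hs ∈ germs t ↔ θ ∈ basicD (dom t) ∧ ∃ e : Idem S, θ ∈ basicD e ∧ s * e.1 = t * e.1 :=
  mk_mem_slice_iff

theorem mem_germs {t : S} {γ : UniversalGroupoid S} :
    γ ∈ germs t ↔ ∃ (θ : Spectrum S) (h : θ ∈ basicD (dom t)), γ = mk t θ h := Iff.rfl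

theorem germs_zero : germs (0 : S) = ∅ := by
  refine eq_empty_of_forall_notMem ?_
  rintro _ ⟨θ, hθ, rfl⟩
  rw [basicD_dom_zero] at hθ
  exact hθ

theorem isOpen_germs (s : S) : IsOpen (germs s) := isOpen_slice _ _ (isOpen_basicD _)

theorem continuous_section (s : S) :
    Continuous fun θ : basicD (dom s) => (mk s θ.1 θ.2 : UniversalGroupoid S) := by
  refine continuous_def.2 fun W hW => isOpen_iff_mem_nhds.2 ?_
  rintro ⟨θ, hθ⟩ h
  obtain ⟨U, hU, hU', hθ, h⟩ := exists_slice_subset hW h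
  exact Filter.mem_of_superset ((hU'.preimage continuous_subtype_val).mem_nhds hθ)
    fun η hη => h (mk_mem_slice hη)

theorem isCompact_germs (s : S) : IsCompact (germs s) := by
  have : CompactSpace (basicD (dom s)) := isCompact_iff_compactSpace.1
    (isClopen_basicD _).isClosed.isCompact
  convert isCompact_range (continuous_section s) using 1
  ext γ
  simp only [mem_germs, mem_range, Subtype.exists, eq_comm]

/-- Inversion is a continuous involution, hence open, and r = d ∘ inv. -/
theorem isOpenMap_r : IsOpenMap (r : UniversalGroupoid S → Spectrum S) := by
  have hinv : Function.Involutive (inv : UniversalGroupoid S → UniversalGroupoid S) := by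
    intro a
    induction a using ind with | h s θ hs => ?_
    rw [inv_mk, inv_mk]
    exact mk_eq_mk.2 ⟨act_pinv hs, 1, Spectrum.map_one _, by rw [pinv_pinv]⟩
  have h : IsOpenMap (inv : UniversalGroupoid S → UniversalGroupoid S) := fun U hU => by
    rw [hinv.image_eq_preimage_symm]
    exact hU.preimage continuous_inv
  have h2 : (r : UniversalGroupoid S → Spectrum S) = d ∘ inv := by
    funext a
    induction a using ind with | h s θ hs => rfl
  rw [h2]
  exact isOpenMap_d.comp h

theorem isLocalBisection_germs (s : S) : ArrowGroupoid.IsLocalBisection (germs s) := by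
  refine ⟨isOpen_germs s, (isOpenEmbedding_d_slice s _ (isOpen_basicD _)).toIsEmbedding,
    (IsOpenEmbedding.of_continuous_injective_isOpenMap (continuous_r.comp continuous_subtype_val)
      (injOn_iff_injective.1 ?_)
      (isOpenMap_r.comp (isOpen_germs s).isOpenMap_subtype_val)).toIsEmbedding⟩
  rintro _ ⟨θ, hθ, rfl⟩ _ ⟨η, hη, rfl⟩ h
  change act s θ hθ = act s η hη at h
  have h2 : θ = η := by
    rw [← act_pinv hθ, ← act_pinv hη]
    congr 1
  subst h2
  rfl

section Algebra

variable (K : Type*) [Field K]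

/-- The linear map `KS → K𝒢(S)` that sends `s` to the characteristic function of the set of its
germs. -/
noncomputable def toSteinberg : MonoidAlgebra K S →ₗ[K] (UniversalGroupoid S → K) :=
  Finsupp.linearCombination K (fun s : S => (germs s).indicator fun _ => (1 : K)) ∘ₗ
    (MonoidAlgebra.coeffLinearEquiv K).toLinearMap

variable {K}

theorem toSteinberg_single (s : S) (c : K) :
    toSteinberg K (MonoidAlgebra.single s c) = c • (germs s).indicator fun _ => (1 : K) :=
  Finsupp.linearCombination_single K c s

theorem toSteinberg_apply (a : MonoidAlgebra K S) (γ : UniversalGroupoid S) :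
    toSteinberg K a γ = ∑ s ∈ a.coeff.support, a.coeff s * (germs s).indicator (fun _ => 1) γ := by
  change Finsupp.linearCombination K (fun s : S => (germs s).indicator fun _ => (1 : K)) a.coeff γ
    = _
  rw [Finsupp.linearCombination_apply, Finsupp.sum, Finset.sum_apply]
  rfl

/-- Among the nonzero s in the support take one with dom s maximal, and evaluate at its germ over
the principal character of dom s. If t has the same germ there, then dom s ≤ dom t and s = t · dom
s; maximality forces t = s. So the value is the single coefficient of s. -/
theorem toSteinberg_eq_zero_iff (a : MonoidAlgebra K S) :
    toSteinberg K a = 0 ↔ ∀ s : S, s ≠ 0 → a.coeff s = 0 := by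
  classical
  constructor
  · intro h
    by_contra! hne
    obtain ⟨s₀, hs₀, hs₀'⟩ := hne
    obtain ⟨s, hs⟩ := Finset.exists_maximalFor (dom : S → Idem S)
      (a.coeff.support.filter (· ≠ 0))
      ⟨s₀, Finset.mem_filter.2 ⟨Finsupp.mem_support_iff.2 hs₀', hs₀⟩⟩
    have hs1 := Finset.mem_filter.1 hs.1
    have hd : (dom s).1 ≠ 0 := fun h0 => hs1.2 (by rw [← mul_dom s, h0, mul_zero])
    have hmem : principalCharacter (dom s) hd ∈ basicD (dom s) :=
      principalCharacter_mem.2 (dom s).2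
    have h1 := congrFun h (mk s _ hmem)
    rw [toSteinberg_apply, Finset.sum_eq_single s] at h1
    · rw [indicator_of_mem (mk_mem_germs.2 ⟨hmem, dom s, hmem, rfl⟩), mul_one] at h1
      exact (Finsupp.mem_support_iff.1 hs1.1) h1
    · intro t ht hts
      rw [indicator_of_notMem, mul_zero]
      intro hmt
      obtain ⟨h2, e, he, hst⟩ := mk_mem_germs.1 hmt
      rw [principalCharacter_mem] at h2 he
      have h3 : s = t * (dom s).1 := by
        calc s = s * (e.1 * (dom s).1) := by rw [idem_mul_comm, he, mul_dom]
          _ = t * (e.1 * (dom s).1) := by rw [← mul_assoc, hst, mul_assoc]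
          _ = _ := by rw [idem_mul_comm, he]
      have ht0 : t ≠ 0 := by
        rintro rfl
        exact hs1.2 (by rw [h3, zero_mul])
      have h4 : dom t ≤ dom s := hs.2 (Finset.mem_filter.2 ⟨ht, ht0⟩) h2
      have h5 : dom t = dom s := le_antisymm h4 h2
      exact hts (by rw [h3, ← h5, mul_dom])
    · exact fun h' => absurd hs1.1 h'
  · intro h
    rw [MonoidAlgebra.eq_single_zero h, toSteinberg_single, germs_zero, indicator_empty]
    exact smul_zero (a.coeff 0)

theorem finite_fiber (a : MonoidAlgebra K S) (θ : Spectrum S) :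
    {γ : UniversalGroupoid S | toSteinberg K a γ ≠ 0 ∧ d γ = θ}.Finite := by
  have h : (⋃ s ∈ a.coeff.support, {γ : UniversalGroupoid S | γ ∈ germs s ∧ d γ = θ}).Finite := by
    refine Finset.finite_toSet _ |>.biUnion fun s _ => ?_
    refine Set.Subsingleton.finite ?_
    rintro γ ⟨h1, h2⟩ γ' ⟨h1', h2'⟩
    exact injOn_d_slice s subset_rfl h1 h1' (h2.trans h2'.symm)
  refine h.subset ?_
  rintro γ ⟨h1, h2⟩
  rw [toSteinberg_apply] at h1
  obtain ⟨s, hs, hs'⟩ := Finset.exists_ne_zero_of_sum_ne_zero h1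
  refine mem_iUnion₂.2 ⟨s, hs, ?_, h2⟩
  by_contra hγ
  rw [indicator_of_notMem hγ, mul_zero] at hs'
  exact hs' rfl

/-- The second factor of a contributing pair lies in a finite fibre of d, and determines the first
factor by γ = (γγ')γ'⁻¹. Finiteness is needed because `finsum` takes the default value 0 on infinite
supports and is additive only on finite ones. -/
theorem hasFiniteSupport_conv (f : UniversalGroupoid S → K) (b : MonoidAlgebra K S)
    (c : UniversalGroupoid S) :
    Function.HasFiniteSupport fun p : {p : UniversalGroupoid S × UniversalGroupoid S //
      ∃ h : ArrowGroupoid.d p.1 = ArrowGroupoid.r p.2, ArrowGroupoid.mul p.1 p.2 h = c} =>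
        f p.1.1 * toSteinberg K b p.1.2 := by
  refine Set.Finite.of_finite_image (f := fun p => p.1.2) ((finite_fiber b (d c)).subset ?_) ?_
  · rintro _ ⟨⟨⟨γ, γ'⟩, h, rfl⟩, hp, rfl⟩
    exact ⟨right_ne_zero_of_mul hp, (ArrowGroupoid.d_mul γ γ' h).symm⟩
  · rintro ⟨⟨γ, γ'⟩, h, rfl⟩ _ ⟨⟨δ, δ'⟩, h', h''⟩ _ heq
    obtain rfl : γ' = δ' := heq
    refine Subtype.ext (Prod.ext ?_ rfl)
    have key : ∀ (γ γ' : UniversalGroupoid S) (h : ArrowGroupoid.d γ = ArrowGroupoid.r γ'),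
        γ = ArrowGroupoid.mul (ArrowGroupoid.mul γ γ' h) (ArrowGroupoid.inv γ')
          ((ArrowGroupoid.d_mul γ γ' h).trans (ArrowGroupoid.r_inv γ').symm) := by
      intro γ γ' h
      rw [ArrowGroupoid.mul_assoc _ _ _ h (ArrowGroupoid.r_inv γ').symm]
      rw! [ArrowGroupoid.mul_inv, ← h, ArrowGroupoid.mul_one]
      rfl
    rw! [key γ γ' h, key δ γ' h', h'']
    rfl

/-- A germ [st, θ] has exactly one factorization into a germ of s and a germ of t, namely [s, tθ][t,
θ], and no other arrow has one. -/
theorem conv_germs (s t : S) :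
    ArrowGroupoid.conv ((germs s).indicator fun _ => (1 : K)) ((germs t).indicator fun _ => (1 : K))
      = (germs (s * t)).indicator fun _ => (1 : K) := by
  funext c
  have hsupp : ∀ p : {p : UniversalGroupoid S × UniversalGroupoid S //
      ∃ h : ArrowGroupoid.d p.1 = ArrowGroupoid.r p.2, ArrowGroupoid.mul p.1 p.2 h = c},
      (germs s).indicator (fun _ => (1 : K)) p.1.1 * (germs t).indicator (fun _ => (1 : K)) p.1.2 ≠ 0 →
      ∃ (θ : Spectrum S) (ht : θ ∈ basicD (dom t)) (hs : act t θ ht ∈ basicD (dom s)),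
        p.1 = (mk s _ hs, mk t θ ht) ∧ c = mk (s * t) θ (mem_dom_mul ht hs) := by
    rintro ⟨⟨γ, γ'⟩, h, rfl⟩ hne
    have h1 := mem_of_indicator_ne_zero (left_ne_zero_of_mul hne)
    have h2 := mem_of_indicator_ne_zero (right_ne_zero_of_mul hne)
    obtain ⟨η, hη, h1⟩ := h1
    obtain ⟨θ, hθ, h2⟩ := h2
    dsimp only at h1 h2
    subst h1 h2
    obtain rfl : η = act t θ hθ := h
    exact ⟨θ, hθ, hη, rfl, mul_mk s t _ θ hη hθ rfl⟩
  by_cases hc : c ∈ germs (s * t)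
  · rw [indicator_of_mem hc]
    obtain ⟨θ, hθ, rfl⟩ := hc
    have h : dom (s * t) = conj t (dom s) := Subtype.ext (by
      change pinv (s * t) * (s * t) = pinv t * (pinv s * s) * t
      rw [pinv_mul_rev]; simp only [mul_assoc])
    have h' : dom (s * t) = dom (s * t) * dom t := Subtype.ext (by
      change pinv (s * t) * (s * t) = pinv (s * t) * (s * t) * (pinv t * t)
      rw [mul_assoc, mul_assoc s t, ← mul_assoc t, mul_pinv_mul])
    have ht : θ ∈ basicD (dom t) := by
      rw [h', basicD_mul] at hθ; exact hθ.2
    have hs : act t θ ht ∈ basicD (dom s) := by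
      rw [h] at hθ; exact hθ
    refine (finsum_eq_single _ ⟨(mk s _ hs, mk t θ ht), rfl, mul_mk s t _ θ hs ht rfl⟩ ?_).trans ?_
    · intro p hp
      by_contra hne
      obtain ⟨θ', ht', hs', h1, h2⟩ := hsupp p hne
      obtain ⟨rfl, -⟩ := mk_eq_mk.1 h2
      exact hp (Subtype.ext h1)
    · change (germs s).indicator (fun _ => (1 : K)) (mk s _ hs) *
        (germs t).indicator (fun _ => (1 : K)) (mk t θ ht) = 1
      rw [indicator_of_mem (mem_germs.2 ⟨_, hs, rfl⟩),
        indicator_of_mem (mem_germs.2 ⟨_, ht, rfl⟩), mul_one]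
  · rw [indicator_of_notMem hc]
    refine finsum_eq_zero_of_forall_eq_zero fun p => ?_
    by_contra hne
    obtain ⟨θ, ht, hs, -, h2⟩ := hsupp p hne
    exact hc ⟨θ, mem_dom_mul ht hs, h2⟩

theorem toSteinberg_mul (a b : MonoidAlgebra K S) :
    toSteinberg K (a * b) = ArrowGroupoid.conv (toSteinberg K a) (toSteinberg K b) := by
  induction b using MonoidAlgebra.induction_linear with
  | zero =>
    funext c
    rw [mul_zero, map_zero]
    exact (finsum_eq_zero_of_forall_eq_zero fun p => mul_zero _).symm
  | add x y hx hy =>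
    funext c
    rw [mul_add, map_add, hx, hy, map_add]
    refine Eq.trans (finsum_add_distrib (hasFiniteSupport_conv _ x c)
      (hasFiniteSupport_conv _ y c)).symm (finsum_congr fun p => (mul_add _ _ _).symm)
  | single t r =>
    induction a using MonoidAlgebra.induction_linear with
    | zero =>
      funext c
      rw [zero_mul, map_zero]
      exact (finsum_eq_zero_of_forall_eq_zero fun p => zero_mul _).symm
    | add x y hx hy =>
      funext c
      rw [add_mul, map_add, hx, hy, map_add]
      refine Eq.trans (finsum_add_distrib (hasFiniteSupport_conv _ _ c)
        (hasFiniteSupport_conv _ _ c)).symm (finsum_congr fun p => (add_mul _ _ _).symm)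
    | single s r' =>
      rw [MonoidAlgebra.single_mul_single, toSteinberg_single, toSteinberg_single,
        toSteinberg_single, ← conv_germs]
      funext c
      rw [Pi.smul_apply, ArrowGroupoid.conv, smul_finsum]
      refine finsum_congr fun p => ?_
      simp only [Pi.smul_apply, smul_eq_mul]
      ring

/-- The restriction of `f` to the arrows with domain in `A` is in the image of `KS` whenever `f` is
so. -/
def IsLocalizing (K : Type*) [Field K] (A : Set (Spectrum S)) : Prop :=
  ∀ f ∈ LinearMap.range (toSteinberg K (S := S)),
    (d ⁻¹' A).indicator f ∈ LinearMap.range (toSteinberg K (S := S))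

theorem isLocalizing_empty : IsLocalizing K (∅ : Set (Spectrum S)) := fun f _ => by
  rw [preimage_empty, indicator_empty]
  exact Submodule.zero_mem _

theorem mem_germs_mul_idem {s : S} {e : Idem S} {γ : UniversalGroupoid S} :
    γ ∈ germs (s * e.1) ↔ γ ∈ d ⁻¹' basicD e ∧ γ ∈ germs s := by
  constructor
  · rintro ⟨θ, hθ, rfl⟩
    rw [dom_mul_idem, basicD_mul] at hθ
    exact ⟨hθ.2, mk_mem_germs.2 ⟨hθ.1, e, hθ.2, by rw [mul_assoc, e.2]⟩⟩
  · rintro ⟨h, ⟨θ, hθ, rfl⟩⟩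
    refine mk_mem_germs.2 ⟨?_, e, h, by rw [mul_assoc, e.2]⟩
    rw [dom_mul_idem, basicD_mul]
    exact ⟨hθ, h⟩

/-- Right multiplication by e restricts the germs of each s to those over D(e). -/
theorem isLocalizing_basicD (e : Idem S) : IsLocalizing K (basicD e) := by
  rintro _ ⟨a, rfl⟩
  refine ⟨a * MonoidAlgebra.single e.1 1, ?_⟩
  induction a using MonoidAlgebra.induction_linear with
  | zero => rw [zero_mul, map_zero]; exact (indicator_zero K (d ⁻¹' basicD e)).symm
  | add x y hx hy =>
    rw [add_mul, map_add, hx, hy, map_add]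
    exact (indicator_add (M := K) (d ⁻¹' basicD e) _ _).symm
  | single s r =>
    rw [MonoidAlgebra.single_mul_single, mul_one, toSteinberg_single, toSteinberg_single]
    funext γ
    by_cases h1 : γ ∈ d ⁻¹' basicD e
    · by_cases h2 : γ ∈ germs s
      · rw [indicator_of_mem h1, Pi.smul_apply, Pi.smul_apply, indicator_of_mem h2,
          indicator_of_mem (mem_germs_mul_idem.2 ⟨h1, h2⟩)]
      · rw [indicator_of_mem h1, Pi.smul_apply, Pi.smul_apply, indicator_of_notMem h2,
          indicator_of_notMem fun h' => h2 (mem_germs_mul_idem.1 h').2]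
    · rw [indicator_of_notMem h1, Pi.smul_apply,
        indicator_of_notMem fun h' => h1 (mem_germs_mul_idem.1 h').1, smul_zero]

theorem IsLocalizing.sdiff {A B : Set (Spectrum S)} (hA : IsLocalizing K A)
    (hB : IsLocalizing K B) : IsLocalizing K (A \ B) := by
  intro f hf
  have h : (d ⁻¹' (A \ B)).indicator f =
      (d ⁻¹' A).indicator f - (d ⁻¹' B).indicator ((d ⁻¹' A).indicator f) := by
    funext γ
    by_cases h1 : d γ ∈ A <;> by_cases h2 : d γ ∈ B <;> simp [Set.indicator, h1, h2]
  rw [h]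
  exact Submodule.sub_mem _ (hA f hf) (hB _ (hA f hf))

theorem IsLocalizing.union {A B : Set (Spectrum S)} (hA : IsLocalizing K A)
    (hB : IsLocalizing K B) : IsLocalizing K (A ∪ B) := by
  intro f hf
  have h : (d ⁻¹' (A ∪ B)).indicator f =
      (d ⁻¹' A).indicator f + (d ⁻¹' (B \ A)).indicator f := by
    funext γ
    by_cases h1 : d γ ∈ A <;> by_cases h2 : d γ ∈ B <;> simp [Set.indicator, h1, h2]
  rw [h]
  exact Submodule.add_mem _ (hA f hf) (hB.sdiff hA f hf)

/-- A clopen set is compact, hence a finite union of sets D(e) minus finitely many D(f), and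
localizing sets are closed under differences and unions. -/
theorem isLocalizing_of_isClopen {A : Set (Spectrum S)} (hA : IsClopen A) : IsLocalizing K A := by
  classical
  have key : ∃ W : Set (Spectrum S), A ⊆ W ∧ W ⊆ A ∧ IsLocalizing K W := by
    refine hA.isClosed.isCompact.induction_on (p := fun V => ∃ W, V ⊆ W ∧ W ⊆ A ∧ IsLocalizing K W)
      ⟨∅, subset_rfl, empty_subset _, isLocalizing_empty⟩ ?_ ?_ ?_
    · rintro V V' h ⟨W, h1, h2⟩
      exact ⟨W, h.trans h1, h2⟩
    · rintro V V' ⟨W, h1, h2, h3⟩ ⟨W', h1', h2', h3'⟩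
      exact ⟨W ∪ W', union_subset_union h1 h1', union_subset h2 h2', h3.union h3'⟩
    · intro θ hθ
      obtain ⟨e, I, h1, h2, h3⟩ := exists_basicD_sdiff_subset hA.isOpen hθ
      suffices h : ∀ J ⊆ I, ∃ W : Set (Spectrum S), IsOpen W ∧ θ ∈ W ∧ IsLocalizing K W ∧
          W ⊆ {η | η ∈ basicD e ∧ ∀ f ∈ J, η ∉ basicD f} by
        obtain ⟨W, hW, hθW, hW', hWI⟩ := h I subset_rfl
        exact ⟨W, mem_nhdsWithin_of_mem_nhds (hW.mem_nhds hθW), W, subset_rfl,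
          fun η hη => h3 η (hWI hη).1 (hWI hη).2, hW'⟩
      intro J
      induction J using Finset.induction_on with
      | empty =>
        exact fun _ => ⟨basicD e, isOpen_basicD e, h1, isLocalizing_basicD e, fun η hη => ⟨hη, by simp⟩⟩
      | insert f J _ ih =>
        intro hJ
        obtain ⟨W, hW, hθW, hW', hWI⟩ := ih ((Finset.subset_insert _ _).trans hJ)
        refine ⟨W \ basicD f, hW.sdiff (isClopen_basicD f).isClosed,
          ⟨hθW, h2 f (hJ (Finset.mem_insert_self _ _))⟩, hW'.sdiff (isLocalizing_basicD f),
          fun η hη => ⟨(hWI hη.1).1, fun g hg => ?_⟩⟩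
        rcases Finset.mem_insert.1 hg with rfl | hg
        · exact hη.2
        · exact (hWI hη.1).2 g hg
  obtain ⟨W, h1, h2, h3⟩ := key
  rwa [subset_antisymm h1 h2]

theorem indicator_germs_mem (s : S) :
    (germs s).indicator (fun _ => (1 : K)) ∈ LinearMap.range (toSteinberg K (S := S)) :=
  ⟨MonoidAlgebra.single s 1, by rw [toSteinberg_single, one_smul]⟩

/-- Near an arrow [s, θ] a bisection coincides with the germs of s over a clopen set of units.
Compactness glues finitely many of these pieces, each in the image by localization. -/
theorem indicator_mem_of_isLocalBisection {U : Set (UniversalGroupoid S)}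
    (hU : ArrowGroupoid.IsLocalBisection U) (hU' : IsCompact U) :
    U.indicator (fun _ => (1 : K)) ∈ LinearMap.range (toSteinberg K (S := S)) := by
  have hinj : InjOn d U := injOn_iff_injective.2 hU.2.1.injective
  obtain ⟨A, hA, hUA, h⟩ : ∃ A : Set (Spectrum S), IsClopen A ∧ U ⊆ d ⁻¹' A ∧
      (U ∩ d ⁻¹' A).indicator (fun _ => (1 : K)) ∈ LinearMap.range (toSteinberg K (S := S)) := by
    refine hU'.induction_on (p := fun V => ∃ A : Set (Spectrum S), IsClopen A ∧ V ⊆ d ⁻¹' A ∧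
      (U ∩ d ⁻¹' A).indicator (fun _ => (1 : K)) ∈ LinearMap.range (toSteinberg K (S := S)))
      ⟨∅, isClopen_empty, empty_subset _, ?_⟩ ?_ ?_ ?_
    · rw [preimage_empty, inter_empty, indicator_empty]
      exact Submodule.zero_mem _
    · rintro V V' h ⟨A, h1, h2, h3⟩
      exact ⟨A, h1, h.trans h2, h3⟩
    · rintro V V' ⟨A, h1, h2, h3⟩ ⟨B, h1', h2', h3'⟩
      refine ⟨A ∪ B, h1.union h1', union_subset_union h2 h2', ?_⟩
      -- The second piece is cut down to the complement of A so that the overlap is counted once.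
      have h : (U ∩ d ⁻¹' (A ∪ B)).indicator (fun _ => (1 : K)) =
          (U ∩ d ⁻¹' A).indicator (fun _ => (1 : K)) +
            (d ⁻¹' Aᶜ).indicator ((U ∩ d ⁻¹' B).indicator (fun _ => (1 : K))) := by
        funext γ
        by_cases h1 : d γ ∈ A <;> by_cases h2 : d γ ∈ B <;> by_cases h3 : γ ∈ U <;>
          simp [Set.indicator, h1, h2, h3]
      rw [h]
      exact Submodule.add_mem _ h3 (isLocalizing_of_isClopen h1.compl _ h3')
    · intro γ hγ
      induction γ using ind with | h s θ hs => ?_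
      obtain ⟨V, hV, hVo, hθ, hVU⟩ := exists_slice_subset hU.1 hγ
      obtain ⟨A, ⟨hA, hA'⟩, hθA, hAV⟩ :=
        Spectrum.isTopologicalBasis_compact_open.exists_subset_of_mem_open hθ hVo
      have hAc : IsClopen A := ⟨hA'.isClosed, hA⟩
      refine ⟨d ⁻¹' A, mem_nhdsWithin_of_mem_nhds ((hA.preimage continuous_d).mem_nhds hθA), A,
        hAc, subset_rfl, ?_⟩
      -- Over each point of A the germ of s lies in U, and injectivity of d on U leaves room for no
      -- other arrow.
      have h : U ∩ d ⁻¹' A = d ⁻¹' A ∩ germs s := by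
        ext γ
        constructor
        · rintro ⟨h1, h2⟩
          refine ⟨h2, d γ, hV (hAV h2), hinj h1 (hVU (mk_mem_slice (hAV h2))) rfl⟩
        · rintro ⟨h1, η, hη, rfl⟩
          exact ⟨hVU (mk_mem_slice (hAV h1)), h1⟩
      rw [h, ← indicator_indicator]
      exact isLocalizing_of_isClopen hAc _ (indicator_germs_mem s)
  rwa [inter_eq_left.2 hUA] at h

theorem range_toSteinberg :
    LinearMap.range (toSteinberg K (S := S)) = ArrowGroupoid.steinberg (UniversalGroupoid S) K := by
  refine le_antisymm ?_ (Submodule.span_le.2 ?_)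
  · rintro _ ⟨a, rfl⟩
    induction a using MonoidAlgebra.induction_linear with
    | zero => rw [map_zero]; exact Submodule.zero_mem _
    | add x y hx hy => rw [map_add]; exact Submodule.add_mem _ hx hy
    | single s r =>
      rw [toSteinberg_single]
      exact Submodule.smul_mem _ _ (Submodule.subset_span
        ⟨_, isLocalBisection_germs s, isCompact_germs s, rfl⟩)
  · rintro _ ⟨U, hU, hU', rfl⟩
    exact indicator_mem_of_isLocalBisection hU hU'

variable (K) in
-- `toSteinberg` is additive, multiplicative, onto the Steinberg algebra, and its kernel is the line
-- of 0. So images and preimages match the ideals on both sides.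
theorem isSimpleSteinberg_iff [Nontrivial S] :
    ArrowGroupoid.IsSimpleSteinberg (UniversalGroupoid S) K ↔ HasOnlyTrivialIdeals K S := by
  have hmem (a : MonoidAlgebra K S) :
      toSteinberg K a ∈ ArrowGroupoid.steinberg (UniversalGroupoid S) K := by
    rw [← range_toSteinberg]; exact ⟨a, rfl⟩
  constructor
  · rintro ⟨-, h⟩ J hJ
    let I := J.asIdeal.toAddSubgroup.map (toSteinberg K (S := S)).toAddMonoidHom
    have hI (f) : f ∈ I ↔ ∃ a ∈ J, toSteinberg K a = f := Iff.rfl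
    have hI1 : I ≤ (ArrowGroupoid.steinberg (UniversalGroupoid S) K).toAddSubgroup := by
      rintro _ ⟨a, -, rfl⟩
      exact hmem a
    have hI2 : ∀ f ∈ I, ∀ g ∈ ArrowGroupoid.steinberg (UniversalGroupoid S) K,
        ArrowGroupoid.conv g f ∈ I ∧ ArrowGroupoid.conv f g ∈ I := by
      rintro _ ⟨a, ha, rfl⟩ g hg
      rw [← range_toSteinberg] at hg
      obtain ⟨b, rfl⟩ := hg
      exact ⟨(hI _).2 ⟨b * a, J.mul_mem_left _ _ ha, toSteinberg_mul b a⟩,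
        (hI _).2 ⟨a * b, J.mul_mem_right _ _ ha, toSteinberg_mul a b⟩⟩
    rcases h I hI1 hI2 with h | h
    · left
      intro a ha
      rw [← toSteinberg_eq_zero_iff]
      have : toSteinberg K a ∈ I := (hI _).2 ⟨a, ha, rfl⟩
      rw [h] at this
      exact this
    · right
      have : toSteinberg K (1 : MonoidAlgebra K S) ∈ I := by rw [h]; exact hmem 1
      obtain ⟨a, ha, ha'⟩ := (hI _).1 this
      rw [← sub_eq_zero, ← map_sub, toSteinberg_eq_zero_iff] at ha'
      have h2 : a - 1 ∈ J := by
        rw [MonoidAlgebra.eq_single_zero ha']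
        exact single_zero_mem hJ _
      simpa using J.sub_mem ha h2
  · intro h
    constructor
    · intro hbot
      have h1 := hmem 1
      rw [hbot, Submodule.mem_bot, toSteinberg_eq_zero_iff] at h1
      simpa [MonoidAlgebra.one_def] using h1 1 one_ne_zero
    · intro I hI hconv
      let J : TwoSidedIdeal (MonoidAlgebra K S) := TwoSidedIdeal.mk' {a | toSteinberg K a ∈ I}
        (by rw [mem_ofPred_eq, map_zero]; exact I.zero_mem)
        (fun {x y} hx hy => by rw [mem_ofPred_eq, map_add]; exact I.add_mem hx hy)
        (fun {x} hx => by rw [mem_ofPred_eq, map_neg]; exact I.neg_mem hx)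
        (fun {x y} hy => by
          rw [mem_ofPred_eq, toSteinberg_mul]; exact (hconv _ hy _ (hmem x)).1)
        (fun {x y} hx => by
          rw [mem_ofPred_eq, toSteinberg_mul]; exact (hconv _ hx _ (hmem y)).2)
      have hJ (a : MonoidAlgebra K S) : a ∈ J ↔ toSteinberg K a ∈ I :=
        TwoSidedIdeal.mem_mk' _ _ _ _ _ _ _
      have hlift (f) (hf : f ∈ I) : ∃ a, toSteinberg K a = f := by
        have h1 := hI hf
        rw [← range_toSteinberg] at h1
        exact h1
      have hJ0 : MonoidAlgebra.single (0 : S) (1 : K) ∈ J := by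
        rw [hJ, (toSteinberg_eq_zero_iff _).2 fun s hs => by simp [Ne.symm hs]]
        exact I.zero_mem
      rcases h J hJ0 with h | h
      · left
        refine (AddSubgroup.eq_bot_iff_forall _).2 fun f hf => ?_
        obtain ⟨a, rfl⟩ := hlift f hf
        exact (toSteinberg_eq_zero_iff a).2 (h a ((hJ a).2 hf))
      · right
        refine le_antisymm hI fun f hf => ?_
        have h1 : f ∈ LinearMap.range (toSteinberg K (S := S)) := by
          rw [range_toSteinberg]; exact hf
        obtain ⟨a, rfl⟩ := h1
        -- The image of 1 is an identity for convolution, so an ideal containing it is everything.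
        rw [← mul_one a, toSteinberg_mul]
        exact (hconv _ ((hJ 1).1 h) _ (hmem a)).1

end Algebra

end UniversalGroupoid

end InverseMonoidWithZero

end

/-! ### The inverse hull of X*G: normal forms and idempotents -/

section

open Set

namespace InverseHull

open SymmetricInverseMonoid InverseMonoidWithZero

section Monoid

variable {M : Type*} [Monoid M] [IsLeftCancelMul M]

/-- `s` is defined at `a`, with value `b`. -/
def Maps (s : InverseHull M) (a b : M) : Prop := PEquiv.toFun s.1 a = some b

theorem ext_maps {s t : InverseHull M} (h : ∀ a b, s.Maps a b ↔ t.Maps a b) : s = t :=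
  Subtype.ext (ext_some h)

theorem Maps.eq {s : InverseHull M} {a b b' : M} (h : s.Maps a b) (h' : s.Maps a b') : b = b' :=
  Option.some.inj (h.symm.trans h')

theorem Maps.inj {s : InverseHull M} {a a' b : M} (h : s.Maps a b) (h' : s.Maps a' b) : a = a' :=
  SymmetricInverseMonoid.inj s.1 h h'

theorem maps_mul {s t : InverseHull M} {a c : M} :
    (s * t).Maps a c ↔ ∃ b, t.Maps a b ∧ s.Maps b c :=
  mul_eq_some s.1 t.1 a c

theorem not_maps_zero {a b : M} : ¬ (0 : InverseHull M).Maps a b :=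
  fun h => Option.noConfusion rfl (heq_of_eq (show (none : Option M) = some b from h))

theorem maps_one {a b : M} : (1 : InverseHull M).Maps a b ↔ a = b :=
  ⟨fun h => Option.some.inj h, fun h => congrArg some h⟩

theorem maps_pinv {s : InverseHull M} {a b : M} : (pinv s).Maps b a ↔ s.Maps a b :=
  symm_eq_some s.1 a b

theorem maps_idem {e : InverseHull M} (he : e * e = e) {a b : M} (h : e.Maps a b) : a = b := by
  have h1 := h
  rw [← he, maps_mul] at h1
  obtain ⟨c, h2, h3⟩ := h1
  obtain rfl := h.eq h2
  exact h.inj h3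

open Classical in
/-- The character of the idempotents that are defined at `m`. -/
noncomputable def pointCharacter (m : M) : Spectrum (InverseHull M) where
  toFun e := decide (e.1.Maps m m)
  map_zero := decide_eq_false not_maps_zero
  map_mul e f := by
    rw [← Bool.decide_and, decide_eq_decide]
    constructor
    · intro h
      obtain ⟨b, h1, h2⟩ := maps_mul.1 h
      obtain rfl := maps_idem f.2 h1
      exact ⟨h2, h1⟩
    · rintro ⟨h1, h2⟩
      exact maps_mul.2 ⟨m, h2, h1⟩
  nonzero := ⟨1, decide_eq_true (maps_one.2 rfl)⟩

theorem pointCharacter_mem {m : M} {e : Idem (InverseHull M)} :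
    pointCharacter m ∈ basicD e ↔ e.1.Maps m m := by
  classical
  exact decide_eq_true_iff

/-- Conjugating by s transports "e is defined at n" back to m, so point characters move as the
points of M do. -/
theorem act_pointCharacter {s : InverseHull M} {m n : M} (h : s.Maps m n)
    (hs : pointCharacter m ∈ basicD (dom s)) : act s (pointCharacter m) hs = pointCharacter n := by
  classical
  refine Spectrum.ext' fun e => ?_
  refine decide_eq_decide.2 ?_
  change (pinv s * e.1 * s).Maps m m ↔ _
  simp only [maps_mul]
  constructor
  · rintro ⟨b, h1, c, h2, h3⟩
    obtain rfl := h.eq h1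
    obtain rfl := h.eq (maps_pinv.1 h3)
    exact h2
  · intro h1
    exact ⟨n, h, n, h1, maps_pinv.2 h⟩

end Monoid

section SelfSimilar

variable {G X : Type*} [Group G] {σ : SelfSimilarAction G X}

variable (σ) in
/-- The element `u g v*` of the inverse hull of `X*G`, that is, the partial bijection
`v m ↦ u g m`. -/
noncomputable def triple (u : List X) (g : G) (v : List X) : InverseHull σ.WordMonoid :=
  ⟨leftMul ⟨u, g⟩ * symm (leftMul ⟨v, 1⟩), Submonoid.mul_mem _
    (Submonoid.subset_closure (Or.inl (Or.inl ⟨_, rfl⟩)))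
    (Submonoid.subset_closure (Or.inl (Or.inr ⟨_, rfl⟩)))⟩

theorem mk_mul_mk (u v : List X) (g h : G) : (⟨u, g⟩ * ⟨v, h⟩ : σ.WordMonoid) =
    ⟨u ++ σ.actWord g v, σ.secWord g v * h⟩ := rfl

theorem mk_one_mul_mk (u v : List X) (h : G) :
    (⟨u, 1⟩ * ⟨v, h⟩ : σ.WordMonoid) = ⟨u ++ v, h⟩ := by
  rw [mk_mul_mk, σ.actWord_one, σ.secWord_one, one_mul]

theorem maps_triple {u v : List X} {g : G} {a b : σ.WordMonoid} : (triple σ u g v).Maps a b ↔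
    ∃ w h, a = ⟨v ++ w, h⟩ ∧ b = ⟨u ++ σ.actWord g w, σ.secWord g w * h⟩ := by
  refine (mul_eq_some _ _ _ _).trans ?_
  constructor
  · rintro ⟨c, h1, h2⟩
    obtain ⟨w, h⟩ := c
    have h1' := (symm_eq_some _ _ _).1 h1
    refine ⟨w, h, ?_, (Option.some.inj h2).symm⟩
    rw [← mk_one_mul_mk]
    exact (Option.some.inj h1').symm
  · rintro ⟨w, h, rfl, rfl⟩
    refine ⟨⟨w, h⟩, (symm_eq_some _ _ _).2 ?_, rfl⟩
    rw [← mk_one_mul_mk]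
    rfl

theorem maps_triple_append (u v w : List X) (g h : G) : (triple σ u g v).Maps ⟨v ++ w, h⟩
    ⟨u ++ σ.actWord g w, σ.secWord g w * h⟩ :=
  maps_triple.2 ⟨w, h, rfl, rfl⟩

theorem maps_triple_self (u v : List X) (g h : G) :
    (triple σ u g v).Maps ⟨v, h⟩ ⟨u, g * h⟩ :=
  maps_triple.2 ⟨[], h, by rw [List.append_nil], by
    change _ = (⟨u ++ [], g * h⟩ : σ.WordMonoid)
    rw [List.append_nil]⟩

theorem triple_ne_zero (u v : List X) (g : G) : triple σ u g v ≠ 0 := fun h =>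
  not_maps_zero (h ▸ maps_triple_self u v g 1)

/-- The word v is the shortest one in the domain: each domain contains the other's word, so each
word is a prefix of the other. The value at v then gives u and g. -/
theorem triple_inj {u v u' v' : List X} {g g' : G} :
    triple σ u g v = triple σ u' g' v' ↔ u = u' ∧ g = g' ∧ v = v' := by
  refine ⟨fun h => ?_, fun ⟨h1, h2, h3⟩ => by rw [h1, h2, h3]⟩
  have h1 := maps_triple_self (σ := σ) u v g 1
  rw [h] at h1
  obtain ⟨w, k, h2, h3⟩ := maps_triple.1 h1
  have h1' := maps_triple_self (σ := σ) u' v' g' 1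
  rw [← h] at h1'
  obtain ⟨w', k', h2', h3'⟩ := maps_triple.1 h1'
  have hv : v = v' ++ w := congrArg SelfSimilarAction.WordMonoid.word h2
  have hv' : v' = v ++ w' := congrArg SelfSimilarAction.WordMonoid.word h2'
  have hw : w = [] := by
    have h4 := congrArg List.length hv
    have h5 := congrArg List.length hv'
    rw [List.length_append] at h4 h5
    exact List.eq_nil_of_length_eq_zero (by omega)
  subst hw
  rw [List.append_nil] at hv
  have hk : (1 : G) = k := congrArg SelfSimilarAction.WordMonoid.grp h2
  have hu : u = u' ++ [] := congrArg SelfSimilarAction.WordMonoid.word h3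
  have hg : g * 1 = g' * k := congrArg SelfSimilarAction.WordMonoid.grp h3
  rw [List.append_nil] at hu
  rw [← hk, mul_one, mul_one] at hg
  exact ⟨hu, hg, hv⟩

theorem triple_nil_one_nil : triple σ [] 1 [] = 1 := by
  refine ext_maps fun a b => ?_
  rw [maps_triple, maps_one]
  constructor
  · rintro ⟨w, h, rfl, rfl⟩
    rw [σ.actWord_one, σ.secWord_one, one_mul]
  · rintro rfl
    exact ⟨a.word, a.grp, rfl, by rw [σ.actWord_one, σ.secWord_one, one_mul]; rfl⟩

theorem triple_mul_triple_append (u v w v' : List X) (g g' : G) :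
    triple σ u g v * triple σ (v ++ w) g' v' =
      triple σ (u ++ σ.actWord g w) (σ.secWord g w * g') v' := by
  refine ext_maps fun a b => ?_
  rw [maps_mul, maps_triple]
  constructor
  · rintro ⟨c, h1, h2⟩
    obtain ⟨t, h, rfl, rfl⟩ := maps_triple.1 h1
    rw [List.append_assoc] at h2
    obtain rfl := h2.eq (maps_triple_append ..)
    refine ⟨t, h, rfl, ?_⟩
    rw [σ.actWord_append, σ.secWord_append, σ.actWord_mul, σ.secWord_mul, List.append_assoc,
      mul_assoc]
  · rintro ⟨t, h, rfl, rfl⟩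
    refine ⟨_, maps_triple_append .., ?_⟩
    rw [List.append_assoc]
    convert maps_triple_append u v _ g _ using 2
    · rw [σ.actWord_append, σ.actWord_mul, List.append_assoc]
    · rw [σ.secWord_append, σ.secWord_mul, mul_assoc]

/-- This is the case where the domain word of the left factor extends the range word of the right
one. The extension is written as g'(w), so that pulling it back through g' simply appends w to v'.
-/
theorem triple_append_mul_triple (u v w v' : List X) (g g' : G) :
    triple σ u g (v ++ σ.actWord g' w) * triple σ v g' v' =
      triple σ u (g * σ.secWord g' w) (v' ++ w) := by
  refine ext_maps fun a b => ?_
  rw [maps_mul, maps_triple]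
  constructor
  · rintro ⟨c, h1, h2⟩
    obtain ⟨t, h, rfl, rfl⟩ := maps_triple.1 h1
    obtain ⟨t', h', h3, rfl⟩ := maps_triple.1 h2
    have h4 : v ++ σ.actWord g' t = v ++ σ.actWord g' w ++ t' :=
      congrArg SelfSimilarAction.WordMonoid.word h3
    have h5 : σ.secWord g' t * h = h' := congrArg SelfSimilarAction.WordMonoid.grp h3
    rw [List.append_assoc] at h4
    -- Applying g'⁻¹ to the common word shows that t itself starts with w.
    have h6 := congrArg (σ.actWord g'⁻¹) (List.append_cancel_left h4)
    rw [← σ.actWord_mul, inv_mul_cancel, σ.actWord_one, σ.actWord_append, ← σ.actWord_mul,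
      inv_mul_cancel, σ.actWord_one] at h6
    obtain ⟨t'', rfl⟩ : ∃ t'', t = w ++ t'' := ⟨_, h6⟩
    rw [σ.actWord_append] at h4
    have h7 := List.append_cancel_left (List.append_cancel_left h4)
    subst h7 h5
    refine ⟨t'', h, by rw [List.append_assoc], ?_⟩
    rw [σ.actWord_mul, σ.secWord_append, σ.secWord_mul, mul_assoc]
  · rintro ⟨t, h, rfl, rfl⟩
    rw [List.append_assoc]
    refine ⟨_, maps_triple_append .., ?_⟩
    rw [σ.actWord_append, ← List.append_assoc]
    convert maps_triple_append u (v ++ σ.actWord g' w) _ g _ using 2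
    · rw [σ.actWord_mul]
    · rw [σ.secWord_append, σ.secWord_mul, mul_assoc]

/-- A point where the product is defined passes through an element whose word begins with both v and
u', and two prefixes of one word are comparable. -/
theorem prefix_or_prefix_of_triple_mul_ne_zero {u v u' v' : List X} {g g' : G}
    (h : triple σ u g v * triple σ u' g' v' ≠ 0) : v <+: u' ∨ u' <+: v := by
  by_contra hne
  refine h (ext_maps fun a b => ⟨fun h => ?_, fun h => absurd h not_maps_zero⟩)
  obtain ⟨c, h1, h2⟩ := maps_mul.1 h
  obtain ⟨t, h, rfl, rfl⟩ := maps_triple.1 h1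
  obtain ⟨t', h', h3, rfl⟩ := maps_triple.1 h2
  have h4 : u' ++ σ.actWord g' t = v ++ t' := congrArg SelfSimilarAction.WordMonoid.word h3
  exact absurd (List.prefix_or_prefix_of_prefix (h4 ▸ List.prefix_append v t')
    (List.prefix_append u' _)) hne

theorem actWord_mul_inv (g : G) (w : List X) : σ.actWord g (σ.actWord g⁻¹ w) = w := by
  rw [← σ.actWord_mul, mul_inv_cancel, σ.actWord_one]

theorem pinv_triple (u v : List X) (g : G) : pinv (triple σ u g v) = triple σ v g⁻¹ u := by
  have h (u v : List X) (g : G) : triple σ u g v * triple σ v g⁻¹ u = triple σ u 1 u := by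
    have := triple_mul_triple_append (σ := σ) u v [] u g g⁻¹
    rw [List.append_nil] at this
    rw [this]
    change triple σ (u ++ []) (g * g⁻¹) u = _
    rw [List.append_nil, mul_inv_cancel]
  have h2 (u v : List X) (g : G) : triple σ u 1 u * triple σ u g v = triple σ u g v := by
    have := triple_mul_triple_append (σ := σ) u u [] v 1 g
    rw [List.append_nil] at this
    rw [this]
    change triple σ (u ++ []) (1 * g) v = _
    rw [List.append_nil, one_mul]
  refine (pinv_unique _ _ ?_ ?_).symm
  · rw [h, h2]
  · have h3 := h v u g⁻¹
    rw [inv_inv] at h3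
    rw [h3, h2]

theorem triple_mul_mem_range (u v u' v' : List X) (g g' : G) :
    triple σ u g v * triple σ u' g' v' = 0 ∨
      ∃ u'' g'' v'', triple σ u g v * triple σ u' g' v' = triple σ u'' g'' v'' := by
  by_cases h : triple σ u g v * triple σ u' g' v' = 0
  · exact Or.inl h
  · right
    rcases prefix_or_prefix_of_triple_mul_ne_zero h with ⟨w, rfl⟩ | ⟨w, rfl⟩
    · exact ⟨_, _, _, triple_mul_triple_append ..⟩
    · refine ⟨u, g * σ.secWord g' (σ.actWord g'⁻¹ w), v' ++ σ.actWord g'⁻¹ w, ?_⟩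
      rw [← triple_append_mul_triple, actWord_mul_inv]

/-- The generators have this form, and the form is closed under products: comparable inner words
give one of the two product formulas, incomparable ones give 0. -/
theorem eq_zero_or_triple (s : InverseHull σ.WordMonoid) :
    s = 0 ∨ ∃ u g v, s = triple σ u g v := by
  have hleft (m : σ.WordMonoid) : ∀ hm, (⟨leftMul m, hm⟩ : InverseHull σ.WordMonoid) =
      triple σ m.word m.grp [] := by
    intro hm
    refine ext_maps fun a b => ?_
    rw [maps_triple]
    constructor
    · intro h
      exact ⟨a.word, a.grp, rfl, (Option.some.inj h).symm⟩
    · rintro ⟨w, h, rfl, rfl⟩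
      rfl
  suffices h : ∀ x ∈ hull σ.WordMonoid, ∃ t : InverseHull σ.WordMonoid, t.1 = x ∧
      (t = 0 ∨ ∃ u g v, t = triple σ u g v) by
    obtain ⟨t, h, ht⟩ := h s.1 s.2
    rwa [← show t = s from Subtype.ext h]
  intro x hx
  induction hx using Submonoid.closure_induction with
  | mem x hx =>
    rcases hx with (⟨m, rfl⟩ | ⟨m, rfl⟩) | rfl
    · exact ⟨_, rfl, Or.inr ⟨_, _, _,
        hleft m (Submonoid.subset_closure (Or.inl (Or.inl ⟨m, rfl⟩)))⟩⟩
    · refine ⟨pinv (triple σ m.word m.grp []), ?_, Or.inr ⟨_, _, _, pinv_triple ..⟩⟩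
      rw [← hleft m (Submonoid.subset_closure (Or.inl (Or.inl ⟨m, rfl⟩)))]
      rfl
    · exact ⟨0, rfl, Or.inl rfl⟩
  | one => exact ⟨1, rfl, Or.inr ⟨[], 1, [], triple_nil_one_nil.symm⟩⟩
  | mul x y hx hy ihx ihy =>
    obtain ⟨t, rfl, rfl | ⟨u, g, v, rfl⟩⟩ := ihx
    · exact ⟨0 * _, congrArg (_ * ·) ihy.choose_spec.1, Or.inl (zero_mul _)⟩
    · obtain ⟨t, rfl, rfl | ⟨u', g', v', rfl⟩⟩ := ihy
      · exact ⟨_ * 0, rfl, Or.inl (mul_zero _)⟩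
      · exact ⟨_ * _, rfl, triple_mul_mem_range ..⟩

instance [Countable G] [Countable X] : Countable (InverseHull σ.WordMonoid) := by
  let f : Option (List X × G × List X) → InverseHull σ.WordMonoid
    | none => 0
    | some (u, g, v) => triple σ u g v
  refine Function.Surjective.countable (f := f) fun s => ?_
  rcases eq_zero_or_triple s with rfl | ⟨u, g, v, rfl⟩
  · exact ⟨none, rfl⟩
  · exact ⟨some (u, g, v), rfl⟩

instance : Nontrivial (InverseHull σ.WordMonoid) :=
  ⟨triple σ [] 1 [], 0, triple_ne_zero _ _ _⟩

theorem triple_mul_self (u v w : List X) (g h : G) :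
    triple σ u g v * triple σ v h w = triple σ u (g * h) w := by
  have := triple_mul_triple_append (σ := σ) u v [] w g h
  rw [List.append_nil] at this
  rw [this]
  change triple σ (u ++ []) (g * h) w = _
  rw [List.append_nil]

/-- The idempotent `u u*`. -/
noncomputable def wordIdem (u : List X) : Idem (InverseHull σ.WordMonoid) :=
  ⟨triple σ u 1 u, by rw [triple_mul_self, mul_one]⟩

theorem dom_triple (u v : List X) (g : G) : dom (triple σ u g v) = wordIdem v :=
  Subtype.ext (by
    change pinv (triple σ u g v) * triple σ u g v = triple σ v 1 v
    rw [pinv_triple, triple_mul_self, inv_mul_cancel])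

/-- An idempotent is its own inverse, which forces u = v; then g² = g forces g = 1. -/
theorem eq_zero_or_wordIdem (e : Idem (InverseHull σ.WordMonoid)) :
    e = 0 ∨ ∃ u, e = wordIdem u := by
  rcases eq_zero_or_triple e.1 with h | ⟨u, g, v, h⟩
  · exact Or.inl (Subtype.ext h)
  · right
    have h1 := pinv_idem e.2
    rw [h, pinv_triple, triple_inj] at h1
    obtain ⟨rfl, -, -⟩ := h1
    have h2 := e.2
    rw [h, triple_mul_self, triple_inj] at h2
    exact ⟨v, Subtype.ext (by rw [h, mul_eq_left.1 h2.2.1]; rfl)⟩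

theorem wordIdem_append_mul (u w : List X) :
    (wordIdem (u ++ w) * wordIdem u : Idem (InverseHull σ.WordMonoid)) = wordIdem (u ++ w) := by
  refine Subtype.ext ?_
  have := triple_append_mul_triple (σ := σ) (u ++ w) u w u 1 1
  rw [σ.actWord_one, σ.secWord_one, mul_one] at this
  exact this

theorem basicD_wordIdem_append (u w : List X) :
    basicD (wordIdem (u ++ w) : Idem (InverseHull σ.WordMonoid)) ⊆ basicD (wordIdem u) := by
  rw [← wordIdem_append_mul, basicD_mul]
  exact inter_subset_right

theorem basicD_zero : basicD (0 : Idem (InverseHull σ.WordMonoid)) = ∅ :=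
  eq_empty_of_forall_notMem fun θ hθ => Bool.false_ne_true (θ.map_zero.symm.trans hθ)

theorem prefix_or_prefix_of_mem_basicD {u v : List X} {θ : Spectrum (InverseHull σ.WordMonoid)}
    (hu : θ ∈ basicD (wordIdem u)) (hv : θ ∈ basicD (wordIdem v)) : u <+: v ∨ v <+: u := by
  refine prefix_or_prefix_of_triple_mul_ne_zero (σ := σ) (u := u) (g := 1) (g' := 1) (v' := v)
    fun h => ?_
  have h1 := mem_basicD_mul hu hv
  have h2 : (wordIdem u * wordIdem v : Idem (InverseHull σ.WordMonoid)) = 0 := Subtype.ext h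
  rw [h2, basicD_zero] at h1
  exact h1

theorem maps_wordIdem_iff {u v : List X} {g : G} :
    (wordIdem u : Idem (InverseHull σ.WordMonoid)).1.Maps ⟨v, g⟩ ⟨v, g⟩ ↔ u <+: v := by
  refine maps_triple.trans ⟨?_, ?_⟩
  · rintro ⟨w, h, h1, -⟩
    exact ⟨w, (congrArg SelfSimilarAction.WordMonoid.word h1).symm⟩
  · rintro ⟨w, rfl⟩
    exact ⟨w, g, rfl, by rw [σ.actWord_one, σ.secWord_one, one_mul]⟩

/-- The character of m contains the idempotents of exactly the prefixes of its word, so equal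
characters give words that are prefixes of each other. -/
theorem pointCharacter_word_inj {m n : σ.WordMonoid} (h : pointCharacter m = pointCharacter n) :
    m.word = n.word := by
  have key : ∀ m n : σ.WordMonoid, pointCharacter m = pointCharacter n → m.word <+: n.word := by
    intro m n h
    refine (maps_wordIdem_iff (σ := σ) (g := n.grp)).1 ?_
    refine pointCharacter_mem.1 (h ▸ pointCharacter_mem.2 ?_)
    exact maps_wordIdem_iff.2 List.prefix_rfl
  exact (key m n h).eq_of_length_le (key n m h.symm).length_le

theorem length_actWord (g : G) (w : List X) : (σ.actWord g w).length = w.length := by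
  induction w generalizing g with
  | nil => rfl
  | cons x u ih => simp only [SelfSimilarAction.actWord, List.length_cons, ih]

end SelfSimilar

end InverseHull

end

/-! ### Fresh letters: minimality and effectiveness for inflations -/

section

open Set Filter

namespace InverseHull

open SymmetricInverseMonoid InverseMonoidWithZero

variable {G A : Type*} [Group G] {σ : SelfSimilarAction G A}

/-- The index `i` does not occur in the words of `s`. -/
def IsFresh (i : ℕ) (s : InverseHull σ.inflation.WordMonoid) : Prop :=
  ∀ u g v, s = triple σ.inflation u g v → (∀ x ∈ u, x.2 ≠ i) ∧ ∀ x ∈ v, x.2 ≠ i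

theorem eventually_ne_of_mem (u : List (A × ℕ)) : ∀ᶠ i in atTop, ∀ x ∈ u, x.2 ≠ i := by
  induction u with
  | nil => simp
  | cons y u ih =>
    filter_upwards [ih, eventually_gt_atTop y.2] with i h1 h2 x hx
    rcases List.mem_cons.1 hx with rfl | hx
    · exact h2.ne
    · exact h1 x hx

theorem eventually_isFresh (s : InverseHull σ.inflation.WordMonoid) :
    ∀ᶠ i in atTop, IsFresh i s := by
  rcases eq_zero_or_triple s with rfl | ⟨u, g, v, rfl⟩
  · exact Eventually.of_forall fun i u g v h => absurd h.symm (triple_ne_zero u v g)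
  · filter_upwards [eventually_ne_of_mem u, eventually_ne_of_mem v] with i h1 h2 u' g' v' h
    obtain ⟨rfl, rfl, rfl⟩ := triple_inj.1 h
    exact ⟨h1, h2⟩

theorem exists_isFresh (F : Finset (InverseHull σ.inflation.WordMonoid)) :
    ∃ i, ∀ s ∈ F, IsFresh i s :=
  ((eventually_all_finset F).2 fun s _ => eventually_isFresh s).exists

theorem exists_isFresh_idem (F : Finset (Idem (InverseHull σ.inflation.WordMonoid))) :
    ∃ i, ∀ e ∈ F, IsFresh i e.1 :=
  ((eventually_all_finset F).2 fun e _ => eventually_isFresh e.1).exists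

/-- If `θ` avoids `f`, then so does every character in `D(w)` that passes through a fresh letter
after a word `w` with `θ ∈ D(w)`. -/
theorem notMem_basicD_of_isFresh {θ η : Spectrum (InverseHull σ.inflation.WordMonoid)}
    {w : List (A × ℕ)} {a : A} {i : ℕ} {f : Idem (InverseHull σ.inflation.WordMonoid)}
    (hf : IsFresh i f.1) (hw : θ ∈ basicD (wordIdem w)) (hθ : θ ∉ basicD f)
    (hη : η ∈ basicD (wordIdem (w ++ [(a, i)]))) : η ∉ basicD f := by
  intro h
  rcases eq_zero_or_wordIdem f with rfl | ⟨u, rfl⟩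
  · rw [basicD_zero] at h
    exact h
  have hu : ∀ x ∈ u, x.2 ≠ i := (hf u 1 u rfl).1
  -- With f = u u*, comparability of u with w(a,i) means that u contains the fresh index, which is
  -- excluded, or u is a prefix of w, which would put θ into D(f).
  rcases prefix_or_prefix_of_mem_basicD h hη with h1 | h1
  · rcases List.prefix_concat_iff.1 h1 with rfl | ⟨t, rfl⟩
    · exact hu (a, i) (by simp) rfl
    · exact hθ (basicD_wordIdem_append u t hw)
  · exact hu (a, i) (h1.subset (by simp)) rfl

/-- Left multiplication by w is defined everywhere and has range idempotent w w*, so it moves every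
character into D(w). -/
theorem act_mem_basicD_wordIdem {X : Type*} {τ : SelfSimilarAction G X}
    (η : Spectrum (InverseHull τ.WordMonoid)) (w : List X) :
    ∃ h : η ∈ basicD (dom (triple τ w 1 [])), act (triple τ w 1 []) η h ∈ basicD (wordIdem w) := by
  have h1 : dom (triple τ w 1 []) = 1 := by
    rw [dom_triple]
    exact Subtype.ext triple_nil_one_nil
  have h2 : conj (triple τ w 1 []) (wordIdem w) = 1 := Subtype.ext (by
    change pinv (triple τ w 1 []) * triple τ w 1 w * triple τ w 1 [] = 1
    rw [pinv_triple, triple_mul_self, triple_mul_self, inv_one, mul_one, mul_one,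
      triple_nil_one_nil])
  refine ⟨by rw [h1]; exact η.map_one, ?_⟩
  change η.toFun (conj _ _) = true
  rw [h2]
  exact η.map_one

/-- A nonempty open set contains D(w(a,i)) for some word w and fresh i. Every character is carried
there by left multiplication by w(a,i), so every orbit meets the open set. -/
theorem isMinimal_inflation :
    ArrowGroupoid.IsMinimal (UniversalGroupoid (InverseHull σ.inflation.WordMonoid)) := by
  intro U hU hinv
  refine or_iff_not_imp_left.2 fun hne => eq_univ_of_forall fun η => ?_
  obtain ⟨θ, hθ⟩ := nonempty_iff_ne_empty.2 hne
  obtain ⟨e, I, he, hI, hsub⟩ := exists_basicD_sdiff_subset hU hθ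
  rcases eq_zero_or_wordIdem e with rfl | ⟨w, rfl⟩
  · rw [basicD_zero] at he
    exact he.elim
  rcases isEmpty_or_nonempty A with hA | ⟨⟨a⟩⟩
  -- Over an empty alphabet the only word is empty, and the spectrum is a single point.
  · have key (ζ : Spectrum (InverseHull σ.inflation.WordMonoid)) (u : List (A × ℕ)) :
        ζ.toFun (wordIdem u) = true := by
      have hu : u = [] := List.eq_nil_iff_forall_not_mem.2 fun x => hA.elim x.1
      rw [hu, show (wordIdem [] : Idem (InverseHull σ.inflation.WordMonoid)) = 1 from
        Subtype.ext triple_nil_one_nil]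
      exact ζ.map_one
    have h : η = θ := Spectrum.ext' fun f => by
      rcases eq_zero_or_wordIdem f with rfl | ⟨u, rfl⟩
      · rw [η.map_zero, θ.map_zero]
      · rw [key, key]
    rwa [h]
  · obtain ⟨i, hi⟩ := exists_isFresh_idem I
    obtain ⟨h1, h2⟩ := act_mem_basicD_wordIdem η (w ++ [(a, i)])
    have h3 : act (triple σ.inflation (w ++ [(a, i)]) 1 []) η h1 ∈ U :=
      hsub _ (basicD_wordIdem_append w _ h2) fun f hf =>
        notMem_basicD_of_isFresh (hi f hf) he (hI f hf) h2
    -- Invariance is used along the inverse arrow, from the translated character back to η.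
    have h4 := hinv (ArrowGroupoid.inv
      (UniversalGroupoid.mk (triple σ.inflation (w ++ [(a, i)]) 1 []) η h1))
    rw [ArrowGroupoid.d_inv, ArrowGroupoid.r_inv] at h4
    exact h4 h3

/-- If u g v* fixes all characters near θ, testing on point characters gives u g(w) = v w for a word
w with θ ∈ D(vw), hence u = v and g(w) = w. Testing on vw followed by fresh letters shows that g|_w
fixes each letter, so g|_w = 1, and u g v* is the identity on D(vw). -/
theorem isEffective_inflation (hσ : ∀ g, (∀ a, σ.act g a = a) → g = 1) :
    ArrowGroupoid.IsEffective (UniversalGroupoid (InverseHull σ.inflation.WordMonoid)) := by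
  refine subset_antisymm ?_ ?_
  · intro γ hγ
    induction γ using UniversalGroupoid.ind with | h s θ hs => ?_
    obtain ⟨U, hU, hUo, hθ, hUsub⟩ := UniversalGroupoid.exists_slice_subset isOpen_interior hγ
    have hfix : ∀ η (hη : η ∈ U), η = act s η (hU hη) := fun η hη => by
      have h := interior_subset (hUsub (UniversalGroupoid.mk_mem_slice (hθ := hU hη) hη))
      exact h
    obtain ⟨e, I, he, hI, hsub⟩ := exists_basicD_sdiff_subset hUo hθ
    rcases eq_zero_or_triple s with rfl | ⟨u, g, v, rfl⟩
    · rw [basicD_dom_zero] at hs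
      exact hs.elim
    have hs' := hs
    rw [dom_triple] at hs'
    -- Both D(v) and D(e) contain θ, so their words are comparable; the longer one is written as vw.
    obtain ⟨w, hw, hwe⟩ : ∃ w, θ ∈ basicD (wordIdem (v ++ w)) ∧
        basicD (wordIdem (v ++ w) : Idem (InverseHull σ.inflation.WordMonoid)) ⊆ basicD e := by
      rcases eq_zero_or_wordIdem e with rfl | ⟨t, rfl⟩
      · rw [basicD_zero] at he
        exact he.elim
      rcases prefix_or_prefix_of_mem_basicD hs' he with ⟨w, rfl⟩ | ⟨w, rfl⟩
      · exact ⟨w, he, subset_rfl⟩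
      · exact ⟨[], by rwa [List.append_nil], by
          rw [List.append_nil]; exact basicD_wordIdem_append t w⟩
    -- Points vwt outside the excluded sets have characters in the neighbourhood, and the
    -- fixed-point condition becomes an equation of words.
    have hpt : ∀ t : List (A × ℕ), (∀ f ∈ I, pointCharacter
        (⟨v ++ (w ++ t), 1⟩ : σ.inflation.WordMonoid) ∉ basicD f) →
        u ++ σ.inflation.actWord g (w ++ t) = v ++ (w ++ t) := by
      intro t ht
      have h1 : pointCharacter (⟨v ++ (w ++ t), 1⟩ : σ.inflation.WordMonoid) ∈
          basicD (wordIdem (v ++ w)) := by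
        rw [pointCharacter_mem, maps_wordIdem_iff, ← List.append_assoc]
        exact List.prefix_append _ _
      have h2 := hfix _ (hsub _ (hwe h1) ht)
      rw [act_pointCharacter (maps_triple_append u v (w ++ t) g 1)] at h2
      exact (pointCharacter_word_inj h2).symm
    have h0 : u ++ σ.inflation.actWord g w = v ++ w := by
      have := hpt [] fun f hf hmem => ?_
      · rwa [List.append_nil] at this
      · rw [List.append_nil, pointCharacter_mem] at hmem
        rcases eq_zero_or_wordIdem f with rfl | ⟨t, rfl⟩
        · exact not_maps_zero hmem
        · obtain ⟨t', h'⟩ := maps_wordIdem_iff.1 hmem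
          refine hI _ hf (basicD_wordIdem_append t t' ?_)
          rwa [h']
    -- Since g preserves length, the last |w| letters on both sides can be compared.
    obtain ⟨rfl, h0'⟩ := List.append_inj' h0 (length_actWord g w)
    obtain ⟨i, hi⟩ := exists_isFresh_idem I
    have hg : σ.inflation.secWord g w = 1 := by
      refine hσ _ fun a => ?_
      have h1 := hpt [(a, i)] fun f hf => ?_
      · rw [σ.inflation.actWord_append, h0'] at h1
        have h2 := List.append_cancel_left (List.append_cancel_left h1)
        exact congrArg Prod.fst (List.cons.inj h2).1
      · refine notMem_basicD_of_isFresh (hi f hf) hw (hI f hf) (a := a) ?_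
        rw [pointCharacter_mem, maps_wordIdem_iff, List.append_assoc]
    -- The idempotent of uw witnesses equality with the unit germ, since u g u* · (uw)(uw)* = u g(w)
    -- g|_w (uw)*.
    refine ⟨θ, Eq.symm (UniversalGroupoid.mk_eq_mk.2 ⟨rfl, wordIdem (u ++ w), hw, ?_⟩)⟩
    change triple σ.inflation u g u * triple σ.inflation (u ++ w) 1 (u ++ w) =
      1 * triple σ.inflation (u ++ w) 1 (u ++ w)
    rw [triple_mul_triple_append, h0', hg, one_mul, one_mul]
  · rintro _ ⟨θ, rfl⟩
    rw [mem_interior]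
    refine ⟨UniversalGroupoid.germs 1, ?_, UniversalGroupoid.isOpen_germs 1,
      UniversalGroupoid.mk_mem_slice (UniversalGroupoid.mem_dom_one θ)⟩
    rintro _ ⟨η, hη, rfl⟩
    exact (UniversalGroupoid.act_one η).symm

end InverseHull

end

/-! ### The group ⨁ C_p × C_p, its subgroups of prime index, and stabilizers of words -/

section

open Set

namespace PrimeGroup

variable {P : Set Nat.Primes}

instance fact_prime (p : P) : Fact (p.1 : ℕ).Prime := ⟨p.1.2⟩

/-- The inclusion of the `p`-component. -/
def embed (p : P) : Multiplicative (ZMod (p.1 : ℕ) × ZMod (p.1 : ℕ)) →* PrimeGroup P :=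
  AddMonoidHom.toMultiplicative
    (DFinsupp.singleAddHom (fun p : P => ZMod (p.1 : ℕ) × ZMod (p.1 : ℕ)) p)

/-- The projection to the `p`-component. -/
def component (p : P) : PrimeGroup P →* Multiplicative (ZMod (p.1 : ℕ) × ZMod (p.1 : ℕ)) :=
  AddMonoidHom.toMultiplicative
    (DFinsupp.evalAddMonoidHom (β := fun p : P => ZMod (p.1 : ℕ) × ZMod (p.1 : ℕ)) p)

theorem component_embed (p : P) (c) : component p (embed p c) = c :=
  congrArg Multiplicative.ofAdd (DFinsupp.single_eq_same
    (β := fun p : P => ZMod (p.1 : ℕ) × ZMod (p.1 : ℕ)) (i := p) (b := c.toAdd))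

theorem embed_injective (p : P) : Function.Injective (embed p) :=
  Function.LeftInverse.injective (component_embed p)

theorem proj_embed (p : P) (c) : proj p (embed p c) = 1 :=
  congrArg Multiplicative.ofAdd (DFinsupp.erase_single_same
    (β := fun p : P => ZMod (p.1 : ℕ) × ZMod (p.1 : ℕ)) p c.toAdd)

theorem proj_embed_of_ne {p q : P} (h : p ≠ q) (c) : proj p (embed q c) = embed q c :=
  congrArg Multiplicative.ofAdd (DFinsupp.erase_single_ne
    (β := fun p : P => ZMod (p.1 : ℕ) × ZMod (p.1 : ℕ)) c.toAdd h.symm)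

theorem embed_mul_proj (p : P) (g : PrimeGroup P) : embed p (component p g) * proj p g = g :=
  congrArg Multiplicative.ofAdd (DFinsupp.single_add_erase p g.toAdd)

theorem proj_eq_one_iff {p : P} {g : PrimeGroup P} : proj p g = 1 ↔ ∃ c, g = embed p c := by
  constructor
  · intro h
    have h1 := embed_mul_proj p g
    rw [h, mul_one] at h1
    exact ⟨_, h1.symm⟩
  · rintro ⟨c, rfl⟩
    exact proj_embed p c

theorem component_proj (p : P) (g : PrimeGroup P) : component p (proj p g) = 1 :=
  congrArg Multiplicative.ofAdd (DFinsupp.erase_same (i := p) (f := g.toAdd))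

theorem component_proj_of_ne {p q : P} (h : q ≠ p) (g : PrimeGroup P) :
    component q (proj p g) = component q g :=
  congrArg Multiplicative.ofAdd (DFinsupp.erase_ne (f := g.toAdd) h)

theorem ext_component {g h : PrimeGroup P} (H : ∀ p, component p g = component p h) : g = h :=
  congrArg Multiplicative.ofAdd (DFinsupp.ext fun p => congrArg Multiplicative.toAdd (H p))

theorem finite_component_ne_one (g : PrimeGroup P) : {p : P | component p g ≠ 1}.Finite :=
  DFinsupp.finite_support g.toAdd

theorem pow_eq_one (p : P) (c : Multiplicative (ZMod (p.1 : ℕ) × ZMod (p.1 : ℕ))) :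
    c ^ (p.1 : ℕ) = 1 := by
  have h : (p.1 : ℕ) • c.toAdd = 0 := by
    refine Prod.ext ?_ ?_ <;> simp
  exact congrArg Multiplicative.ofAdd h

/-- The q-th power of the element lies in the index-q subgroup H and its p-th power is 1; a Bézout
relation between p and q puts the element itself in H. -/
theorem embed_mem_of_index {p q : P} (h : p ≠ q) {H : Subgroup (PrimeGroup P)}
    (hH : H.index = (q.1 : ℕ)) (c) : embed p c ∈ H := by
  have h1 : embed p c ^ (q.1 : ℕ) ∈ H := hH ▸ H.pow_index_mem _
  have h2 : embed p c ^ (p.1 : ℕ) = 1 := by rw [← map_pow, pow_eq_one, map_one]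
  have hc : Nat.Coprime (q.1 : ℕ) (p.1 : ℕ) := (Nat.coprime_primes q.1.2 p.1.2).2 fun h' =>
    h (Subtype.ext (Subtype.ext h'.symm))
  have h3 : embed p c ^ (Nat.gcd (q.1 : ℕ) (p.1 : ℕ) : ℤ) ∈ H := by
    rw [Nat.gcd_eq_gcd_ab, zpow_add, zpow_mul, zpow_mul, zpow_natCast, zpow_natCast, h2, one_zpow,
      mul_one]
    exact H.zpow_mem h1 _
  rwa [hc.gcd_eq_one, Nat.cast_one, zpow_one] at h3

/-- H contains every q-component with q ≠ p, and these generate the image of the projection. So H is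
determined by its trace on the p-component. -/
theorem proj_mem_of_index {p : P} {H : Subgroup (PrimeGroup P)} (hH : H.index = (p.1 : ℕ))
    (g : PrimeGroup P) : proj p g ∈ H := by
  have h : ∀ f : Π₀ p : P, ZMod (p.1 : ℕ) × ZMod (p.1 : ℕ), proj p (Multiplicative.ofAdd f) ∈ H := by
    intro f
    induction f using DFinsupp.induction with
    | h0 => exact (map_one (proj p)).symm ▸ H.one_mem
    | ha q b f _ _ ih =>
      rw [ofAdd_add, map_mul]
      refine H.mul_mem ?_ ih
      change proj p (embed q (Multiplicative.ofAdd b)) ∈ H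
      by_cases hpq : q = p
      · subst hpq
        rw [proj_embed]
        exact H.one_mem
      · rw [proj_embed_of_ne (Ne.symm hpq)]
        exact embed_mem_of_index hpq hH _
  exact h g.toAdd

theorem mem_iff_embed_component_mem {p : P} {H : Subgroup (PrimeGroup P)}
    (hH : H.index = (p.1 : ℕ)) (g : PrimeGroup P) : g ∈ H ↔ embed p (component p g) ∈ H := by
  conv_lhs => rw [← embed_mul_proj p g]
  exact H.mul_mem_cancel_right (proj_mem_of_index hH g)

/-- The subgroup of index `p` given by a nonzero linear form on the `p`-component. -/
def lineSubgroup (p : P) (f : ZMod (p.1 : ℕ) × ZMod (p.1 : ℕ) →+ ZMod (p.1 : ℕ)) :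
    Subgroup (PrimeGroup P) :=
  ((AddMonoidHom.toMultiplicative f).comp (component p)).ker

theorem mem_lineSubgroup {p : P} {f : ZMod (p.1 : ℕ) × ZMod (p.1 : ℕ) →+ ZMod (p.1 : ℕ)}
    {g : PrimeGroup P} : g ∈ lineSubgroup p f ↔ f (component p g).toAdd = 0 := Iff.rfl

theorem index_lineSubgroup {p : P} {f : ZMod (p.1 : ℕ) × ZMod (p.1 : ℕ) →+ ZMod (p.1 : ℕ)}
    (hf : Function.Surjective f) : (lineSubgroup p f).index = (p.1 : ℕ) := by
  have h : Function.Surjective ((AddMonoidHom.toMultiplicative f).comp (component p)) := by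
    intro t
    obtain ⟨c, hc⟩ := hf t.toAdd
    refine ⟨embed p (Multiplicative.ofAdd c), ?_⟩
    rw [MonoidHom.comp_apply, component_embed]
    exact congrArg Multiplicative.ofAdd hc
  rw [lineSubgroup, Subgroup.index_ker, MonoidHom.range_eq_top.2 h, Subgroup.card_top]
  exact (Nat.card_congr Multiplicative.toAdd).trans (Nat.card_zmod _)

theorem fst_surjective (p : P) :
    Function.Surjective (AddMonoidHom.fst (ZMod (p.1 : ℕ)) (ZMod (p.1 : ℕ))) :=
  fun t => ⟨(t, 0), rfl⟩

theorem snd_surjective (p : P) :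
    Function.Surjective (AddMonoidHom.snd (ZMod (p.1 : ℕ)) (ZMod (p.1 : ℕ))) :=
  fun t => ⟨(0, t), rfl⟩

/-- The letter of the coset `g H`, for the subgroup `H` of index `p` given by a linear form. -/
def lineLetter (p : P) (f : ZMod (p.1 : ℕ) × ZMod (p.1 : ℕ) →+ ZMod (p.1 : ℕ))
    (hf : Function.Surjective f) (g : PrimeGroup P) : PrimeAlphabet P :=
  ⟨p, ⟨lineSubgroup p f, index_lineSubgroup hf⟩, (g : PrimeGroup P ⧸ lineSubgroup p f)⟩

theorem act_lineLetter_eq_iff {p : P} {f : ZMod (p.1 : ℕ) × ZMod (p.1 : ℕ) →+ ZMod (p.1 : ℕ)}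
    {hf : Function.Surjective f} {g h k : PrimeGroup P} :
    (primeAction P).act g (lineLetter p f hf h) = lineLetter p f hf k ↔
      f (component p (g * h)).toAdd = f (component p k).toAdd := by
  have h1 : (primeAction P).act g (lineLetter p f hf h) = lineLetter p f hf (g * h) := rfl
  rw [h1]
  constructor
  · intro h2
    have h3 : ((g * h : PrimeGroup P) : PrimeGroup P ⧸ lineSubgroup p f) = k :=
      eq_of_heq (Sigma.mk.inj (eq_of_heq (Sigma.mk.inj h2).2)).2
    rw [QuotientGroup.eq, mem_lineSubgroup, map_mul, toAdd_mul, map_add, map_inv, toAdd_inv,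
      map_neg, neg_add_eq_zero] at h3
    exact h3
  · intro h2
    have h3 : ((g * h : PrimeGroup P) : PrimeGroup P ⧸ lineSubgroup p f) = k := by
      rw [QuotientGroup.eq, mem_lineSubgroup, map_mul, toAdd_mul, map_add, map_inv, toAdd_inv,
        map_neg, neg_add_eq_zero]
      exact h2
    unfold lineLetter
    rw [h3]

/-- The two coordinate forms on each p-component give letters whose stabilizers meet that component
trivially. -/
theorem eq_one_of_act_eq {g : PrimeGroup P} (h : ∀ a, (primeAction P).act g a = a) : g = 1 := by
  refine ext_component fun p => ?_
  have h1 := act_lineLetter_eq_iff.1 (h (lineLetter p _ (fst_surjective p) 1))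
  have h2 := act_lineLetter_eq_iff.1 (h (lineLetter p _ (snd_surjective p) 1))
  rw [mul_one] at h1 h2
  exact congrArg Multiplicative.ofAdd (Prod.ext h1 h2)

theorem isFaithful_inflation : (primeAction P).inflation.IsFaithful := fun _ h =>
  eq_one_of_act_eq fun a => congrArg Prod.fst (List.cons.inj (h [(a, 0)])).1

theorem infinite_alphabet (hP : P.Nonempty) : Infinite (PrimeAlphabet P × ℕ) := by
  obtain ⟨p, hp⟩ := hP
  have : Nonempty (PrimeAlphabet P) := ⟨lineLetter ⟨p, hp⟩ _ (fst_surjective _) 1⟩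
  infer_instance

instance countable_primeGroup : Countable (PrimeGroup P) := by
  let f : List (Σ p : P, Multiplicative (ZMod (p.1 : ℕ) × ZMod (p.1 : ℕ))) → PrimeGroup P :=
    fun l => (l.map fun x => embed x.1 x.2).prod
  have hf : ∀ g : Π₀ p : P, ZMod (p.1 : ℕ) × ZMod (p.1 : ℕ), ∃ l, f l = Multiplicative.ofAdd g := by
    intro g
    induction g using DFinsupp.induction with
    | h0 => exact ⟨[], rfl⟩
    | ha q b g _ _ ih =>
      obtain ⟨l, hl⟩ := ih
      refine ⟨⟨q, Multiplicative.ofAdd b⟩ :: l, ?_⟩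
      change embed q _ * f l = _
      rw [hl]
      rfl
  have (p : P) : Countable (Multiplicative (ZMod (p.1 : ℕ) × ZMod (p.1 : ℕ))) :=
    inferInstanceAs (Countable (ZMod (p.1 : ℕ) × ZMod (p.1 : ℕ)))
  exact Function.Surjective.countable (f := f) fun g => hf g.toAdd

/-- A subgroup of index p is determined by its trace on the finite p-component, and its cosets are
countable because G is. -/
instance countable_alphabet : Countable (PrimeAlphabet P) := by
  have h1 (p : P) : Countable {H : Subgroup (PrimeGroup P) // H.index = (p.1 : ℕ)} := by
    have : Finite (Multiplicative (ZMod (p.1 : ℕ) × ZMod (p.1 : ℕ))) :=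
      inferInstanceAs (Finite (ZMod (p.1 : ℕ) × ZMod (p.1 : ℕ)))
    refine Function.Injective.countable (β := Set (Multiplicative (ZMod (p.1 : ℕ) × ZMod (p.1 : ℕ))))
      (f := fun H => {c | embed p c ∈ H.1}) fun H H' h => Subtype.ext (Subgroup.ext fun g => ?_)
    rw [mem_iff_embed_component_mem H.2, mem_iff_embed_component_mem H'.2]
    exact Set.ext_iff.1 h _
  have h2 (H : Subgroup (PrimeGroup P)) : Countable (PrimeGroup P ⧸ H) :=
    Quotient.mk_surjective.countable
  infer_instance

/-- Pigeonhole: the p² elements of the p-component fall into p cosets of H, so two of them differ by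
a nontrivial element of H. -/
theorem exists_embed_mem {p : P} {H : Subgroup (PrimeGroup P)} (hH : H.index = (p.1 : ℕ)) :
    ∃ c ≠ 1, embed p c ∈ H := by
  have hfin : Finite (PrimeGroup P ⧸ H) := by
    refine Nat.finite_of_card_ne_zero ?_
    rw [← Subgroup.index_eq_card, hH]
    exact p.1.2.ne_zero
  have hcard : Nat.card (PrimeGroup P ⧸ H) <
      Nat.card (Multiplicative (ZMod (p.1 : ℕ) × ZMod (p.1 : ℕ))) := by
    rw [← Subgroup.index_eq_card, hH, Nat.card_congr Multiplicative.toAdd, Nat.card_prod,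
      Nat.card_zmod]
    exact lt_mul_self p.1.2.one_lt
  have : Finite (Multiplicative (ZMod (p.1 : ℕ) × ZMod (p.1 : ℕ))) :=
    inferInstanceAs (Finite (ZMod (p.1 : ℕ) × ZMod (p.1 : ℕ)))
  obtain ⟨a, b, hab, hne⟩ : ∃ a b, (embed p a : PrimeGroup P ⧸ H) = embed p b ∧ a ≠ b := by
    by_contra! hinj
    exact hcard.not_ge (Nat.card_le_card_of_injective
      (fun a => (embed p a : PrimeGroup P ⧸ H)) fun a b => hinj a b)
  refine ⟨a⁻¹ * b, fun h => hne (inv_mul_eq_one.1 h), ?_⟩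
  rw [map_mul, map_inv]
  exact QuotientGroup.eq.1 hab

/-- G is abelian, so an element of H fixes every coset of H and not only H itself. -/
theorem act_eq_self_of_mem {g : PrimeGroup P} {a : PrimeAlphabet P} (h : g ∈ a.2.1.1) :
    (primeAction P).act g a = a := by
  obtain ⟨p, H, x⟩ := a
  have h1 : g • x = x := by
    induction x using QuotientGroup.induction_on with | H k => ?_
    refine (QuotientGroup.eq (s := H.1)).2 ?_
    change (g * k)⁻¹ * k ∈ H.1
    have h2 : (g * k)⁻¹ * k = g⁻¹ := by rw [mul_inv_rev, mul_assoc, mul_comm, mul_assoc, mul_inv_cancel, mul_one]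
    rw [h2]
    exact H.1.inv_mem h
  change (⟨p, H, g • x⟩ : PrimeAlphabet P) = _
  rw [h1]

/-- Each word is fixed by a nontrivial element of the `p`-component. -/
theorem exists_embed_actWord_eq (p : P) (w : List (PrimeAlphabet P × ℕ)) :
    ∃ c ≠ 1, (primeAction P).inflation.actWord (embed p c) w = w := by
  induction w with
  | nil =>
    refine ⟨Multiplicative.ofAdd (1, 0), fun h => ?_, rfl⟩
    have h1 : ((1, 0) : ZMod (p.1 : ℕ) × ZMod (p.1 : ℕ)) = 0 := congrArg Multiplicative.toAdd h
    exact one_ne_zero (congrArg Prod.fst h1)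
  | cons x w ih =>
    obtain ⟨⟨q, H, y⟩, i⟩ := x
    by_cases hq : p = q
    · subst hq
      -- A letter of A_p can be fixed by choosing c in its subgroup; the section there is 1, so the
      -- rest of the word imposes no condition.
      obtain ⟨c, hc, hcH⟩ := exists_embed_mem H.2
      refine ⟨c, hc, ?_⟩
      change ((primeAction P).act (embed p c) ⟨p, H, y⟩, i) ::
        (primeAction P).inflation.actWord (proj p (embed p c)) w = _
      rw [act_eq_self_of_mem hcH, proj_embed, SelfSimilarAction.actWord_one]
    -- A letter of A_q with q ≠ p is fixed by the whole p-component, and sections there do not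
    -- change it, so the element for the tail works.
    · obtain ⟨c, hc, h⟩ := ih
      refine ⟨c, hc, ?_⟩
      change ((primeAction P).act (embed p c) ⟨q, H, y⟩, i) ::
        (primeAction P).inflation.actWord (proj q (embed p c)) w = _
      rw [act_eq_self_of_mem (embed_mem_of_index hq H.2 c), proj_embed_of_ne (Ne.symm hq), h]

end PrimeGroup

end

/-! ### Coefficients under compression s ↦ l s r -/

section

open Set

section Coefficients

variable {K S : Type*} [Field K]

open Classical in
theorem MonoidAlgebra.coeff_single_mul_mul_single [Monoid S] (a : MonoidAlgebra K S) (l r t : S) :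
    (MonoidAlgebra.single l 1 * a * MonoidAlgebra.single r 1).coeff t =
      ∑ s ∈ a.coeff.support with l * s * r = t, a.coeff s := by
  rw [Finset.sum_filter]
  change _ = a.coeff.sum fun s c => if l * s * r = t then c else 0
  induction a using MonoidAlgebra.induction_linear with
  | zero => simp
  | add x y hx hy =>
    rw [mul_add, add_mul, MonoidAlgebra.coeff_add, Finsupp.add_apply, hx, hy,
      MonoidAlgebra.coeff_add, Finsupp.sum_add_index']
    · intro s; split_ifs <;> rfl
    · intro s c d; split_ifs <;> simp
  | single s c =>
    rw [MonoidAlgebra.single_mul_single, MonoidAlgebra.single_mul_single, one_mul, mul_one,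
      MonoidAlgebra.coeff_single, MonoidAlgebra.coeff_single, Finsupp.sum_single_index (by simp),
      Finsupp.single_apply]

theorem exists_of_coeff_single_mul_mul_single_ne_zero [Monoid S] {a : MonoidAlgebra K S}
    {l r t : S}
    (h : (MonoidAlgebra.single l 1 * a * MonoidAlgebra.single r 1).coeff t ≠ 0) :
    ∃ s ∈ a.coeff.support, l * s * r = t := by
  classical
  rw [MonoidAlgebra.coeff_single_mul_mul_single] at h
  obtain ⟨s, hs, -⟩ := Finset.exists_ne_zero_of_sum_ne_zero h
  exact ⟨s, (Finset.mem_filter.1 hs).1, (Finset.mem_filter.1 hs).2⟩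

/-- Modulo the line of 0, which J contains, the element a is a nonzero scalar multiple of 1. -/
theorem one_mem_of_coeff_eq_zero [MonoidWithZero S] {J : TwoSidedIdeal (MonoidAlgebra K S)}
    (hJ : MonoidAlgebra.single (0 : S) (1 : K) ∈ J) {a : MonoidAlgebra K S} (ha : a ∈ J)
    (h1 : a.coeff 1 ≠ 0) (h : ∀ s, s ≠ 0 → s ≠ 1 → a.coeff s = 0) : (1 : MonoidAlgebra K S) ∈ J := by
  classical
  have h2 : ∀ s : S, s ≠ 0 → (a - MonoidAlgebra.single 1 (a.coeff 1)).coeff s = 0 := by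
    intro s hs
    by_cases hs1 : s = 1
    · subst hs1; simp
    · simp [h s hs hs1, Ne.symm hs1]
  have h3 : a - MonoidAlgebra.single 1 (a.coeff 1) ∈ J := by
    rw [MonoidAlgebra.eq_single_zero h2]
    exact single_zero_mem hJ _
  have h4 : MonoidAlgebra.single 1 (a.coeff 1) ∈ J := by simpa using J.sub_mem ha h3
  have h5 := J.mul_mem_left (MonoidAlgebra.single 1 (a.coeff 1)⁻¹) _ h4
  rwa [MonoidAlgebra.single_mul_single, inv_mul_cancel₀ h1, one_mul] at h5

end Coefficients

/-- A function on the affine plane over `𝔽_p` with zero sum on each line vanishes if `p` is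
invertible. -/
theorem apply_zero_eq_zero_of_sum_line_eq_zero {K : Type*} [Field K] {p : ℕ} [Fact p.Prime]
    (hp : (p : K) ≠ 0) (b : ZMod p × ZMod p → K)
    (h : ∀ f : ZMod p × ZMod p →+ ZMod p, Function.Surjective f → ∀ t,
      ∑ c with f c = t, b c = 0) : b 0 = 0 := by
  -- The lines parallel to the first axis, as fibres of the second coordinate.
  have h1 : ∀ y, ∑ x, b (x, y) = 0 := by
    intro y
    rw [← h (AddMonoidHom.snd _ _) (fun t => ⟨(0, t), rfl⟩) y]
    refine Finset.sum_nbij' (fun x => (x, y)) Prod.fst ?_ ?_ ?_ ?_ ?_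
    · exact fun x _ => Finset.mem_filter.2 ⟨Finset.mem_univ _, rfl⟩
    · simp
    · simp
    · rintro ⟨c, d⟩ hc
      have : d = y := (Finset.mem_filter.1 hc).2
      subst this
      rfl
    · simp
  -- The kernels of (x, y) ↦ x + m y are the p lines through the origin other than y = 0.
  have h2 : ∀ m, ∑ y, b (-m * y, y) = 0 := by
    intro m
    rw [← h (AddMonoidHom.fst _ _ + (AddMonoidHom.mulLeft m).comp (AddMonoidHom.snd _ _))
      (fun t => ⟨(t, 0), by simp⟩) 0]
    refine Finset.sum_nbij' (fun y => (-m * y, y)) Prod.snd ?_ ?_ ?_ ?_ ?_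
    · exact fun y _ => Finset.mem_filter.2 ⟨Finset.mem_univ _, by simp⟩
    · simp
    · simp
    · rintro ⟨c, d⟩ hc
      have : c + m * d = 0 := (Finset.mem_filter.1 hc).2
      exact Prod.ext (by rw [eq_neg_of_add_eq_zero_left this, neg_mul]) rfl
    · simp
  have h3 : ∑ m : ZMod p, ∑ y, b (-m * y, y) = 0 := Finset.sum_eq_zero fun m _ => h2 m
  -- Summed over m, the origin is counted p times. For fixed y ≠ 0 the map m ↦ -m y is a bijection,
  -- so that row contributes a full row sum, which is 0.
  rw [Finset.sum_comm, Finset.sum_eq_single 0] at h3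
  · simp only [mul_zero, Finset.sum_const, Finset.card_univ, ZMod.card, nsmul_eq_mul] at h3
    exact (mul_eq_zero.1 h3).resolve_left hp
  · intro y _ hy
    rw [← h1 y]
    refine Fintype.sum_equiv ((Equiv.neg _).trans (Equiv.mulRight₀ y hy)) _ _ fun m => ?_
    rfl
  · simp

namespace InverseHull

open InverseMonoidWithZero

section SelfSimilar

variable {G X : Type*} [Group G] {σ : SelfSimilarAction G X} {K : Type*} [Field K]

/-- Choose s = u g v* in the support with maximal domain; multiplying by g⁻¹u* and v turns s into 1.
Another t sent to 1 must agree with s at v, so it extends s, and maximality excludes it. -/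
theorem exists_mem_coeff_one_ne_zero {J : TwoSidedIdeal (MonoidAlgebra K (InverseHull σ.WordMonoid))}
    {a : MonoidAlgebra K (InverseHull σ.WordMonoid)} (ha : a ∈ J)
    {s₀ : InverseHull σ.WordMonoid} (hs₀ : s₀ ≠ 0) (has₀ : a.coeff s₀ ≠ 0) :
    ∃ b ∈ J, b.coeff 1 ≠ 0 := by
  classical
  obtain ⟨s, hs⟩ := Finset.exists_maximalFor (dom : InverseHull σ.WordMonoid → Idem _)
    (a.coeff.support.filter (· ≠ 0))
    ⟨s₀, Finset.mem_filter.2 ⟨Finsupp.mem_support_iff.2 has₀, hs₀⟩⟩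
  obtain ⟨hs1, hs2⟩ := Finset.mem_filter.1 hs.1
  obtain ⟨u, g, v, rfl⟩ := (eq_zero_or_triple s).resolve_left hs2
  refine ⟨_, J.mul_mem_right _ (MonoidAlgebra.single (triple σ v 1 []) 1)
    (J.mul_mem_left (MonoidAlgebra.single (triple σ [] g⁻¹ u) 1) _ ha), ?_⟩
  rw [MonoidAlgebra.coeff_single_mul_mul_single, Finset.sum_eq_single (triple σ u g v)]
  · exact Finsupp.mem_support_iff.1 hs1
  · intro t ht hne
    obtain ⟨ht1, ht2⟩ := Finset.mem_filter.1 ht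
    -- Following the identity of M through the three factors shows that t maps v to u g.
    have h1 : (1 : InverseHull σ.WordMonoid).Maps ⟨[], 1⟩ ⟨[], 1⟩ := maps_one.2 rfl
    rw [← ht2] at h1
    obtain ⟨m, h2, h3⟩ := maps_mul.1 h1
    obtain ⟨n, h4, h5⟩ := maps_mul.1 h3
    obtain rfl := h2.eq (maps_triple_self ..)
    have h6 := maps_triple_self (σ := σ) [] u g⁻¹ g
    rw [inv_mul_cancel] at h6
    obtain rfl := h5.inj h6
    rcases eq_zero_or_triple t with rfl | ⟨u', g', v', rfl⟩
    · exact (not_maps_zero h4).elim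
    obtain ⟨w, k, h7, h8⟩ := maps_triple.1 h4
    have hv : v = v' ++ w := congrArg SelfSimilarAction.WordMonoid.word h7
    have hk : 1 * 1 = k := congrArg SelfSimilarAction.WordMonoid.grp h7
    have hu : u = u' ++ σ.actWord g' w := congrArg SelfSimilarAction.WordMonoid.word h8
    have hg : g = σ.secWord g' w * k := congrArg SelfSimilarAction.WordMonoid.grp h8
    have hle : dom (triple σ u g v) ≤ dom (triple σ u' g' v') := by
      rw [dom_triple, dom_triple, hv]
      exact congrArg Subtype.val (wordIdem_append_mul (σ := σ) v' w)
    have heq := le_antisymm hle (hs.2 (Finset.mem_filter.2 ⟨ht1, triple_ne_zero _ _ _⟩) hle)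
    rw [dom_triple, dom_triple] at heq
    have hvv := (triple_inj.1 (congrArg Subtype.val heq)).1
    have hw : w = [] := List.append_right_eq_self.1 (hv.symm.trans hvv)
    subst hw
    refine absurd ?_ hne
    rw [triple_inj]
    refine ⟨hu.symm ▸ (List.append_nil u').symm, ?_, hvv.symm⟩
    rw [hg, ← hk, mul_one, mul_one]
    rfl
  · intro h
    refine absurd (Finset.mem_filter.2 ⟨hs1, ?_⟩) h
    rw [triple_mul_self, triple_mul_self, inv_mul_cancel, one_mul, triple_nil_one_nil]

end SelfSimilar

section Inflation

variable {G A : Type*} [Group G] {σ : SelfSimilarAction G A}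

theorem letter_mul_mul_letter (g : G) (x : A) (i : ℕ) :
    triple σ.inflation [] 1 [(σ.act g x, i)] * triple σ.inflation [] g [] *
      triple σ.inflation [(x, i)] 1 [] = triple σ.inflation [] (σ.sec g x) [] := by
  have h1 := triple_mul_triple_append (σ := σ.inflation) [] [] [(x, i)] [] g 1
  have h2 : triple σ.inflation [] g [] * triple σ.inflation [(x, i)] 1 [] =
      triple σ.inflation [(σ.act g x, i)] (σ.sec g x) [] := by
    rw [mul_one] at h1
    exact h1
  rw [mul_assoc, h2, triple_mul_self, one_mul]

/-- If u or v is nonempty, its first letter has an index different from i, so it is incomparable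
with the fresh letter and the product vanishes. What remains is a group element, and it must carry x
to y. -/
theorem exists_of_letter_mul_mul_letter_ne_zero {s : InverseHull σ.inflation.WordMonoid} {i : ℕ}
    (hs : IsFresh i s) {x y : A} (h : triple σ.inflation [] 1 [(y, i)] * s *
      triple σ.inflation [(x, i)] 1 [] ≠ 0) :
    ∃ g, s = triple σ.inflation [] g [] ∧ σ.act g x = y := by
  rcases eq_zero_or_triple s with rfl | ⟨u, g, v, rfl⟩
  · rw [mul_zero, zero_mul] at h
    exact absurd rfl h
  obtain ⟨hu, hv⟩ := hs u g v rfl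
  have hv' : v = [] := by
    rw [mul_assoc] at h
    rcases prefix_or_prefix_of_triple_mul_ne_zero (right_ne_zero_of_mul h) with h1 | h1
    · rcases v with _ | ⟨z, v⟩
      · rfl
      · have : z = (x, i) := by simpa using h1.subset (List.mem_cons_self ..)
        exact absurd (congrArg Prod.snd this) (hv z (List.mem_cons_self ..))
    · exact absurd rfl (hv (x, i) (h1.subset (List.mem_cons_self ..)))
  subst hv'
  have hu' : u = [] := by
    rcases prefix_or_prefix_of_triple_mul_ne_zero (left_ne_zero_of_mul h) with h1 | h1
    · exact absurd rfl (hu (y, i) (h1.subset (List.mem_cons_self ..)))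
    · rcases u with _ | ⟨z, u⟩
      · rfl
      · have : z = (y, i) := by simpa using h1.subset (List.mem_cons_self ..)
        exact absurd (congrArg Prod.snd this) (hu z (List.mem_cons_self ..))
  subst hu'
  refine ⟨g, rfl, ?_⟩
  have h1 := triple_mul_triple_append (σ := σ.inflation) [] [] [(x, i)] [] g 1
  rw [mul_assoc] at h
  have h2 : triple σ.inflation [] g [] * triple σ.inflation [(x, i)] 1 [] =
      triple σ.inflation [(σ.act g x, i)] (σ.sec g x) [] := by
    rw [mul_one] at h1
    exact h1
  rw [h2] at h
  have h3 : [(y, i)] = [(σ.act g x, i)] := by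
    rcases prefix_or_prefix_of_triple_mul_ne_zero h with h3 | h3
    · exact h3.eq_of_length rfl
    · exact (h3.eq_of_length rfl).symm
  exact (congrArg Prod.fst (List.cons.inj h3).1).symm

end Inflation

end InverseHull

end

/-! ### The simplicity criterion: eliminating primes -/

section

open Set

namespace PrimeGroup

open InverseMonoidWithZero InverseHull

variable {P : Set Nat.Primes} {K : Type*} [Field K]

/-- The element `g` of `G` as a unit of the inverse hull. -/
noncomputable def unit (g : PrimeGroup P) : PrimeHull P := triple (primeAction P).inflation [] g []

theorem unit_injective : Function.Injective (unit (P := P)) := fun _ _ h => (triple_inj.1 h).2.1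

theorem unit_one : unit (1 : PrimeGroup P) = 1 := triple_nil_one_nil

theorem unit_mul (g h : PrimeGroup P) : unit (g * h) = unit g * unit h :=
  (triple_mul_self [] [] [] g h).symm

theorem unit_ne_zero (g : PrimeGroup P) : unit g ≠ 0 := triple_ne_zero _ _ _

/-- The group elements in the support of `a` have trivial `p`-component for `p ∉ F`. -/
def SupportedOn (F : Finset P) (a : MonoidAlgebra K (PrimeHull P)) : Prop :=
  ∀ g, a.coeff (unit g) ≠ 0 → ∀ p ∉ F, component p g = 1

theorem exists_supportedOn (a : MonoidAlgebra K (PrimeHull P)) : ∃ F, SupportedOn F a := by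
  have h1 : {g : PrimeGroup P | a.coeff (unit g) ≠ 0}.Finite :=
    (a.coeff.support.finite_toSet.preimage unit_injective.injOn).subset fun g hg =>
      Finsupp.mem_support_iff.2 hg
  have h2 := h1.biUnion fun g _ => finite_component_ne_one g
  refine ⟨h2.toFinset, fun g hg p hp => ?_⟩
  by_contra hne
  exact hp (h2.mem_toFinset.2 (mem_iUnion₂.2 ⟨g, hg, hne⟩))

theorem eq_one_of_letter_mul_mul_letter {s : PrimeHull P} {i : ℕ} (hs : IsFresh i s)
    {x y : PrimeAlphabet P} {t : PrimeHull P} (ht : t ≠ 0)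
    (h : triple (primeAction P).inflation [] 1 [(y, i)] * s *
      triple (primeAction P).inflation [(x, i)] 1 [] = t) :
    ∃ g, s = unit g ∧ (primeAction P).act g x = y ∧ t = unit (proj x.1 g) := by
  obtain ⟨g, rfl, rfl⟩ := exists_of_letter_mul_mul_letter_ne_zero hs (h ▸ ht)
  exact ⟨g, rfl, rfl, h.symm.trans (letter_mul_mul_letter g x i)⟩

/-- Compressing between fresh letters of A_p for the subgroup ker f replaces each surviving g by its
projection away from p. The coefficient at 1 becomes the sum over an affine line in the p-component,
and some line sum is nonzero since p is invertible. -/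
theorem exists_supportedOn_erase [DecidableEq P] {p : P} (hp : ((p.1 : ℕ) : K) ≠ 0)
    {J : TwoSidedIdeal (MonoidAlgebra K (PrimeHull P))} {a : MonoidAlgebra K (PrimeHull P)}
    (ha : a ∈ J) (h1 : a.coeff 1 ≠ 0) {F : Finset P} (hF : SupportedOn F a) :
    ∃ b ∈ J, b.coeff 1 ≠ 0 ∧ SupportedOn (F.erase p) b := by
  classical
  obtain ⟨i, hi⟩ := exists_isFresh a.coeff.support
  obtain ⟨f, hf, t, ht⟩ : ∃ f : ZMod (p.1 : ℕ) × ZMod (p.1 : ℕ) →+ ZMod (p.1 : ℕ),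
      Function.Surjective f ∧ ∃ t, ∑ c with f c = t,
        a.coeff (unit (embed p (Multiplicative.ofAdd c))) ≠ 0 := by
    by_contra! h
    refine h1 ?_
    have h0 := apply_zero_eq_zero_of_sum_line_eq_zero hp
      (fun c => a.coeff (unit (embed p (Multiplicative.ofAdd c)))) h
    rwa [ofAdd_zero, map_one, unit_one] at h0
  -- A point c₀ on the line: the elements carrying the coset of 1 to the coset of c₀ are those with
  -- f-value f(c₀).
  obtain ⟨c₀, rfl⟩ := hf t
  set x := lineLetter p f hf 1 with hx
  set y := lineLetter p f hf (embed p (Multiplicative.ofAdd c₀)) with hy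
  refine ⟨_, J.mul_mem_right _
    (MonoidAlgebra.single (triple (primeAction P).inflation [(x, i)] 1 []) 1)
    (J.mul_mem_left (MonoidAlgebra.single (triple (primeAction P).inflation [] 1 [(y, i)]) 1) _ ha),
    ?_, ?_⟩
  · rw [MonoidAlgebra.coeff_single_mul_mul_single]
    convert ht using 1
    have hinj : Function.Injective fun c : ZMod (p.1 : ℕ) × ZMod (p.1 : ℕ) =>
        unit (embed p (Multiplicative.ofAdd c)) := fun c d h =>
      Multiplicative.ofAdd.injective (embed_injective p (unit_injective h))
    rw [← Finset.sum_image (f := fun s => a.coeff s) hinj.injOn]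
    refine Finset.sum_subset ?_ ?_
    · intro s hs
      obtain ⟨hs1, hs2⟩ := Finset.mem_filter.1 hs
      obtain ⟨g, rfl, hg, hg'⟩ := eq_one_of_letter_mul_mul_letter (hi s hs1) one_ne_zero hs2
      rw [← unit_one] at hg'
      change unit 1 = unit (proj p g) at hg'
      -- Only elements of the p-component itself are compressed to 1.
      obtain ⟨c, rfl⟩ := proj_eq_one_iff.1 (unit_injective hg').symm
      rw [act_lineLetter_eq_iff, mul_one, component_embed, component_embed] at hg
      exact Finset.mem_image.2 ⟨c.toAdd, Finset.mem_filter.2 ⟨Finset.mem_univ _, hg⟩, rfl⟩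
    · intro s hs hs'
      obtain ⟨c, hc, rfl⟩ := Finset.mem_image.1 hs
      by_contra hne
      refine hs' (Finset.mem_filter.2 ⟨Finsupp.mem_support_iff.2 hne, ?_⟩)
      have hact : (primeAction P).act (embed p (Multiplicative.ofAdd c)) x = y := by
        rw [hx, hy, act_lineLetter_eq_iff, mul_one, component_embed, component_embed]
        exact (Finset.mem_filter.1 hc).2
      have h2 := letter_mul_mul_letter (σ := primeAction P) (embed p (Multiplicative.ofAdd c)) x i
      rw [hact] at h2
      refine h2.trans ?_
      change unit (proj p _) = 1
      rw [proj_embed, unit_one]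
  · intro g' hg' q hq
    obtain ⟨s, hs, hs'⟩ := exists_of_coeff_single_mul_mul_single_ne_zero hg'
    obtain ⟨g, rfl, -, hg⟩ := eq_one_of_letter_mul_mul_letter (hi s hs) (unit_ne_zero g') hs'
    obtain rfl : g' = proj p g := unit_injective hg
    by_cases hqp : q = p
    · subst hqp
      exact component_proj q g
    · rw [component_proj_of_ne hqp]
      exact hF g (Finsupp.mem_support_iff.1 hs) q fun h => hq (Finset.mem_erase.2 ⟨hqp, h⟩)

/-- The identity is now the only group element in the support. Compressing by one fresh letter on
both sides fixes 1 and kills all non-group terms; over an empty alphabet there are no such terms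
apart from 0. -/
theorem one_mem_of_supportedOn_empty {J : TwoSidedIdeal (MonoidAlgebra K (PrimeHull P))}
    (hJ : MonoidAlgebra.single 0 1 ∈ J) {a : MonoidAlgebra K (PrimeHull P)}
    (ha : a ∈ J) (h1 : a.coeff 1 ≠ 0) (hF : SupportedOn ∅ a) :
    (1 : MonoidAlgebra K (PrimeHull P)) ∈ J := by
  classical
  have hg : ∀ g, a.coeff (unit g) ≠ 0 → g = 1 := fun g hg =>
    ext_component fun p => (hF g hg p (by simp)).trans (map_one _).symm
  rcases isEmpty_or_nonempty (PrimeAlphabet P) with hA | ⟨⟨x⟩⟩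
  · refine one_mem_of_coeff_eq_zero hJ ha h1 fun s hs hs1 => ?_
    obtain ⟨u, g, v, rfl⟩ := (eq_zero_or_triple s).resolve_left hs
    have hnil (u : List (PrimeAlphabet P × ℕ)) : u = [] :=
      List.eq_nil_iff_forall_not_mem.2 fun x => hA.elim x.1
    rw [hnil u, hnil v] at hs1 ⊢
    by_contra hne
    rw [hg g hne] at hs1
    exact hs1 triple_nil_one_nil
  · obtain ⟨i, hi⟩ := exists_isFresh a.coeff.support
    have hone : triple (primeAction P).inflation [] 1 [(x, i)] * 1 *
        triple (primeAction P).inflation [(x, i)] 1 [] = 1 := by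
      rw [mul_one, triple_mul_self, mul_one, triple_nil_one_nil]
    have key : ∀ s ∈ a.coeff.support, ∀ t ≠ 0, triple (primeAction P).inflation [] 1 [(x, i)] * s *
        triple (primeAction P).inflation [(x, i)] 1 [] = t → s = 1 ∧ t = 1 := by
      intro s hs t ht h
      obtain ⟨g, rfl, -, rfl⟩ := eq_one_of_letter_mul_mul_letter (hi s hs) ht h
      rw [hg g (Finsupp.mem_support_iff.1 hs), map_one]
      exact ⟨unit_one, unit_one⟩
    refine one_mem_of_coeff_eq_zero hJ (J.mul_mem_right _
      (MonoidAlgebra.single (triple (primeAction P).inflation [(x, i)] 1 []) 1)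
      (J.mul_mem_left (MonoidAlgebra.single (triple (primeAction P).inflation [] 1 [(x, i)]) 1)
        _ ha)) ?_ fun t ht ht1 => ?_
    · rw [MonoidAlgebra.coeff_single_mul_mul_single, Finset.sum_eq_single 1]
      · exact h1
      · intro s hs hs1
        obtain ⟨hs2, hs3⟩ := Finset.mem_filter.1 hs
        exact absurd (key s hs2 1 one_ne_zero hs3).1 hs1
      · intro h
        exact (h (Finset.mem_filter.2 ⟨Finsupp.mem_support_iff.2 h1, hone⟩)).elim
    · by_contra hne
      obtain ⟨s, hs, hs'⟩ := exists_of_coeff_single_mul_mul_single_ne_zero hne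
      exact ht1 (key s hs t ht hs').2

/-- Induction on the finite set of primes occurring in the group elements of the support, keeping
the coefficient at 1 nonzero. -/
theorem hasOnlyTrivialIdeals (hK : ∀ p ∈ P, ((p : ℕ) : K) ≠ 0) :
    HasOnlyTrivialIdeals K (PrimeHull P) := by
  classical
  intro J hJ
  refine or_iff_not_imp_left.2 fun hne => ?_
  push Not at hne
  obtain ⟨a, ha, s, hs, has⟩ := hne
  obtain ⟨b, hb, hb1⟩ := exists_mem_coeff_one_ne_zero ha hs has
  obtain ⟨F, hF⟩ := exists_supportedOn b
  induction F using Finset.induction_on generalizing b with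
  | empty => exact one_mem_of_supportedOn_empty hJ hb hb1 hF
  | insert p F hp ih =>
    obtain ⟨c, hc, hc1, hcF⟩ := exists_supportedOn_erase (hK p.1 p.2) hb hb1 hF
    rw [Finset.erase_insert hp] at hcF
    exact ih c hc hc1 hcF

/-! ### A proper ideal in characteristic `p` -/

/-- If X · u g v* is a group element, it is defined at the identity of M, so v is empty. Since G is
abelian, replacing g by k g then just multiplies the product on the right by k. -/
theorem mul_triple_mem_range_unit {X : PrimeHull P} {u v : List (PrimeAlphabet P × ℕ)}
    {g : PrimeGroup P} (k : PrimeGroup P)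
    (h : X * triple (primeAction P).inflation u g v ∈ range (unit (P := P))) :
    X * triple (primeAction P).inflation u (k * g) v ∈ range (unit (P := P)) := by
  obtain ⟨l, hl⟩ := h
  have h1 := maps_triple_self (σ := (primeAction P).inflation) [] [] l 1
  change (unit l).Maps _ _ at h1
  rw [hl, maps_mul] at h1
  obtain ⟨m, h2, -⟩ := h1
  obtain ⟨w, j, h3, -⟩ := maps_triple.1 h2
  have hv : v = [] := (List.append_eq_nil_iff.1
    (congrArg SelfSimilarAction.WordMonoid.word h3).symm).1
  subst hv
  refine ⟨l * k, ?_⟩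
  rw [unit_mul, hl, mul_assoc, mul_comm k g]
  exact congrArg (X * ·) (triple_mul_self u [] [] g k)

theorem unit_mul_triple {k : PrimeGroup P} {u v : List (PrimeAlphabet P × ℕ)}
    (h : (primeAction P).inflation.actWord k u = u) (g : PrimeGroup P) :
    unit k * triple (primeAction P).inflation u g v =
      triple (primeAction P).inflation u ((primeAction P).inflation.secWord k u * g) v := by
  have := triple_mul_triple_append (σ := (primeAction P).inflation) [] [] u v k g
  rw [h] at this
  exact this

/-- Right translation by c₀ is a map of order dividing p on the set, without fixed points, so p
divides the cardinality. -/
theorem natCast_card_eq_zero {p : P} (hp : ((p.1 : ℕ) : K) = 0)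
    (Z : Multiplicative (ZMod (p.1 : ℕ) × ZMod (p.1 : ℕ)) → Prop) [DecidablePred Z] {c₀}
    (hc₀ : c₀ ≠ 1) (hZ : ∀ c, Z c → Z (c * c₀)) :
    (Fintype.card {c // Z c} : K) = 0 := by
  classical
  let f : Function.End {c // Z c} := fun c => ⟨c.1 * c₀, hZ c.1 c.2⟩
  have hf : ∀ (n : ℕ) (c : {c // Z c}), ((f ^ n) c).1 = c.1 * c₀ ^ n := by
    intro n c
    induction n with
    | zero => rw [pow_zero, pow_zero, mul_one]; rfl
    | succ n ih =>
      rw [pow_succ', pow_succ, ← mul_assoc, ← ih]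
      rfl
  -- The fixed-point congruence is stated for maps whose order divides a power of p; here the
  -- exponent is 1.
  have h1 : f ^ (p.1 : ℕ) ^ 1 = 1 := by
    rw [pow_one]
    funext c
    exact Subtype.ext (by rw [hf, pow_eq_one, mul_one]; rfl)
  have h2 := Equiv.Perm.card_fixedPoints_modEq h1
  have h3 : Fintype.card (Function.fixedPoints f) = 0 := by
    refine Fintype.card_eq_zero_iff.2 ⟨fun c => hc₀ ?_⟩
    exact mul_eq_left.1 (congrArg Subtype.val c.2)
  rw [h3] at h2
  obtain ⟨m, hm⟩ := (Nat.modEq_zero_iff_dvd).1 h2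
  rw [hm, Nat.cast_mul, hp, zero_mul]

open Classical in
/-- The sum of the coefficients of `r` in `a` over all `r` such that `s r t` is a unit. -/
noncomputable def unitSum (s t : PrimeHull P) : MonoidAlgebra K (PrimeHull P) →ₗ[K] K :=
  Finsupp.linearCombination K (fun r => if s * r * t ∈ range (unit (P := P)) then (1 : K) else 0) ∘ₗ
    (MonoidAlgebra.coeffLinearEquiv K).toLinearMap

open Classical in
theorem unitSum_single (s t r : PrimeHull P) (c : K) :
    unitSum s t (MonoidAlgebra.single r c) =
      c * if s * r * t ∈ range (unit (P := P)) then (1 : K) else 0 :=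
  Finsupp.linearCombination_single K c r

/-- Factors of a basis element are absorbed into s, and on the other side into t. This is why the
common kernel of all these functionals is a two-sided ideal. -/
theorem unitSum_single_mul (s t r : PrimeHull P) (c : K) (a : MonoidAlgebra K (PrimeHull P)) :
    unitSum s t (MonoidAlgebra.single r c * a) = c * unitSum (s * r) t a := by
  induction a using MonoidAlgebra.induction_linear with
  | zero => rw [mul_zero, map_zero, map_zero, mul_zero]
  | add x y hx hy => rw [mul_add, map_add, hx, hy, map_add, mul_add]
  | single r' c' =>
    rw [MonoidAlgebra.single_mul_single, unitSum_single, unitSum_single, mul_assoc,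
      mul_assoc s r r']

theorem unitSum_mul_single (s t r : PrimeHull P) (c : K) (a : MonoidAlgebra K (PrimeHull P)) :
    unitSum s t (a * MonoidAlgebra.single r c) = c * unitSum s (r * t) a := by
  induction a using MonoidAlgebra.induction_linear with
  | zero => rw [zero_mul, map_zero, map_zero, mul_zero]
  | add x y hx hy => rw [add_mul, map_add, hx, hy, map_add, mul_add]
  | single r' c' =>
    rw [MonoidAlgebra.single_mul_single, unitSum_single, unitSum_single, mul_comm c' c, mul_assoc,
      ← mul_assoc s r' r, mul_assoc (s * r')]

variable (P K) in
/-- The ideal of all `a` that are annihilated by `unitSum s t` for all `s` and `t`. -/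
noncomputable def unitSumIdeal : TwoSidedIdeal (MonoidAlgebra K (PrimeHull P)) :=
  TwoSidedIdeal.mk' {a | ∀ s t, unitSum s t a = 0}
    (fun s t => map_zero _)
    (fun hx hy s t => by rw [map_add, hx, hy, add_zero])
    (fun hx s t => by rw [map_neg, hx, neg_zero])
    (fun {x y} hy s t => by
      induction x using MonoidAlgebra.induction_linear with
      | zero => rw [zero_mul, map_zero]
      | add x x' hx hx' => rw [add_mul, map_add, hx, hx', add_zero]
      | single r c => rw [unitSum_single_mul, hy, mul_zero])
    (fun {x y} hx s t => by
      induction y using MonoidAlgebra.induction_linear with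
      | zero => rw [mul_zero, map_zero]
      | add y y' hy hy' => rw [mul_add, map_add, hy, hy', add_zero]
      | single r c => rw [unitSum_mul_single, hx, mul_zero])

theorem mem_unitSumIdeal {a : MonoidAlgebra K (PrimeHull P)} :
    a ∈ unitSumIdeal P K ↔ ∀ s t, unitSum s t a = 0 :=
  TwoSidedIdeal.mem_mk' _ _ _ _ _ _ _

variable (K) in
/-- The sum of the elements of the `p`-component. -/
noncomputable def componentSum (p : P) : MonoidAlgebra K (PrimeHull P) :=
  ∑ c : Multiplicative (ZMod (p.1 : ℕ) × ZMod (p.1 : ℕ)), MonoidAlgebra.single (unit (embed p c)) 1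

theorem zero_notMem_range_unit : (0 : PrimeHull P) ∉ range (unit (P := P)) := by
  rintro ⟨g, hg⟩
  exact unit_ne_zero g hg

/-- For t = u g v*, take a nontrivial c₀ in the p-component that fixes u. Multiplying c by c₀
changes c t only in its group part, so the set of c with s c t ∈ G is stable under c₀ and its
cardinality is 0 in K. -/
theorem componentSum_mem {p : P} (hp : ((p.1 : ℕ) : K) = 0) :
    componentSum K p ∈ unitSumIdeal P K := by
  classical
  refine mem_unitSumIdeal.2 fun s t => ?_
  simp only [componentSum, map_sum, unitSum_single, one_mul]
  rcases eq_zero_or_triple t with rfl | ⟨u, g, v, rfl⟩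
  · refine Finset.sum_eq_zero fun c _ => if_neg ?_
    rw [mul_zero]
    exact zero_notMem_range_unit
  obtain ⟨c₀, hc₀, hfix⟩ := exists_embed_actWord_eq p u
  have := natCast_card_eq_zero hp (fun c => s * unit (embed p c) *
    triple (primeAction P).inflation u g v ∈ range (unit (P := P))) hc₀ fun c hc => by
      have h := mul_triple_mem_range_unit ((primeAction P).inflation.secWord (embed p c₀) u) hc
      rwa [← unit_mul_triple hfix, ← mul_assoc, mul_assoc s, ← unit_mul, ← map_mul] at h
  rw [Finset.sum_boole, ← Fintype.card_subtype]
  exact this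

/-- The sum over the p-component lies in the ideal and has coefficient 1 at the identity, so the
ideal exceeds the line of 0; the functional with s = t = 1 takes the value 1 at the identity, so the
ideal is proper. -/
theorem not_hasOnlyTrivialIdeals {p : P} (hp : ((p.1 : ℕ) : K) = 0) :
    ¬ HasOnlyTrivialIdeals K (PrimeHull P) := by
  classical
  intro h
  have h0 : MonoidAlgebra.single 0 1 ∈ unitSumIdeal P K := mem_unitSumIdeal.2 fun s t => by
    rw [unitSum_single, mul_zero, zero_mul, if_neg zero_notMem_range_unit, mul_zero]
  rcases h (unitSumIdeal P K) h0 with h | h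
  · have h1 := h _ (componentSum_mem hp) 1 one_ne_zero
    rw [componentSum, MonoidAlgebra.coeff_sum, Finsupp.finsetSum_apply,
      Finset.sum_eq_single 1] at h1
    · rw [map_one (embed p), unit_one, MonoidAlgebra.coeff_single, Finsupp.single_eq_same] at h1
      exact one_ne_zero h1
    · intro c _ hc
      rw [MonoidAlgebra.coeff_single, Finsupp.single_eq_of_ne]
      rw [← unit_one, ← map_one (embed p)]
      exact fun h' => hc (embed_injective p (unit_injective h').symm)
    · exact fun h' => absurd (Finset.mem_univ _) h'
  · have h1 := mem_unitSumIdeal.1 h 1 1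
    rw [MonoidAlgebra.one_def, unitSum_single, if_pos ⟨1, by rw [mul_one, mul_one, unit_one]⟩,
      mul_one] at h1
    exact one_ne_zero h1

theorem natCast_ne_zero_iff {p : ℕ} (hp : p.Prime) : (p : K) ≠ 0 ↔ ringChar K ≠ p := by
  rw [not_iff_not, ringChar.spec]
  constructor
  · intro h
    exact ((Nat.dvd_prime hp).1 h).resolve_left (CharP.ringChar_ne_one)
  · intro h
    rw [h]

variable (P K) in
theorem hasOnlyTrivialIdeals_iff :
    HasOnlyTrivialIdeals K (PrimeHull P) ↔ ∀ p ∈ P, ringChar K ≠ (p : ℕ) := by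
  constructor
  · intro h p hp
    rw [← natCast_ne_zero_iff p.2]
    exact fun h0 => not_hasOnlyTrivialIdeals (p := ⟨p, hp⟩) h0 h
  · exact fun h => hasOnlyTrivialIdeals fun p hp => (natCast_ne_zero_iff p.2).2 (h p hp)

variable (K) in
theorem charZero_iff_forall_prime : CharZero K ↔ ∀ p : Nat.Primes, ringChar K ≠ (p : ℕ) := by
  constructor
  · intro h p
    rw [ringChar.eq_zero]
    exact p.2.ne_zero.symm
  · intro h
    rcases CharP.char_is_prime_or_zero K (ringChar K) with h1 | h1
    · exact absurd rfl (h ⟨_, h1⟩)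
    · have : CharP K 0 := h1 ▸ ringChar.charP K
      exact CharP.charP_to_charZero K

end PrimeGroup

end

theorem mainTheorem9 (P : Set Nat.Primes) :
    (primeAction P).inflation.IsFaithful ∧
    (P.Nonempty → Infinite (PrimeAlphabet P × ℕ)) ∧
    Countable (PrimeHull P) ∧
    IsCongruenceFree (PrimeHull P) ∧
    (∀ (K : Type*) [Field K],
      IsSimpleRing (ContractedAlgebra K (PrimeHull P)) ↔ ∀ p ∈ P, ringChar K ≠ (p : ℕ)) ∧
    (P = Set.univ → ∀ (K : Type*) [Field K],
      IsSimpleRing (ContractedAlgebra K (PrimeHull P)) ↔ CharZero K) ∧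
    ArrowGroupoid.IsAmple (InverseMonoidWithZero.UniversalGroupoid (PrimeHull P)) ∧
    SecondCountableTopology (InverseMonoidWithZero.UniversalGroupoid (PrimeHull P)) ∧
    ArrowGroupoid.IsMinimal (InverseMonoidWithZero.UniversalGroupoid (PrimeHull P)) ∧
    ArrowGroupoid.IsEffective (InverseMonoidWithZero.UniversalGroupoid (PrimeHull P)) ∧
    (∀ (K : Type*) [Field K],
      ArrowGroupoid.IsSimpleSteinberg (InverseMonoidWithZero.UniversalGroupoid (PrimeHull P)) K ↔
        ∀ p ∈ P, ringChar K ≠ (p : ℕ)) := by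
  have hsimple : ∀ (K : Type _) [Field K], IsSimpleRing (ContractedAlgebra K (PrimeHull P)) ↔
      ∀ p ∈ P, ringChar K ≠ (p : ℕ) := fun K _ =>
    isSimpleRing_contractedAlgebra_iff.trans (PrimeGroup.hasOnlyTrivialIdeals_iff P K)
  refine ⟨PrimeGroup.isFaithful_inflation, PrimeGroup.infinite_alphabet, inferInstance, ?_,
    hsimple, ?_, InverseMonoidWithZero.UniversalGroupoid.isAmple,
    InverseMonoidWithZero.UniversalGroupoid.secondCountableTopology,
    InverseHull.isMinimal_inflation,
    InverseHull.isEffective_inflation fun _ => PrimeGroup.eq_one_of_act_eq, fun K _ =>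
    (InverseMonoidWithZero.UniversalGroupoid.isSimpleSteinberg_iff K).trans
      (PrimeGroup.hasOnlyTrivialIdeals_iff P K)⟩
  -- One field suffices, and ℚ satisfies the characteristic condition for every P.
  · refine HasOnlyTrivialIdeals.isCongruenceFree (K := ℚ)
      ((PrimeGroup.hasOnlyTrivialIdeals_iff P ℚ).2 fun p _ => ?_)
    exact (PrimeGroup.charZero_iff_forall_prime ℚ).1 inferInstance p
  · rintro rfl K _
    rw [isSimpleRing_contractedAlgebra_iff, PrimeGroup.hasOnlyTrivialIdeals_iff,
      PrimeGroup.charZero_iff_forall_prime]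
    exact ⟨fun h p => h p trivial, fun h p _ => h p⟩
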